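/- **Setting.** Let $\mathsf k$ be a complex Hilbert space and, for an interval $A\subseteq\mathbb R_+=[0,\infty)$, let $\mathcal F_A$ be the Boson Fock space over $L^2(A;\mathsf k)$, with exponential vectors $\varepsilon(f)$. Put $\mathcal F=\mathcal F_{\mathbb R_+}$ and identify $\mathcal F=\mathcal F_{[0,t)}\otimes\mathcal F_{[t,\infty)}$ by $\varepsilon(f)\leftrightarrow\varepsilon(f|_{[0,t)})\otimes\varepsilon(f|_{[t,\infty)})$. All tensor products are Hilbert-space tensor products. For $t\in[0,\infty)$ let $E_t$ be the orthogonal projection onto $\mathcal F_{[0,t)}\otimes\varepsilon(0)$, so that $E_t\varepsilon(f)=\varepsilon(1_{[0,t)}f)$, and let $\Gamma_t\varepsilon(f)=\varepsilon(\theta_tf)$, where $\theta_t$ is the right shift by $t$ on $L^2(\mathbb R_+;\mathsf k)$; put $E_\infty=I$ and $\Gamma_\infty=E_0$. A *finite quantum stop time* is a map $S$ from the Borel sets of $[0,\infty]$ to the orthogonal projections on $\mathcal F$ such that $A\mapsto\langle x,S(A)y\rangle$ is a complex measure for all $x,y\in\mathcal F$, $S([0,\infty])=I$, $S([0,t])\in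 B(\mathcal F_{[0,t)})\otimes I$ for all $t\in(0,\infty)$, and $S(\{0\})=S(\{\infty\})=0$. For $t\in(0,\infty]$ write $$\int_{[0,t]}S(\mathrm ds)\,\Phi(s)=\lim_\pi\sum_{j=1}^{n+1}S\bigl((\pi_{j-1},\pi_j]\bigr)\Phi(\pi_j),$$ the limit being taken over finite partitions $\pi=\{0=\pi_0<\dots<\pi_{n+1}=t\}$ ordered by refinement. For a finite quantum stop time $S$: * $E_{S,t}$ is the orthogonal projection such that $E_{S,t}\varepsilon(f)=\int_{[0,t]}S(\mathrm ds)E_s\varepsilon(f)$ for all $f$; $E_S=E_{S,\infty}$ and $\mathcal F_{S)}=\operatorname{im}E_S$; * $\Gamma_S$ is the isometry such that $\Gamma_Sx=\int_{[0,\infty]}S(\mathrm ds)\Gamma_sx$ for all $x\in\mathcal F$, and $\mathcal F_{[S}=\operatorname{im}\Gamma_S$; * $j_S:\mathcal F_{S)}\otimes\mathcal F_{[S}\to\mathcal F$ is the isometric isomorphism such that $j_S(E_{S,t}\varepsilon(f)\otimes\Gamma_Sx)=\int_{[0,t]}S(\mathrm ds)\,\varepsilon(f|_{[0,s)})\otimes\Gamma_sx$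 for all $t\in(0,\infty]$, $f\in L^2(\mathbb R_+;\mathsf k)$ and $x\in\mathcal F$, where $\Gamma_s$ is regarded as a map onto $\mathcal F_{[s,\infty)}$ and the integrand at $s=\infty$ is $\varepsilon(f)$. For finite quantum stop times $S$ and $T$, $S\otimes T$ is the spectral measure on the Borel sets of $[0,\infty]^2$ such that $(S\otimes T)(A\times B)=j_S\bigl(S(A)|_{\mathcal F_{S)}}\otimes\Gamma_ST(B)\Gamma_S^*\bigr)j_S^*$ for all Borel sets $A,B\subseteq[0,\infty]$, and the convolution is $(S\star T)(C)=(S\otimes T)(\{(s,t):s+t\in C\})$. **Theorem.** Let $S$ and $T$ be finite quantum stop times. The objects above are well defined for $S$ and $T$, $S\star T$ is a finite quantum stop time, and the objects above are well defined for it too. There is an isometric isomorphism $$j_{S,T}:\mathcal F_{S)}\otimes\Gamma_S(\mathcal F_{T)})\otimes\mathcal F_{[S\star T}\to\mathcal F$$ such that, for all $x,y,z\in\mathcal F$, $$j_{S,T}\bigl(E_Sx\otimes\Gamma_SE_Ty\otimes\Gamma_{S\star T}z\bigr)=j_S\bigl(E_Sx\otimes\Gamma_Sj_T(E_Ty\otimes\Gamma_Tz)\bigr).$$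 Moreover $\varepsilon(0)\in\mathcal F_{[S\star T}$, $\varepsilon(0)\in\mathcal F_{S)}$, $$j_{S,T}\bigl(\mathcal F_{S)}\otimes\Gamma_S(\mathcal F_{T)})\otimes\varepsilon(0)\bigr)=j_S\bigl(\mathcal F_{S)}\otimes\Gamma_S(\mathcal F_{T)})\bigr)=\mathcal F_{S\star T)}$$ and $$j_{S,T}\bigl(\varepsilon(0)\otimes\Gamma_S(\mathcal F_{T)})\otimes\mathcal F_{[S\star T}\bigr)=\mathcal F_{[S}.$$ Furthermore, $$j_{S,T}=j_{S\star T}\circ\bigl(j_S|_{\mathcal F_{S)}\otimes\Gamma_S(\mathcal F_{T)})}\otimes I_{\mathcal F_{[S\star T}}\bigr).$$ -/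

import Mathlib

open MeasureTheory Filter
open scoped Topology NNReal ENNReal TensorProduct InnerProductSpace

noncomputable section

namespace StopTime

universe u v w

section Isometry

variable {ι : Type*} {E F : Type*} [NormedAddCommGroup E] [InnerProductSpace ℂ E]
  [NormedAddCommGroup F] [InnerProductSpace ℂ F]

theorem norm_linearCombination_eq {a : ι → E} {b : ι → F}
    (h : ∀ i j, ⟪b i, b j⟫_ℂ = ⟪a i, a j⟫_ℂ) (x : ι →₀ ℂ) :
    ‖Finsupp.linearCombination ℂ b x‖ = ‖Finsupp.linearCombination ℂ a x‖ := by
  have : ⟪Finsupp.linearCombination ℂ b x, Finsupp.linearCombination ℂ b x⟫_ℂ =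
      ⟪Finsupp.linearCombination ℂ a x, Finsupp.linearCombination ℂ a x⟫_ℂ := by
    simp only [Finsupp.linearCombination_apply, Finsupp.sum, sum_inner, inner_sum,
      inner_smul_left, inner_smul_right, h]
  rw [inner_self_eq_norm_sq_to_K, inner_self_eq_norm_sq_to_K] at this
  have h2 : ‖Finsupp.linearCombination ℂ b x‖ ^ 2 = ‖Finsupp.linearCombination ℂ a x‖ ^ 2 := by
    exact_mod_cast this
  exact (pow_left_inj₀ (norm_nonneg _) (norm_nonneg _) two_ne_zero).1 h2

theorem denseRange_linearCombination {a : ι → E}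
    (ha : (Submodule.span ℂ (Set.range a)).topologicalClosure = ⊤) :
    DenseRange (Finsupp.linearCombination ℂ a) := by
  have h : Dense ((Submodule.span ℂ (Set.range a) : Submodule ℂ E) : Set E) :=
    (Submodule.dense_iff_topologicalClosure_eq_top).2 ha
  rw [← Finsupp.range_linearCombination] at h
  exact h

/-- The unique linear isometry with `a i ↦ b i`, where `a` is a total family in `E` and `b` is a
family in the Hilbert space `F` with the same inner products. -/
def isometryOfTotal [CompleteSpace F] (a : ι → E) (b : ι → F)
    (ha : (Submodule.span ℂ (Set.range a)).topologicalClosure = ⊤)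
    (h : ∀ i j, ⟪b i, b j⟫_ℂ = ⟪a i, a j⟫_ℂ) : E →ₗᵢ[ℂ] F where
  toLinearMap := ((Finsupp.linearCombination ℂ b).extendOfNorm
    (Finsupp.linearCombination ℂ a)).toLinearMap
  norm_map' := by
    have hd := denseRange_linearCombination ha
    intro x
    refine hd.induction (P := fun x => ‖((Finsupp.linearCombination ℂ b).extendOfNorm
      (Finsupp.linearCombination ℂ a)) x‖ = ‖x‖) ?_ (isClosed_eq (by fun_prop) (by fun_prop)) x
    rintro _ ⟨y, rfl⟩
    rw [LinearMap.extendOfNorm_eq hd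
      ⟨1, fun x => by rw [one_mul, norm_linearCombination_eq h]⟩]
    exact norm_linearCombination_eq h y

theorem isometryOfTotal_apply [CompleteSpace F] (a : ι → E) (b : ι → F)
    (ha : (Submodule.span ℂ (Set.range a)).topologicalClosure = ⊤)
    (h : ∀ i j, ⟪b i, b j⟫_ℂ = ⟪a i, a j⟫_ℂ) (i : ι) :
    isometryOfTotal a b ha h (a i) = b i := by
  have hd := denseRange_linearCombination ha
  have := LinearMap.extendOfNorm_eq (f := Finsupp.linearCombination ℂ b) hd
    ⟨1, fun x => by rw [one_mul, norm_linearCombination_eq h]⟩ (Finsupp.single i 1)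
  simp only [Finsupp.linearCombination_single, one_smul] at this
  exact this

end Isometry

section HilbertTensor

/-- The Hilbert-space tensor product. -/
abbrev HTensor (E : Type v) (F : Type w) [NormedAddCommGroup E] [InnerProductSpace ℂ E]
    [NormedAddCommGroup F] [InnerProductSpace ℂ F] : Type (max v w) :=
  UniformSpace.Completion (E ⊗[ℂ] F)

infixl:100 " ⊗ᴴ " => HTensor

variable {E F E' F' : Type*} [NormedAddCommGroup E] [InnerProductSpace ℂ E]
  [NormedAddCommGroup F] [InnerProductSpace ℂ F] [NormedAddCommGroup E'] [InnerProductSpace ℂ E']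
  [NormedAddCommGroup F'] [InnerProductSpace ℂ F']

/-- The elementary tensor `x ⊗ y`. -/
def htmul (x : E) (y : F) : E ⊗ᴴ F := ((x ⊗ₜ[ℂ] y : E ⊗[ℂ] F) : UniformSpace.Completion (E ⊗[ℂ] F))

theorem inner_htmul (x x' : E) (y y' : F) :
    ⟪htmul x y, htmul x' y'⟫_ℂ = ⟪x, x'⟫_ℂ * ⟪y, y'⟫_ℂ := by
  simp [htmul]

/-- The tensor product `A ⊗ B` of two bounded operators. -/
def hmap (A : E →L[ℂ] E') (B : F →L[ℂ] F') : E ⊗ᴴ F →L[ℂ] E' ⊗ᴴ F' :=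
  (TensorProduct.mapL A B).completion

theorem hmap_htmul (A : E →L[ℂ] E') (B : F →L[ℂ] F') (x : E) (y : F) :
    hmap A B (htmul x y) = htmul (A x) (B y) := by
  simp [hmap, htmul]

theorem htmul_total {ι κ : Type*} {a : ι → E} {b : κ → F}
    (ha : (Submodule.span ℂ (Set.range a)).topologicalClosure = ⊤)
    (hb : (Submodule.span ℂ (Set.range b)).topologicalClosure = ⊤) :
    (Submodule.span ℂ (Set.range fun p : ι × κ => htmul (a p.1) (b p.2))).topologicalClosure
      = ⊤ := by
  set K := (Submodule.span ℂ (Set.range fun p : ι × κ => htmul (a p.1) (b p.2))).topologicalClosure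
    with hK
  have hKc : IsClosed (K : Set (E ⊗ᴴ F)) := Submodule.isClosed_topologicalClosure _
  let m : E →L[ℂ] F →L[ℂ] E ⊗ᴴ F :=
    (ContinuousLinearMap.compL ℂ F (E ⊗[ℂ] F) (E ⊗ᴴ F) UniformSpace.Completion.toComplL).comp
      (TensorProduct.mkL ℂ E F)
  have hm : ∀ x y, m x y = htmul x y := fun x y => rfl
  have h1 : ∀ i y, htmul (a i) y ∈ K := by
    intro i y
    have : (Submodule.span ℂ (Set.range b)).topologicalClosure ≤
        K.comap (m (a i)).toLinearMap := by
      refine Submodule.topologicalClosure_minimal _ ?_ (hKc.preimage (m (a i)).continuous)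
      rw [Submodule.span_le]
      rintro _ ⟨j, rfl⟩
      exact Submodule.le_topologicalClosure _ (Submodule.subset_span ⟨(i, j), rfl⟩)
    rw [hb] at this
    exact this (Submodule.mem_top (x := y))
  have h2 : ∀ x y, htmul x y ∈ K := by
    intro x y
    have : (Submodule.span ℂ (Set.range a)).topologicalClosure ≤
        K.comap (m.flip y).toLinearMap := by
      refine Submodule.topologicalClosure_minimal _ ?_ (hKc.preimage (m.flip y).continuous)
      rw [Submodule.span_le]
      rintro _ ⟨i, rfl⟩
      exact h1 i y
    rw [ha] at this
    exact this (Submodule.mem_top (x := x))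
  rw [eq_top_iff]
  intro z _
  refine UniformSpace.Completion.induction_on z hKc fun t => ?_
  induction t using TensorProduct.induction_on with
  | zero => exact K.zero_mem
  | tmul x y => exact h2 x y
  | add s t hs ht => 
    rw [UniformSpace.Completion.coe_add]
    exact K.add_mem hs ht

end HilbertTensor

section Fock

/-- A bundled complex Hilbert space, used only to define tensor powers by recursion. -/
structure HilbertObj : Type (u + 1) where
  carrier : Type u
  [nacg : NormedAddCommGroup carrier]
  [ips : InnerProductSpace ℂ carrier]
  [complete : CompleteSpace carrier]

attribute [instance] HilbertObj.nacg HilbertObj.ips HilbertObj.complete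

variable (H : Type u) [NormedAddCommGroup H] [InnerProductSpace ℂ H]

/-- The `n`-fold Hilbert-space tensor power of `H`; the zeroth power is one dimensional. -/
def tensorPow : ℕ → HilbertObj.{u}
  | 0 => ⟨EuclideanSpace ℂ PUnit.{u + 1}⟩
  | n + 1 => ⟨H ⊗ᴴ (tensorPow n).carrier⟩

variable {H} in
/-- The vector `f ⊗ ⋯ ⊗ f` in the `n`-fold tensor power. -/
def diag (f : H) : (n : ℕ) → (tensorPow H n).carrier
  | 0 => EuclideanSpace.single PUnit.unit (1 : ℂ)
  | n + 1 => htmul f (diag f n)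

variable {H} in
theorem inner_diag (f g : H) (n : ℕ) : ⟪diag f n, diag g n⟫_ℂ = ⟪f, g⟫_ℂ ^ n := by
  induction n with
  | zero => 
    change ⟪EuclideanSpace.single PUnit.unit (1 : ℂ), EuclideanSpace.single PUnit.unit (1 : ℂ)⟫_ℂ
      = _
    simp
  | succ n ih =>
    change ⟪htmul f (diag f n), htmul g (diag g n)⟫_ℂ = _
    rw [inner_htmul, ih, pow_succ']

/-- The `n`-fold symmetric tensor power of `H`, the closed linear span of the vectors
`f ⊗ ⋯ ⊗ f`. -/
def symPow (n : ℕ) : Submodule ℂ (tensorPow H n).carrier :=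
  (Submodule.span ℂ (Set.range fun f : H => diag f n)).topologicalClosure

/-- The Boson Fock space over `H` as a subspace of the full Fock space: the Hilbert-space direct sum
of the symmetric tensor powers of `H`. -/
def fockSubmodule : Submodule ℂ (lp (fun n => (tensorPow H n).carrier) 2) where
  carrier := {x | ∀ n, x n ∈ symPow H n}
  add_mem' hx hy n := (symPow H n).add_mem (hx n) (hy n)
  zero_mem' n := (symPow H n).zero_mem
  smul_mem' c _ hx n := (symPow H n).smul_mem c (hx n)

/-- The Boson Fock space over `H`. -/
def Fock : Type u := fockSubmodule H

instance : NormedAddCommGroup (Fock H) := inferInstanceAs (NormedAddCommGroup (fockSubmodule H))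

instance : InnerProductSpace ℂ (Fock H) := inferInstanceAs (InnerProductSpace ℂ (fockSubmodule H))

instance : CompleteSpace (Fock H) := by
  have hc : IsClosed (fockSubmodule H : Set (lp (fun n => (tensorPow H n).carrier) 2)) := by
    have : (fockSubmodule H : Set (lp (fun n => (tensorPow H n).carrier) 2)) =
        ⋂ n, (fun x : lp (fun n => (tensorPow H n).carrier) 2 => x n) ⁻¹' (symPow H n) := by
      ext x
      simp only [Set.mem_iInter, Set.mem_preimage]
      rfl
    rw [this]
    refine isClosed_iInter fun n => IsClosed.preimage ?_ (Submodule.isClosed_topologicalClosure _)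
    exact (continuous_apply n).comp (lp.uniformContinuous_coe
      (E := fun n => (tensorPow H n).carrier) (p := 2)).continuous
  exact hc.completeSpace_coe

variable {H}

theorem memℓp_diag (f : H) :
    Memℓp (fun n => ((Real.sqrt n.factorial : ℂ)⁻¹ • diag f n : (tensorPow H n).carrier)) 2 := by
  refine memℓp_gen ?_
  have h : ∀ n, ‖((Real.sqrt n.factorial : ℂ)⁻¹ • diag f n : (tensorPow H n).carrier)‖ ^
      (2 : ℝ≥0∞).toReal = (‖f‖ ^ 2) ^ n / n.factorial := by
    intro n
    have h1 : ‖diag f n‖ ^ 2 = (‖f‖ ^ 2) ^ n := by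
      have := inner_diag f f n
      rw [inner_self_eq_norm_sq_to_K, inner_self_eq_norm_sq_to_K] at this
      exact_mod_cast this
    rw [norm_smul, ENNReal.toReal_ofNat, Real.rpow_ofNat, mul_pow, h1, norm_inv, inv_pow,
      Complex.norm_real, Real.norm_eq_abs, sq_abs, Real.sq_sqrt (by positivity)]
    ring
  simp_rw [h]
  exact Real.summable_pow_div_factorial _

/-- The exponential vector `ε(f)`, whose component in the `n`-th symmetric power is
`(n!)^{-1/2} f ⊗ ⋯ ⊗ f`. -/
def expVec (f : H) : Fock H :=
  ⟨⟨fun n => (Real.sqrt n.factorial : ℂ)⁻¹ • diag f n, memℓp_diag f⟩, fun n =>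
    (symPow H n).smul_mem _ (Submodule.le_topologicalClosure _ (Submodule.subset_span ⟨f, rfl⟩))⟩

theorem inner_expVec (f g : H) : ⟪expVec f, expVec g⟫_ℂ = Complex.exp ⟪f, g⟫_ℂ := by
  have h1 : ⟪expVec f, expVec g⟫_ℂ = ∑' n : ℕ, ⟪((Real.sqrt n.factorial : ℂ)⁻¹ • diag f n),
      ((Real.sqrt n.factorial : ℂ)⁻¹ • diag g n)⟫_ℂ :=
    lp.inner_eq_tsum (𝕜 := ℂ) (expVec f).1 (expVec g).1
  rw [h1, Complex.exp_eq_exp_ℂ, NormedSpace.exp_eq_tsum_div]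
  refine tsum_congr fun n => ?_
  rw [inner_smul_left, inner_smul_right, inner_diag, ← mul_assoc, map_inv₀, Complex.conj_ofReal,
    ← mul_inv, ← Complex.ofReal_mul, Real.mul_self_sqrt (by positivity)]
  push_cast
  field_simp

theorem expVec_total :
    (Submodule.span ℂ (Set.range (expVec : H → Fock H))).topologicalClosure = ⊤ := by
  rw [Submodule.topologicalClosure_eq_top_iff, Submodule.eq_bot_iff]
  intro x hx
  have h0 : ∀ f : H, ⟪x, expVec f⟫_ℂ = 0 := fun f =>
    (Submodule.mem_orthogonal' _ _).1 hx _ (Submodule.subset_span ⟨f, rfl⟩)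
  have h1 : ∀ (f : H) (n : ℕ), ⟪x.1 n, diag f n⟫_ℂ = 0 := by
    intro f
    let c : ℕ → ℂ := fun n => (Real.sqrt n.factorial : ℂ)⁻¹ * ⟪x.1 n, diag f n⟫_ℂ
    have hd : ∀ (z : ℂ) (n : ℕ), diag (z • f) n = z ^ n • diag f n := by
      intro z n
      induction n with
      | zero => rw [pow_zero, one_smul]; rfl
      | succ n ih =>
        change htmul (z • f) (diag (z • f) n) = z ^ (n + 1) • htmul f (diag f n)
        rw [ih, htmul, htmul, TensorProduct.smul_tmul_smul, UniformSpace.Completion.coe_smul,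
          pow_succ']
    have hs : ∀ z : ℂ, HasSum (fun n => z ^ n • c n) 0 := by
      intro z
      have h2 := lp.hasSum_inner (𝕜 := ℂ) x.1 (expVec (z • f)).1
      have h3 : ⟪x.1, (expVec (z • f)).1⟫_ℂ = 0 := h0 (z • f)
      rw [h3] at h2
      refine h2.congr_fun fun n => ?_
      change z ^ n • c n = ⟪x.1 n, (Real.sqrt n.factorial : ℂ)⁻¹ • diag (z • f) n⟫_ℂ
      rw [hd, inner_smul_right, inner_smul_right, smul_eq_mul]
      ring
    have hp : HasFPowerSeriesAt (0 : ℂ → ℂ) (FormalMultilinearSeries.ofScalars ℂ c) 0 := by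
      rw [hasFPowerSeriesAt_iff]
      refine Filter.Eventually.of_forall fun z => ?_
      simpa [FormalMultilinearSeries.coeff_ofScalars] using hs z
    intro n
    have h4 : (FormalMultilinearSeries.ofScalars ℂ c).coeff n = 0 := by
      rw [hp.eq_zero]; rfl
    rw [FormalMultilinearSeries.coeff_ofScalars] at h4
    refine (mul_eq_zero.1 h4).resolve_left ?_
    have : (0 : ℝ) < Real.sqrt n.factorial := Real.sqrt_pos.2 (by positivity)
    exact inv_ne_zero (by exact_mod_cast this.ne')
  have h2 : ∀ n, x.1 n = 0 := by
    intro n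
    have hle : symPow H n ≤ (ℂ ∙ (x.1 n))ᗮ := by
      refine Submodule.topologicalClosure_minimal _ ?_ (Submodule.isClosed_orthogonal _)
      rw [Submodule.span_le]
      rintro _ ⟨f, rfl⟩
      exact Submodule.mem_orthogonal_singleton_iff_inner_right.2 (h1 f n)
    exact inner_self_eq_zero.1 (Submodule.mem_orthogonal_singleton_iff_inner_right.1
      (hle (x.2 n)))
  exact Subtype.ext (lp.ext (funext h2))

/-- The second quantisation `ε(f) ↦ ε(θ f)` of an isometry `θ`. -/
def secondQuant {H' : Type v} [NormedAddCommGroup H'] [InnerProductSpace ℂ H'] (θ : H →ₗᵢ[ℂ] H') :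
    Fock H →ₗᵢ[ℂ] Fock H' :=
  isometryOfTotal expVec (fun f => expVec (θ f)) expVec_total fun f g => by
    rw [inner_expVec, inner_expVec, θ.inner_map_map]

/-- The map `ε(f) ⊗ ε(g) ↦ ε(i f + j g)` for isometries `i` and `j` with orthogonal ranges. -/
def fockMul {H₁ : Type v} {H₂ : Type w} [NormedAddCommGroup H₁] [InnerProductSpace ℂ H₁]
    [NormedAddCommGroup H₂] [InnerProductSpace ℂ H₂] (i : H₁ →ₗᵢ[ℂ] H) (j : H₂ →ₗᵢ[ℂ] H)
    (hij : ∀ f g, ⟪i f, j g⟫_ℂ = 0) : Fock H₁ ⊗ᴴ Fock H₂ →ₗᵢ[ℂ] Fock H :=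
  isometryOfTotal (fun p : H₁ × H₂ => htmul (expVec p.1) (expVec p.2))
    (fun p => expVec (i p.1 + j p.2)) (htmul_total expVec_total expVec_total) fun p q => by
      have h : ∀ f g, ⟪j g, i f⟫_ℂ = 0 := fun f g => by rw [← inner_conj_symm, hij, map_zero]
      rw [inner_htmul, inner_expVec, inner_expVec, inner_expVec, ← Complex.exp_add,
        inner_add_left, inner_add_right, inner_add_right, i.inner_map_map, j.inner_map_map,
        hij, h, add_zero, zero_add]

theorem secondQuant_expVec {H' : Type v} [NormedAddCommGroup H'] [InnerProductSpace ℂ H']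
    (θ : H →ₗᵢ[ℂ] H') (f : H) : secondQuant θ (expVec f) = expVec (θ f) :=
  isometryOfTotal_apply _ _ _ _ f

theorem fockMul_htmul {H₁ : Type v} {H₂ : Type w} [NormedAddCommGroup H₁] [InnerProductSpace ℂ H₁]
    [NormedAddCommGroup H₂] [InnerProductSpace ℂ H₂] (i : H₁ →ₗᵢ[ℂ] H) (j : H₂ →ₗᵢ[ℂ] H)
    (hij : ∀ f g, ⟪i f, j g⟫_ℂ = 0) (f : H₁) (g : H₂) :
    fockMul i j hij (htmul (expVec f) (expVec g)) = expVec (i f + j g) :=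
  isometryOfTotal_apply (fun p : H₁ × H₂ => htmul (expVec p.1) (expVec p.2))
    (fun p => expVec (i p.1 + j p.2)) _ _ (f, g)

end Fock

section HalfLine

variable (k : Type u) [NormedAddCommGroup k] [InnerProductSpace ℂ k]

/-- `L²(A; k)` for a set `A` of real numbers. -/
abbrev L2 (A : Set ℝ) : Type u := Lp k 2 (volume.restrict A)

variable {k} {A B : Set ℝ}

/-- Restriction of functions from `B` to a subset `A`. -/
def restrictL2 (hAB : A ⊆ B) (f : L2 k B) : L2 k A :=
  ((Lp.memLp f).mono_measure (Measure.restrict_mono hAB le_rfl)).toLp f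

set_option linter.unusedSectionVars false in
theorem memLp_indicator (hA : MeasurableSet A) (hAB : A ⊆ B) (f : L2 k A) :
    MemLp (A.indicator f) 2 (volume.restrict B) := by
  rw [memLp_indicator_iff_restrict hA, Measure.restrict_restrict hA, Set.inter_eq_left.2 hAB]
  exact Lp.memLp f

set_option linter.unusedSectionVars false in
theorem indicator_ae_eq (hA : MeasurableSet A) (hAB : A ⊆ B) {f g : ℝ → k}
    (h : f =ᵐ[volume.restrict A] g) :
    A.indicator f =ᵐ[volume.restrict B] A.indicator g := by
  have h2 : volume.restrict A = (volume.restrict B).restrict A := by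
    rw [Measure.restrict_restrict hA, Set.inter_eq_left.2 hAB]
  rw [h2] at h
  filter_upwards [(ae_restrict_iff' hA).1 h] with x hx
  by_cases hxA : x ∈ A
  · rw [Set.indicator_of_mem hxA, Set.indicator_of_mem hxA, hx hxA]
  · rw [Set.indicator_of_notMem hxA, Set.indicator_of_notMem hxA]

/-- Extension by zero of functions from `A` to a larger set `B`. -/
def extendL2 (hA : MeasurableSet A) (hAB : A ⊆ B) : L2 k A →ₗᵢ[ℂ] L2 k B where
  toFun f := (memLp_indicator hA hAB f).toLp _
  map_add' f g := by
    rw [← MemLp.toLp_add, MemLp.toLp_eq_toLp_iff, ← Set.indicator_add']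
    exact indicator_ae_eq hA hAB (Lp.coeFn_add f g)
  map_smul' c f := by
    rw [RingHom.id_apply, ← MemLp.toLp_const_smul, MemLp.toLp_eq_toLp_iff,
      show c • A.indicator (f : ℝ → k) = A.indicator (c • (f : ℝ → k)) from
        (Set.indicator_const_smul A c (f : ℝ → k)).symm]
    exact indicator_ae_eq hA hAB (Lp.coeFn_smul c f)
  norm_map' f := by
    change ‖(memLp_indicator hA hAB f).toLp _‖ = ‖f‖
    rw [Lp.norm_toLp, eLpNorm_indicator_eq_eLpNorm_restrict hA, Measure.restrict_restrict hA,
      Set.inter_eq_left.2 hAB, Lp.norm_def]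

theorem extendL2_inner {A' : Set ℝ} (hA : MeasurableSet A) (hAB : A ⊆ B) (hA' : MeasurableSet A')
    (hAB' : A' ⊆ B) (hd : Disjoint A A') (f : L2 k A) (g : L2 k A') :
    ⟪extendL2 hA hAB f, extendL2 hA' hAB' g⟫_ℂ = 0 := by
  rw [L2.inner_def]
  refine integral_eq_zero_of_ae ?_
  filter_upwards [(memLp_indicator hA hAB f).coeFn_toLp, (memLp_indicator hA' hAB' g).coeFn_toLp]
    with x h1 h2
  change ⟪((memLp_indicator hA hAB f).toLp _ : ℝ → k) x,
    ((memLp_indicator hA' hAB' g).toLp _ : ℝ → k) x⟫_ℂ = 0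
  rw [h1, h2]
  by_cases hx : x ∈ A
  · rw [Set.indicator_of_notMem (Set.disjoint_left.1 hd hx), inner_zero_right]
  · rw [Set.indicator_of_notMem hx, inner_zero_left]

theorem Ico_subset_halfLine (t : ℝ≥0) : Set.Ico 0 (t : ℝ) ⊆ Set.Ici 0 := fun _ h => h.1

theorem Ici_subset_halfLine (t : ℝ≥0) : Set.Ici (t : ℝ) ⊆ Set.Ici 0 :=
  Set.Ici_subset_Ici.2 t.2

theorem measurePreserving_shift (t : ℝ≥0) : MeasurePreserving (fun s : ℝ => s - t)
    (volume.restrict (Set.Ici (t : ℝ))) (volume.restrict (Set.Ici 0)) := by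
  have h := (measurePreserving_sub_right (volume : Measure ℝ) (t : ℝ)).restrict_preimage
    (s := Set.Ici 0) measurableSet_Ici
  have h2 : (fun s : ℝ => s - t) ⁻¹' Set.Ici 0 = Set.Ici (t : ℝ) := by
    ext s
    simp
  rwa [h2] at h

/-- The right shift `f ↦ f(· - t)` from `L²([0, ∞); k)` onto `L²([t, ∞); k)`. -/
def shiftL2 (t : ℝ≥0) : L2 k (Set.Ici 0) →ₗᵢ[ℂ] L2 k (Set.Ici (t : ℝ)) :=
  Lp.compMeasurePreservingₗᵢ ℂ (fun s : ℝ => s - t) (measurePreserving_shift t)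

variable (k) in
/-- The Boson Fock space over `L²([0, ∞); k)`. -/
abbrev FockR : Type u := Fock (L2 k (Set.Ici 0))

/-- The vacuum vector `ε(0)`. -/
def vac : FockR k := expVec 0

/-- The identification of the tensor product of the Fock spaces over `L²([0, t); k)` and
`L²([t, ∞); k)` with the Fock space over `L²([0, ∞); k)`, such that
`ε(f|[0, t)) ⊗ ε(f|[t, ∞)) ↦ ε(f)`. -/
def splitAt (t : ℝ≥0) :
    Fock (L2 k (Set.Ico 0 (t : ℝ))) ⊗ᴴ Fock (L2 k (Set.Ici (t : ℝ))) →ₗᵢ[ℂ] FockR k :=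
  fockMul (extendL2 measurableSet_Ico (Ico_subset_halfLine t))
    (extendL2 measurableSet_Ici (Ici_subset_halfLine t))
    (extendL2_inner _ _ _ _ (Set.disjoint_left.2 fun _ h h' => absurd h.2 (not_lt.2 h')))

variable (k) in
/-- The projection `E_t` onto `F_{[0, t)} ⊗ ε(0)`, with `E_∞ = I`. -/
def timeProj (t : ℝ≥0∞) : FockR k →L[ℂ] FockR k :=
  if t = ⊤ then 1 else
    (Submodule.span ℂ (Set.range fun x : Fock (L2 k (Set.Ico 0 (t.toNNReal : ℝ))) =>
      splitAt t.toNNReal (htmul x (expVec 0)))).topologicalClosure.starProjection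

variable (k) in
/-- The second quantised right shift `Γ_t : ε(f) ↦ ε(θ_t f)`, with `Γ_∞ = E_0`. -/
def shiftOp (t : ℝ≥0∞) : FockR k →L[ℂ] FockR k :=
  if t = ⊤ then timeProj k 0 else
    (secondQuant ((extendL2 measurableSet_Ici (Ici_subset_halfLine t.toNNReal)).comp
      (shiftL2 t.toNNReal))).toContinuousLinearMap

end HalfLine

section StopTimes

/-- A (projection-valued) spectral measure; only the values on measurable sets matter. -/
structure IsSpectralMeasure {α : Type v} [MeasurableSpace α] {E : Type w} [NormedAddCommGroup E]
    [InnerProductSpace ℂ E] [CompleteSpace E] (P : Set α → E →L[ℂ] E) : Prop where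
  isStarProjection : ∀ A, MeasurableSet A → IsStarProjection (P A)
  complexMeasure : ∀ x y : E, ∃ μ : ComplexMeasure α, ∀ A, MeasurableSet A → μ A = ⟪x, P A y⟫_ℂ
  total : P Set.univ = 1

variable {k : Type u} [NormedAddCommGroup k] [InnerProductSpace ℂ k]

/-- A quantum stop time: an identity-adapted spectral measure on `[0, ∞]`. -/
structure IsQuantumStopTime (S : Set ℝ≥0∞ → FockR k →L[ℂ] FockR k) : Prop
    extends IsSpectralMeasure S where
  scalar_zero : ∃ c : ℂ, S {0} = c • 1
  adapted : ∀ t : ℝ≥0, 0 < t →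
    ∃ X : Fock (L2 k (Set.Ico 0 (t : ℝ))) →L[ℂ] Fock (L2 k (Set.Ico 0 (t : ℝ))),
      ∀ z, S (Set.Icc 0 (t : ℝ≥0∞)) (splitAt t z) =
        splitAt t (hmap X (ContinuousLinearMap.id ℂ (Fock (L2 k (Set.Ici (t : ℝ))))) z)

/-- A finite quantum stop time with no mass at `0`. -/
structure IsFiniteStopTime (S : Set ℝ≥0∞ → FockR k →L[ℂ] FockR k) : Prop
    extends IsQuantumStopTime S where
  zero_eq : S {0} = 0
  top_eq : S {⊤} = 0

/-- Partitions `0 = π₀ < π₁ < ⋯ < πₙ₊₁ = t`, given by the set of their interior points and ordered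
by refinement. -/
abbrev Partition (t : ℝ≥0∞) : Type := Finset (Set.Ioo (0 : ℝ≥0∞) t)

/-- The points `π₁, …, πₙ₊₁` of a partition. -/
def Partition.points {t : ℝ≥0∞} (π : Partition t) : Finset ℝ≥0∞ :=
  insert t (π.map (Function.Embedding.subtype _))

/-- The point of a partition that precedes `p`; it is `0` for the first point. -/
def Partition.pred {t : ℝ≥0∞} (π : Partition t) (p : ℝ≥0∞) : ℝ≥0∞ :=
  (π.points.filter (· < p)).sup id

/-- The Riemann sum `∑ⱼ S((πⱼ₋₁, πⱼ]) Φ(πⱼ)`. -/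
def stopSum (S : Set ℝ≥0∞ → FockR k →L[ℂ] FockR k) (t : ℝ≥0∞) (Φ : ℝ≥0∞ → FockR k)
    (π : Partition t) : FockR k :=
  ∑ p ∈ π.points, S (Set.Ioc (π.pred p) p) (Φ p)

/-- `∫_{[0, t]} S(ds) Φ(s) = v`, as the limit of Riemann sums over partitions ordered by
refinement. -/
def HasStopIntegral (S : Set ℝ≥0∞ → FockR k →L[ℂ] FockR k) (t : ℝ≥0∞) (Φ : ℝ≥0∞ → FockR k)
    (v : FockR k) : Prop :=
  Tendsto (stopSum S t Φ) atTop (𝓝 v)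

/-- `L` is the projection `E_{S, t}`, which sends `ε(f)` to `∫_{[0, t]} S(ds) E_s ε(f)`. -/
def IsStopProj (S : Set ℝ≥0∞ → FockR k →L[ℂ] FockR k) (t : ℝ≥0∞) (L : FockR k →L[ℂ] FockR k) :
    Prop :=
  IsStarProjection L ∧ ∀ f, HasStopIntegral S t (fun s => timeProj k s (expVec f)) (L (expVec f))

open Classical in
/-- The projection `E_{S, t}`. -/
def stopProj (S : Set ℝ≥0∞ → FockR k →L[ℂ] FockR k) (t : ℝ≥0∞) : FockR k →L[ℂ] FockR k :=
  if h : ∃ L, IsStopProj S t L then h.choose else 0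

/-- `L` is the isometry `Γ_S`, which sends `x` to `∫_{[0, ∞]} S(ds) Γ_s x`. -/
def IsStopShift (S : Set ℝ≥0∞ → FockR k →L[ℂ] FockR k) (L : FockR k →L[ℂ] FockR k) : Prop :=
  Isometry L ∧ ∀ x, HasStopIntegral S ⊤ (fun s => shiftOp k s x) (L x)

open Classical in
/-- The stopped right shift `Γ_S`. -/
def stopShift (S : Set ℝ≥0∞ → FockR k →L[ℂ] FockR k) : FockR k →L[ℂ] FockR k :=
  if h : ∃ L, IsStopShift S L then h.choose else 0

/-- The pre-`S` space, the range of `E_S = E_{S, ∞}`. -/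
def preSpace (S : Set ℝ≥0∞ → FockR k →L[ℂ] FockR k) : Submodule ℂ (FockR k) :=
  LinearMap.range (stopProj S ⊤).toLinearMap

/-- The post-`S` space, the range of `Γ_S`. -/
def postSpace (S : Set ℝ≥0∞ → FockR k →L[ℂ] FockR k) : Submodule ℂ (FockR k) :=
  LinearMap.range (stopShift S).toLinearMap

/-- The image under `Γ_S` of the pre-`T` space. -/
def shiftedPre (S T : Set ℝ≥0∞ → FockR k →L[ℂ] FockR k) : Submodule ℂ (FockR k) :=
  (preSpace T).map (stopShift S).toLinearMap

theorem shiftedPre_le (S T : Set ℝ≥0∞ → FockR k →L[ℂ] FockR k) : shiftedPre S T ≤ postSpace S :=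
  LinearMap.map_le_range

/-- `E_S x` as an element of the pre-`S` space. -/
def toPre (S : Set ℝ≥0∞ → FockR k →L[ℂ] FockR k) (x : FockR k) : preSpace S :=
  ⟨stopProj S ⊤ x, LinearMap.mem_range_self _ x⟩

/-- `Γ_S x` as an element of the post-`S` space. -/
def toPost (S : Set ℝ≥0∞ → FockR k →L[ℂ] FockR k) (x : FockR k) : postSpace S :=
  ⟨stopShift S x, LinearMap.mem_range_self _ x⟩

/-- `Γ_S E_T y` as an element of the image of the pre-`T` space under `Γ_S`. -/
def toShiftedPre (S T : Set ℝ≥0∞ → FockR k →L[ℂ] FockR k) (y : FockR k) : shiftedPre S T :=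
  ⟨stopShift S (stopProj T ⊤ y), Submodule.mem_map_of_mem (LinearMap.mem_range_self _ y)⟩

/-- The inclusion of the image of the pre-`T` space under `Γ_S` into the post-`S` space. -/
def shiftedPreIncl (S T : Set ℝ≥0∞ → FockR k →L[ℂ] FockR k) : shiftedPre S T →L[ℂ] postSpace S :=
  (shiftedPre S T).subtypeL.codRestrict (postSpace S) fun b => shiftedPre_le S T b.2

/-- The integrand `ε(f|[0, s)) ⊗ Γ_s x`, where `Γ_s` has range in the Fock space over
`L²([s, ∞); k)`; by convention it is `ε(f)` at `s = ∞`. -/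
def isoIntegrand (f : L2 k (Set.Ici 0)) (x : FockR k) (s : ℝ≥0∞) : FockR k :=
  if s = ⊤ then expVec f else
    splitAt s.toNNReal (htmul (expVec (restrictL2 (Ico_subset_halfLine s.toNNReal) f))
      (secondQuant (shiftL2 s.toNNReal) x))

/-- `j` is the isometric isomorphism `j_S`, which sends `E_{S, t} ε(f) ⊗ Γ_S x` to
`∫_{[0, t]} S(ds) ε(f|[0, s)) ⊗ Γ_s x` for all `t ∈ (0, ∞]`. -/
def IsStopIso (S : Set ℝ≥0∞ → FockR k →L[ℂ] FockR k)
    (j : preSpace S ⊗ᴴ postSpace S ≃ₗᵢ[ℂ] FockR k) : Prop :=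
  ∀ (t : ℝ≥0∞), 0 < t → ∀ (f : L2 k (Set.Ici 0)) (x : FockR k),
    ∃ h : stopProj S t (expVec f) ∈ preSpace S,
      HasStopIntegral S t (isoIntegrand f x) (j (htmul ⟨stopProj S t (expVec f), h⟩ (toPost S x)))

/-- `P` is the spectral measure `S ⊗ T` on `[0, ∞]²`, which is such that
`P(A × B) = j_S (S(A) ⊗ Γ_S T(B) Γ_S^*) j_S^*`. -/
def IsStopTensor (S T : Set ℝ≥0∞ → FockR k →L[ℂ] FockR k)
    (j : preSpace S ⊗ᴴ postSpace S ≃ₗᵢ[ℂ] FockR k)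
    (P : Set (ℝ≥0∞ × ℝ≥0∞) → FockR k →L[ℂ] FockR k) : Prop :=
  IsSpectralMeasure P ∧ ∀ A B : Set ℝ≥0∞, MeasurableSet A → MeasurableSet B →
    ∃ (X : preSpace S →L[ℂ] preSpace S) (Y : postSpace S →L[ℂ] postSpace S),
      (∀ a, (X a : FockR k) = S A a) ∧
      (∀ b, (Y b : FockR k) =
        stopShift S (T B (ContinuousLinearMap.adjoint (stopShift S) (b : FockR k)))) ∧
      ∀ z, P (A ×ˢ B) z = j (hmap X Y (j.symm z))

/-- `R` is the convolution `S ⋆ T`, the image of `S ⊗ T` under addition. -/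
def IsConvolution (S T : Set ℝ≥0∞ → FockR k →L[ℂ] FockR k)
    (j : preSpace S ⊗ᴴ postSpace S ≃ₗᵢ[ℂ] FockR k) (R : Set ℝ≥0∞ → FockR k →L[ℂ] FockR k) : Prop :=
  ∃ P, IsStopTensor S T j P ∧
    ∀ C, MeasurableSet C → R C = P {p : ℝ≥0∞ × ℝ≥0∞ | p.1 + p.2 ∈ C}

/-- The closed linear span of a set of vectors. -/
def closedSpan {E : Type v} [NormedAddCommGroup E] [InnerProductSpace ℂ E] (s : Set E) : Set E :=
  (Submodule.span ℂ s).topologicalClosure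

end StopTimes

end StopTime

end

open StopTime

/-! Write M_s(y, x) = E_s y ⊗ Γ_s x and Ω = ε(0). Fock space enters only through these bilinear
maps: they multiply inner products, are strongly continuous in s, and are associative,
M_{c+d}(M_c(y, x), z) = M_c(y, M_d(x, z)), since splitting the half line at c and then at c + d can
be done in either order. `StopFlow` records these properties and `fockFlow` verifies them.

For a stop time S put J_S(y, x) = ∫ S(ds) M_s(y, x), which is `IsStop.joint`; convergence is
`exists_tendsto_joint`. Then J_S(y, Ω) = E_S y, J_S(Ω, x) = Γ_S x, ⟪J_S(y, x), J_S(y', x')⟫ = ⟪y,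
E_S y'⟫⟪x, x'⟫ (`inner_joint`), and the vectors J_S(y, x) are total (`joint_total`). Hence E_S y ⊗
Γ_S x ↦ J_S(y, x) extends to the isomorphism j_S.

The spectral measure S ⊗ T is determined by (S ⊗ T)(A × B) J_S(y, x) = J_S(S(A)y, T(B)x); its matrix
elements are products of complex measures, from which `exists_prod_spectralMeasure` builds it.
Bounded rectangles give adapted projections (`adapted_prod`), and approximating {s + u ≤ t} by
rectangles makes S ⋆ T a stop time (`isStop_conv`).

The heart is associativity at stop times, `joint_conv`: J_{S⋆T}(J_S(x, E_T y), z) = J_S(x, J_T(y,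
z)). Over a set {a < s + u ≤ b} with b - a small, cut into thin rectangles, associativity at fixed
times turns M_b(M_s(x, M_u(y, Ω)), z) into M_s(x, M_u(y, Γ_{b-s-u} z)), and Γ_{b-s-u} z is close to
z. Errors over disjoint sets are orthogonal, so they stay small after summation.

Now j_{S,T} is the map with values J_S(x, J_T(y, z)): it is isometric by two uses of `inner_joint`
and onto by totality. With z = Ω, `joint_conv` puts J_S(x, E_T y) into the range of E_{S⋆T}; a
vector of that range orthogonal to all of these is orthogonal to the total family J_S(x, J_T(y, z)),
which gives equality (`closedSpan_joint_proj`). With x = Ω the vectors J_S(Ω, J_T(y, z)) span the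
range of Γ_S. The factorisation through j_{S⋆T} is `joint_conv` on elementary tensors. -/

namespace StopTime

/-! ### Orthogonal projections and total families -/

section Projections

variable {E : Type*} [NormedAddCommGroup E] [InnerProductSpace ℂ E] [CompleteSpace E]
  {p : E →L[ℂ] E}

theorem proj_inner (hp : IsStarProjection p) (x y : E) : ⟪p x, y⟫_ℂ = ⟪x, p y⟫_ℂ :=
  (ContinuousLinearMap.isStarProjection_iff_isSymmetricProjection.1 hp).isSymmetric x y

theorem proj_proj (hp : IsStarProjection p) (x : E) : p (p x) = p x :=
  congrArg (fun q : E →L[ℂ] E => q x) hp.isIdempotentElem.eq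

theorem inner_proj_self (hp : IsStarProjection p) (x : E) :
    ⟪x, p x⟫_ℂ = ((‖p x‖ ^ 2 : ℝ) : ℂ) := by
  rw [← proj_proj hp x, ← proj_inner hp, inner_self_eq_norm_sq_to_K, proj_proj hp]
  norm_cast

theorem norm_proj_le (hp : IsStarProjection p) (x : E) : ‖p x‖ ≤ ‖x‖ := by
  have h1 : ‖p x‖ ^ 2 ≤ ‖x‖ * ‖p x‖ := by
    have := norm_inner_le_norm (𝕜 := ℂ) x (p x)
    rwa [inner_proj_self hp, Complex.norm_real, Real.norm_of_nonneg (by positivity)] at this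
  by_contra! h
  nlinarith [norm_nonneg x, norm_nonneg (p x)]

theorem isStarProjection_of_inner {p : E →L[ℂ] E} (h1 : ∀ x, p (p x) = p x)
    (h2 : ∀ x y, ⟪p x, y⟫_ℂ = ⟪x, p y⟫_ℂ) : IsStarProjection p :=
  ContinuousLinearMap.isStarProjection_iff_isSymmetricProjection.2
    ⟨LinearMap.ext h1, h2⟩

omit [CompleteSpace E] in
/-- Two bounded operators that agree on a total family are equal. -/
theorem clm_ext_of_total {ι : Type*} {F : Type*} [NormedAddCommGroup F] [NormedSpace ℂ F]
    {a : ι → E} (ha : (Submodule.span ℂ (Set.range a)).topologicalClosure = ⊤)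
    {f g : E →L[ℂ] F} (h : ∀ i, f (a i) = g (a i)) : f = g := by
  refine ContinuousLinearMap.ext_on ((Submodule.dense_iff_topologicalClosure_eq_top).2 ha) ?_
  rintro _ ⟨i, rfl⟩
  exact h i

theorem eq_of_inner_total {ι : Type*} {a : ι → E}
    (ha : (Submodule.span ℂ (Set.range a)).topologicalClosure = ⊤) {x y : E}
    (h : ∀ i, ⟪a i, x⟫_ℂ = ⟪a i, y⟫_ℂ) : x = y := by
  rw [← sub_eq_zero]
  refine (Submodule.mem_bot ℂ).1 ?_
  rw [← Submodule.topologicalClosure_eq_top_iff.1 ha, Submodule.mem_orthogonal]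
  intro u hu
  induction hu using Submodule.span_induction with
  | mem u hu =>
    obtain ⟨i, rfl⟩ := hu
    rw [inner_sub_right, h, sub_self]
  | zero => simp
  | add u v _ _ hu hv => rw [inner_add_left, hu, hv, add_zero]
  | smul c u _ hu => rw [inner_smul_left, hu, mul_zero]

end Projections

/-! ### Calculus of projection-valued measures -/

namespace IsSpectralMeasure

variable {α : Type*} [MeasurableSpace α] {E : Type*} [NormedAddCommGroup E]
  [InnerProductSpace ℂ E] [CompleteSpace E] {P : Set α → E →L[ℂ] E}

theorem apply_union (hP : IsSpectralMeasure P) {A B : Set α} (hA : MeasurableSet A)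
    (hB : MeasurableSet B) (hd : Disjoint A B) : P (A ∪ B) = P A + P B := by
  ext y
  refine ext_inner_left ℂ fun x => ?_
  obtain ⟨μ, hμ⟩ := hP.complexMeasure x y
  rw [add_apply, inner_add_right, ← hμ _ hA, ← hμ _ hB, ← hμ _ (hA.union hB),
    VectorMeasure.of_union hd hA hB]

theorem apply_empty (hP : IsSpectralMeasure P) : P ∅ = 0 := by
  have := hP.apply_union MeasurableSet.empty MeasurableSet.empty (Set.disjoint_empty ∅)
  rw [Set.empty_union] at this
  exact left_eq_add.1 this

/-- Multiplicativity comes from additivity: for z in the range of `P B`, additivity gives ‖P(A ∪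
B)z‖² = ‖P(A)z‖² + ‖z‖², and P(A ∪ B) is a contraction. -/
theorem apply_apply_of_disjoint (hP : IsSpectralMeasure P) {A B : Set α} (hA : MeasurableSet A)
    (hB : MeasurableSet B) (hd : Disjoint A B) (x : E) : P A (P B x) = 0 := by
  set z := P B x with hz
  have hBz : P B z = z := proj_proj (hP.isStarProjection B hB) x
  have h1 : ⟪z, P (A ∪ B) z⟫_ℂ = ⟪z, P A z⟫_ℂ + ⟪z, P B z⟫_ℂ := by
    rw [hP.apply_union hA hB hd, add_apply, inner_add_right]
  rw [inner_proj_self (hP.isStarProjection _ (hA.union hB)),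
    inner_proj_self (hP.isStarProjection A hA), inner_proj_self (hP.isStarProjection B hB),
    hBz] at h1
  have h2 : ‖P (A ∪ B) z‖ ^ 2 = ‖P A z‖ ^ 2 + ‖z‖ ^ 2 := by exact_mod_cast h1
  have h3 := norm_proj_le (hP.isStarProjection _ (hA.union hB)) z
  have h4 : ‖P A z‖ = 0 := by
    have : ‖P (A ∪ B) z‖ ^ 2 ≤ ‖z‖ ^ 2 := by gcongr
    have : ‖P A z‖ ^ 2 ≤ 0 := by linarith
    nlinarith [norm_nonneg (P A z)]
  exact norm_eq_zero.1 h4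

theorem apply_apply (hP : IsSpectralMeasure P) {A B : Set α} (hA : MeasurableSet A)
    (hB : MeasurableSet B) (x : E) : P A (P B x) = P (A ∩ B) x := by
  have hAB := hA.inter hB
  have h1 : P A = P (A ∩ B) + P (A \ B) := by
    rw [← hP.apply_union hAB (hA.diff hB) Set.disjoint_sdiff_inter.symm, Set.inter_union_sdiff]
  have h2 : P B = P (A ∩ B) + P (B \ A) := by
    rw [← hP.apply_union hAB (hB.diff hA)
      (Set.disjoint_left.2 fun x h h' => h'.2 h.1), Set.inter_comm, Set.inter_union_sdiff]
  rw [h1, add_apply, hP.apply_apply_of_disjoint (hA.diff hB) hB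
    (Set.disjoint_left.2 fun x h h' => h.2 h'), add_zero, h2, add_apply, map_add,
    proj_proj (hP.isStarProjection _ hAB), hP.apply_apply_of_disjoint hAB (hB.diff hA)
    (Set.disjoint_left.2 fun x h h' => h'.2 h.1), add_zero]

theorem apply_comm (hP : IsSpectralMeasure P) {A B : Set α} (hA : MeasurableSet A)
    (hB : MeasurableSet B) (x : E) : P A (P B x) = P B (P A x) := by
  rw [hP.apply_apply hA hB, hP.apply_apply hB hA, Set.inter_comm]

theorem apply_apply_of_subset (hP : IsSpectralMeasure P) {A B : Set α} (hA : MeasurableSet A)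
    (hB : MeasurableSet B) (h : A ⊆ B) (x : E) : P A (P B x) = P A x := by
  rw [hP.apply_apply hA hB, Set.inter_eq_left.2 h]

theorem apply_diff (hP : IsSpectralMeasure P) {A B : Set α} (hA : MeasurableSet A)
    (hB : MeasurableSet B) (h : B ⊆ A) : P (A \ B) = P A - P B := by
  rw [eq_sub_iff_add_eq, ← hP.apply_union (hA.diff hB) hB Set.disjoint_sdiff_left,
    Set.sdiff_union_of_subset h]

theorem norm_apply_le (hP : IsSpectralMeasure P) {A : Set α} (hA : MeasurableSet A) (x : E) :
    ‖P A x‖ ≤ ‖x‖ :=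
  norm_proj_le (hP.isStarProjection A hA) x

theorem norm_apply_mono (hP : IsSpectralMeasure P) {A B : Set α} (hA : MeasurableSet A)
    (hB : MeasurableSet B) (h : A ⊆ B) (x : E) : ‖P A x‖ ≤ ‖P B x‖ := by
  rw [← hP.apply_apply_of_subset hA hB h]
  exact hP.norm_apply_le hA _

theorem apply_eq_zero_of_subset (hP : IsSpectralMeasure P) {A B : Set α} (hA : MeasurableSet A)
    (hB : MeasurableSet B) (h : A ⊆ B) (hB0 : P B = 0) : P A = 0 := by
  ext x
  rw [← hP.apply_apply_of_subset hA hB h, hB0]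
  simp

theorem apply_biUnion (hP : IsSpectralMeasure P) {ι : Type*} (s : Finset ι) {D : ι → Set α}
    (hD : ∀ i ∈ s, MeasurableSet (D i)) (hd : (s : Set ι).PairwiseDisjoint D) :
    P (⋃ i ∈ s, D i) = ∑ i ∈ s, P (D i) := by
  classical
  induction s using Finset.induction_on with
  | empty => simpa using hP.apply_empty
  | insert a s ha ih =>
    rw [Finset.set_biUnion_insert, Finset.sum_insert ha, hP.apply_union (hD a (by simp))
      (Finset.measurableSet_biUnion s fun i hi => hD i (by simp [hi])), ih]
    · exact fun i hi => hD i (by simp [hi])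
    · exact hd.subset (by simp)
    · rw [Set.disjoint_iUnion₂_right]
      intro i hi
      exact hd (by simp) (by simp [hi]) (by rintro rfl; exact ha hi)

/-- Vectors in the ranges of the projections of disjoint sets are orthogonal. -/
theorem norm_sum_sq (hP : IsSpectralMeasure P) {ι : Type*} (s : Finset ι) {D : ι → Set α}
    (hD : ∀ i ∈ s, MeasurableSet (D i)) (hd : (s : Set ι).PairwiseDisjoint D) (v : ι → E) :
    ‖∑ i ∈ s, P (D i) (v i)‖ ^ 2 = ∑ i ∈ s, ‖P (D i) (v i)‖ ^ 2 := by
  have h : ∀ i ∈ s, ⟪P (D i) (v i), ∑ j ∈ s, P (D j) (v j)⟫_ℂ = ((‖P (D i) (v i)‖ ^ 2 : ℝ) : ℂ) := by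
    intro i hi
    rw [inner_sum, Finset.sum_eq_single i]
    · rw [inner_self_eq_norm_sq_to_K]
      norm_cast
    · intro j hj hji
      rw [proj_inner (hP.isStarProjection _ (hD i hi)),
        hP.apply_apply_of_disjoint (hD i hi) (hD j hj) (hd hi hj hji.symm), inner_zero_right]
    · exact fun h => absurd hi h
  have h2 : ⟪∑ i ∈ s, P (D i) (v i), ∑ j ∈ s, P (D j) (v j)⟫_ℂ =
      ((∑ i ∈ s, ‖P (D i) (v i)‖ ^ 2 : ℝ) : ℂ) := by
    rw [sum_inner, Finset.sum_congr rfl h]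
    push_cast
    rfl
  refine Complex.ofReal_injective ?_
  rw [← h2, inner_self_eq_norm_sq_to_K]
  norm_cast

/-- The tool behind all later estimates: an error of relative size ε on each cell, measured against
the mass of one fixed vector ξ there, remains of size ε‖ξ‖ however many cells there are. -/
theorem norm_sum_le (hP : IsSpectralMeasure P) {ι : Type*} (s : Finset ι) {D : ι → Set α}
    (hD : ∀ i ∈ s, MeasurableSet (D i)) (hd : (s : Set ι).PairwiseDisjoint D) (v : ι → E)
    (ξ : E) {ε : ℝ} (hε : 0 ≤ ε) (h : ∀ i ∈ s, ‖P (D i) (v i)‖ ≤ ε * ‖P (D i) ξ‖) :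
    ‖∑ i ∈ s, P (D i) (v i)‖ ≤ ε * ‖ξ‖ := by
  have h1 : ‖∑ i ∈ s, P (D i) (v i)‖ ^ 2 ≤ (ε * ‖P (⋃ i ∈ s, D i) ξ‖) ^ 2 := by
    rw [hP.norm_sum_sq s hD hd, hP.apply_biUnion s hD hd, sum_apply, mul_pow,
      hP.norm_sum_sq s hD hd fun _ => ξ, Finset.mul_sum]
    refine Finset.sum_le_sum fun i hi => ?_
    rw [← mul_pow]
    exact pow_le_pow_left₀ (norm_nonneg _) (h i hi) 2
  refine ((pow_le_pow_iff_left₀ (norm_nonneg _) (by positivity) two_ne_zero).1 h1).trans ?_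
  gcongr
  exact hP.norm_apply_le (Finset.measurableSet_biUnion s hD) ξ

/-- This is continuity from above of the measure A ↦ ⟪x, P(A)x⟫ = ‖P(A)x‖². -/
theorem tendsto_apply_of_antitone (hP : IsSpectralMeasure P) {D : ℕ → Set α}
    (hD : ∀ n, MeasurableSet (D n)) (ha : Antitone D) (h : ⋂ n, D n = ∅) (x : E) :
    Tendsto (fun n => P (D n) x) atTop (𝓝 0) := by
  obtain ⟨μ, hμ⟩ := hP.complexMeasure x x
  have h1 := VectorMeasure.tendsto_vectorMeasure_iInter_atTop_nat (v := μ) ha hD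
  rw [h, VectorMeasure.empty] at h1
  have h2 : ∀ n, ‖P (D n) x‖ ^ 2 = ‖μ (D n)‖ := by
    intro n
    rw [hμ _ (hD n), inner_proj_self (hP.isStarProjection _ (hD n)), Complex.norm_real,
      Real.norm_of_nonneg (by positivity)]
  rw [tendsto_zero_iff_norm_tendsto_zero] at h1 ⊢
  simp_rw [← h2] at h1
  have h3 := h1.sqrt
  rw [Real.sqrt_zero] at h3
  refine h3.congr fun n => Real.sqrt_sq (norm_nonneg _)

/-- The image of a spectral measure under a measurable map. -/
theorem map (hP : IsSpectralMeasure P) {β : Type*} [MeasurableSpace β] {f : α → β}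
    (hf : Measurable f) : IsSpectralMeasure fun B : Set β => P (f ⁻¹' B) where
  isStarProjection B hB := hP.isStarProjection _ (hf hB)
  complexMeasure x y := by
    obtain ⟨μ, hμ⟩ := hP.complexMeasure x y
    exact ⟨μ.map f, fun B hB => by rw [VectorMeasure.map_apply _ hf hB, hμ _ (hf hB)]⟩
  total := by simpa using hP.total

/-- Bounded operators are intertwined by a spectral measure as soon as this is so on a generating
`π`-system. -/
theorem intertwine (hP : IsSpectralMeasure P) {F : Type*} [NormedAddCommGroup F]
    [InnerProductSpace ℂ F] [CompleteSpace F] {Q : Set α → F →L[ℂ] F} (hQ : IsSpectralMeasure Q)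
    {C : Set (Set α)} (hC : ‹MeasurableSpace α› = MeasurableSpace.generateFrom C)
    (hpi : IsPiSystem C) (f : E →L[ℂ] F) (x : E)
    (h : ∀ A ∈ C, f (P A x) = Q A (f x)) {A : Set α} (hA : MeasurableSet A) :
    f (P A x) = Q A (f x) := by
  refine ext_inner_left ℂ fun y => ?_
  obtain ⟨μ, hμ⟩ := hP.complexMeasure (ContinuousLinearMap.adjoint f y) x
  obtain ⟨ν, hν⟩ := hQ.complexMeasure y (f x)
  have hm : ∀ A ∈ C, MeasurableSet A := fun A hA => by
    rw [hC]; exact MeasurableSpace.measurableSet_generateFrom hA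
  have : μ = ν := by
    refine VectorMeasure.ext_of_generateFrom C (fun A hA => ?_) hC hpi ?_
    · rw [hμ _ (hm A hA), hν _ (hm A hA), ContinuousLinearMap.adjoint_inner_left, h A hA]
    · rw [hμ _ .univ, hν _ .univ, ContinuousLinearMap.adjoint_inner_left, hP.total, hQ.total]
      rfl
  rw [← ContinuousLinearMap.adjoint_inner_left, ← hμ _ hA, ← hν _ hA, this]

end IsSpectralMeasure

end StopTime

namespace StopTime

/-! ### Combinatorics of partitions of [0, t] -/

namespace Partition

variable {t : ℝ≥0∞} {π π' : Partition t} {p q : ℝ≥0∞}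

theorem mem_points : p ∈ π.points ↔ p = t ∨ ∃ h : p ∈ Set.Ioo 0 t, ⟨p, h⟩ ∈ π := by
  simp [points]

theorem top_mem_points (π : Partition t) : t ∈ π.points := mem_points.2 (Or.inl rfl)

theorem le_of_mem_points (hp : p ∈ π.points) : p ≤ t := by
  rcases mem_points.1 hp with rfl | ⟨h, -⟩
  · exact le_rfl
  · exact h.2.le

theorem pos_of_mem_points (ht : 0 < t) (hp : p ∈ π.points) : 0 < p := by
  rcases mem_points.1 hp with rfl | ⟨h, -⟩
  · exact ht
  · exact h.1

theorem points_mono (h : π ≤ π') : π.points ⊆ π'.points := fun p hp => by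
  rcases mem_points.1 hp with rfl | ⟨h1, h2⟩
  · exact top_mem_points _
  · exact mem_points.2 (Or.inr ⟨h1, h h2⟩)

/-- The partition whose interior points are the elements of `s` between `0` and `t`. -/
noncomputable def ofFinset (t : ℝ≥0∞) (s : Finset ℝ≥0∞) : Partition t :=
  letI := Classical.decPred (· ∈ Set.Ioo (0 : ℝ≥0∞) t)
  s.subtype (· ∈ Set.Ioo (0 : ℝ≥0∞) t)

theorem mem_points_of_ofFinset_le {s : Finset ℝ≥0∞} (h : ofFinset t s ≤ π) (hp : p ∈ s)
    (h0 : 0 < p) (ht : p ≤ t) : p ∈ π.points := by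
  rcases ht.eq_or_lt with rfl | ht
  · exact top_mem_points _
  · exact mem_points.2 (Or.inr ⟨⟨h0, ht⟩, h (by simpa [ofFinset] using hp)⟩)

theorem pred_lt (hp : 0 < p) : π.pred p < p :=
  (Finset.sup_lt_iff hp).2 fun _ hq => (Finset.mem_filter.1 hq).2

theorem le_pred (hq : q ∈ π.points) (h : q < p) : q ≤ π.pred p :=
  Finset.le_sup (f := id) (Finset.mem_filter.2 ⟨hq, h⟩)

theorem pred_eq_or_mem (π : Partition t) (p : ℝ≥0∞) : π.pred p = 0 ∨ π.pred p ∈ π.points := by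
  rcases (π.points.filter (· < p)).eq_empty_or_nonempty with h | h
  · left
    rw [pred, h]
    rfl
  · right
    obtain ⟨q, hq, he⟩ := Finset.exists_mem_eq_sup _ h (id : ℝ≥0∞ → ℝ≥0∞)
    rw [pred, he]
    exact (Finset.mem_filter.1 hq).1

theorem pairwiseDisjoint_cells (π : Partition t) :
    (π.points : Set ℝ≥0∞).PairwiseDisjoint fun p => Set.Ioc (π.pred p) p := by
  have key : ∀ p q, p ∈ π.points → p < q →
      Disjoint (Set.Ioc (π.pred p) p) (Set.Ioc (π.pred q) q) := fun p q hp hpq =>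
    Set.disjoint_left.2 fun s hs hs' => absurd (hs.2.trans (le_pred hp hpq)) (not_le.2 hs'.1)
  intro p hp q hq hne
  rcases lt_or_gt_of_ne hne with h | h
  · exact key p q hp h
  · exact (key q p hq h).symm

theorem measurableSet_cell (π : Partition t) (p : ℝ≥0∞) :
    MeasurableSet (Set.Ioc (π.pred p) p) := measurableSet_Ioc

theorem exists_mem_cell (π : Partition t) {s : ℝ≥0∞} (hs : s ∈ Set.Ioc 0 t) :
    ∃ p ∈ π.points, s ∈ Set.Ioc (π.pred p) p := by
  have hne : (π.points.filter (s ≤ ·)).Nonempty :=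
    ⟨t, Finset.mem_filter.2 ⟨top_mem_points _, hs.2⟩⟩
  have hm := Finset.min'_mem _ hne
  set p := (π.points.filter (s ≤ ·)).min' hne with hp
  obtain ⟨hp1, hp2⟩ := Finset.mem_filter.1 hm
  refine ⟨p, hp1, (Finset.sup_lt_iff hs.1).2 fun q hq => ?_, hp2⟩
  obtain ⟨hq1, hq2⟩ := Finset.mem_filter.1 hq
  by_contra! h
  exact absurd (Finset.min'_le _ q (Finset.mem_filter.2 ⟨hq1, h⟩)) (not_le.2 hq2)

theorem biUnion_cells (π : Partition t) :
    ⋃ p ∈ π.points, Set.Ioc (π.pred p) p = Set.Ioc 0 t := by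
  ext s
  simp only [Set.mem_iUnion, exists_prop]
  exact ⟨fun ⟨p, hp, h⟩ => ⟨bot_le.trans_lt h.1, h.2.trans (le_of_mem_points hp)⟩,
    π.exists_mem_cell⟩

/-- The first point of a partition that is not before `p`. -/
noncomputable def next (π : Partition t) (p : ℝ≥0∞) : ℝ≥0∞ := (π.points.filter (p ≤ ·)).inf id

theorem next_mem (π : Partition t) (hp : p ≤ t) : π.next p ∈ π.points ∧ p ≤ π.next p := by
  obtain ⟨q, hq, he⟩ := Finset.exists_mem_eq_inf _ (⟨t, Finset.mem_filter.2
    ⟨top_mem_points _, hp⟩⟩ : (π.points.filter (p ≤ ·)).Nonempty) (id : ℝ≥0∞ → ℝ≥0∞)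
  rw [next, he]
  exact Finset.mem_filter.1 hq

theorem next_le (hq : q ∈ π.points) (h : p ≤ q) : π.next p ≤ q :=
  Finset.inf_le (f := id) (Finset.mem_filter.2 ⟨hq, h⟩)

theorem cell_eq_biUnion (ht : 0 < t) (h : π ≤ π') (hq : q ∈ π.points) :
    Set.Ioc (π.pred q) q =
      ⋃ p ∈ π'.points.filter (π.next · = q), Set.Ioc (π'.pred p) p := by
  ext s
  simp only [Set.mem_iUnion, Finset.mem_filter, exists_prop]
  constructor
  · intro hs
    obtain ⟨p, hp, hps⟩ := π'.exists_mem_cell (s := s)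
      ⟨bot_le.trans_lt hs.1, hs.2.trans (le_of_mem_points hq)⟩
    have hpq : p ≤ q := by
      by_contra! hlt
      exact absurd hs.2 (not_le.2 ((le_pred (points_mono h hq) hlt).trans_lt hps.1))
    refine ⟨p, ⟨hp, le_antisymm (next_le hq hpq) ?_⟩, hps⟩
    obtain ⟨h1, h2⟩ := π.next_mem (le_of_mem_points hp)
    by_contra! hlt
    exact absurd (h2.trans (le_pred h1 hlt)) (not_le.2 (hs.1.trans_le hps.2))
  · rintro ⟨p, ⟨hp, rfl⟩, hs⟩
    obtain ⟨h1, h2⟩ := π.next_mem (le_of_mem_points hp)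
    refine ⟨?_, hs.2.trans h2⟩
    rcases π.pred_eq_or_mem (π.next p) with h0 | hm
    · rw [h0]; exact bot_le.trans_lt hs.1
    · have hlt : π.pred (π.next p) < p := by
        by_contra! hle
        exact absurd (next_le hm hle) (not_le.2 (pred_lt (pos_of_mem_points ht h1)))
      exact (le_pred (points_mono h hm) hlt).trans_lt hs.1

end Partition

/-! ### Riemann sums against a spectral measure -/

variable {F : Type*} [NormedAddCommGroup F] [InnerProductSpace ℂ F]
  {S : Set ℝ≥0∞ → F →L[ℂ] F}

/-- The Riemann sum `∑ⱼ S((πⱼ₋₁, πⱼ]) Φ(πⱼ)`. -/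
noncomputable def riemannSum (S : Set ℝ≥0∞ → F →L[ℂ] F) (t : ℝ≥0∞) (Φ : ℝ≥0∞ → F) (π : Partition t) : F :=
  ∑ p ∈ π.points, S (Set.Ioc (π.pred p) p) (Φ p)

theorem riemannSum_sub (S : Set ℝ≥0∞ → F →L[ℂ] F) (t : ℝ≥0∞) (Φ Ψ : ℝ≥0∞ → F)
    (π : Partition t) : riemannSum S t (fun s => Φ s - Ψ s) π =
      riemannSum S t Φ π - riemannSum S t Ψ π := by
  simp [riemannSum]

theorem riemannSum_add (S : Set ℝ≥0∞ → F →L[ℂ] F) (t : ℝ≥0∞) (Φ Ψ : ℝ≥0∞ → F)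
    (π : Partition t) : riemannSum S t (fun s => Φ s + Ψ s) π =
      riemannSum S t Φ π + riemannSum S t Ψ π := by
  simp [riemannSum, Finset.sum_add_distrib]

theorem riemannSum_smul (S : Set ℝ≥0∞ → F →L[ℂ] F) (t : ℝ≥0∞) (c : ℂ) (Φ : ℝ≥0∞ → F)
    (π : Partition t) : riemannSum S t (fun s => c • Φ s) π = c • riemannSum S t Φ π := by
  simp [riemannSum, Finset.smul_sum]

variable [CompleteSpace F]

namespace IsSpectralMeasure

variable {t : ℝ≥0∞} {Φ Ψ : ℝ≥0∞ → F}

/-- A coarse sum is a fine sum whose integrand is evaluated at the following coarse point. Sums over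
two nested partitions can thus be compared cell by cell of the finer one. -/
theorem riemannSum_of_le (hS : IsSpectralMeasure S) (ht : 0 < t) {π π' : Partition t}
    (h : π ≤ π') (Φ : ℝ≥0∞ → F) :
    riemannSum S t Φ π = riemannSum S t (fun p => Φ (π.next p)) π' := by
  rw [riemannSum, riemannSum,
    ← Finset.sum_fiberwise_of_maps_to (s := π'.points) (t := π.points) (g := π.next)
      fun p hp => (π.next_mem (Partition.le_of_mem_points hp)).1]
  refine Finset.sum_congr rfl fun q hq => ?_
  rw [Partition.cell_eq_biUnion ht h hq, hS.apply_biUnion _ (fun p _ => measurableSet_Ioc)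
    (π'.pairwiseDisjoint_cells.subset
      (Finset.coe_subset.2 (Finset.filter_subset _ _))), sum_apply]
  refine Finset.sum_congr rfl fun p hp => ?_
  rw [(Finset.mem_filter.1 hp).2]

theorem norm_riemannSum_le (hS : IsSpectralMeasure S) {π : Partition t} {ξ : F} {ε : ℝ}
    (hε : 0 ≤ ε) (h : ∀ p ∈ π.points, ‖S (Set.Ioc (π.pred p) p) (Φ p)‖ ≤
      ε * ‖S (Set.Ioc (π.pred p) p) ξ‖) : ‖riemannSum S t Φ π‖ ≤ ε * ‖ξ‖ :=
  hS.norm_sum_le _ (fun p _ => π.measurableSet_cell p) π.pairwiseDisjoint_cells _ ξ hε h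

theorem apply_riemannSum (hS : IsSpectralMeasure S) {A : Set ℝ≥0∞} (hA : MeasurableSet A)
    (π : Partition t) :
    S A (riemannSum S t Φ π) = ∑ p ∈ π.points, S (A ∩ Set.Ioc (π.pred p) p) (Φ p) := by
  simp_rw [riemannSum, map_sum, hS.apply_apply hA measurableSet_Ioc]

theorem norm_apply_riemannSum_le (hS : IsSpectralMeasure S) {A : Set ℝ≥0∞} (hA : MeasurableSet A)
    {π : Partition t} {ξ : F} {ε : ℝ} (hε : 0 ≤ ε) (h : ∀ p ∈ π.points,
      ‖S (A ∩ Set.Ioc (π.pred p) p) (Φ p)‖ ≤ ε * ‖S (A ∩ Set.Ioc (π.pred p) p) ξ‖) :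
    ‖S A (riemannSum S t Φ π)‖ ≤ ε * ‖ξ‖ := by
  rw [hS.apply_riemannSum hA]
  exact hS.norm_sum_le _ (fun p _ => hA.inter measurableSet_Ioc)
    (π.pairwiseDisjoint_cells.mono fun p => Set.inter_subset_right) _ ξ hε h

theorem riemannSum_const (hS : IsSpectralMeasure S) (h0 : S {0} = 0) (π : Partition (⊤ : ℝ≥0∞)) (x : F) :
    riemannSum S ⊤ (fun _ => x) π = x := by
  rw [riemannSum, ← sum_apply, ← hS.apply_biUnion _ (fun p _ => π.measurableSet_cell p)
    π.pairwiseDisjoint_cells, π.biUnion_cells]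
  have : S Set.univ = S {0} + S (Set.Ioc 0 ⊤) := by
    rw [← hS.apply_union (measurableSet_singleton 0) measurableSet_Ioc (by simp)]
    congr 1
    ext s
    simp
  rw [h0, zero_add, hS.total] at this
  rw [← this]
  rfl

/-- No cell straddles t, because t is a point of `π'`: cells up to t are untouched by S([0, t]) and
later cells are killed. -/
theorem apply_Icc_riemannSum (hS : IsSpectralMeasure S) (ht : 0 < t) {π : Partition t} {π' : Partition (⊤ : ℝ≥0∞)}
    (htm : t ∈ π'.points) (h : ∀ p < t, p ∈ π'.points ↔ p ∈ π.points) :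
    S (Set.Icc 0 t) (riemannSum S ⊤ Φ π') = riemannSum S t Φ π := by
  have hpt : ∀ p, p ∈ π.points ↔ p ≤ t ∧ p ∈ π'.points := by
    intro p
    constructor
    · intro hp
      rcases (Partition.le_of_mem_points hp).eq_or_lt with rfl | hlt
      · exact ⟨le_rfl, htm⟩
      · exact ⟨hlt.le, (h p hlt).2 hp⟩
    · rintro ⟨hp, hp'⟩
      rcases hp.eq_or_lt with rfl | hlt
      · exact Partition.top_mem_points _
      · exact (h p hlt).1 hp'
  have hsub : π.points ⊆ π'.points := fun p hp => ((hpt p).1 hp).2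
  rw [hS.apply_riemannSum measurableSet_Icc, riemannSum, ← Finset.sum_subset hsub]
  · refine Finset.sum_congr rfl fun p hp => ?_
    have hpred : π'.pred p = π.pred p := by
      rw [Partition.pred, Partition.pred]
      congr 1
      ext q
      simp only [Finset.mem_filter]
      exact and_congr_left fun hq => h q (hq.trans_le (Partition.le_of_mem_points hp))
    rw [hpred, Set.inter_eq_right.2]
    exact fun s hs => ⟨bot_le, hs.2.trans (Partition.le_of_mem_points hp)⟩
  · intro p hp hp'
    have hlt : t < p := by
      by_contra! hle
      exact hp' ((hpt p).2 ⟨hle, hp⟩)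
    have : Set.Icc 0 t ∩ Set.Ioc (π'.pred p) p = ∅ := by
      rw [← Set.disjoint_iff_inter_eq_empty, Set.disjoint_left]
      exact fun s hs hs' => absurd (hs.2.trans (Partition.le_pred htm hlt)) (not_le.2 hs'.1)
    rw [this, hS.apply_empty, zero_apply]

/-- A stop integral over `[0, t]` is the localisation of the integral over `[0, ∞]`. -/
theorem tendsto_riemannSum_Icc (hS : IsSpectralMeasure S) {v : F}
    (h : Tendsto (riemannSum S ⊤ Φ) atTop (𝓝 v)) (ht : 0 < t) :
    Tendsto (riemannSum S t Φ) atTop (𝓝 (S (Set.Icc 0 t) v)) := by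
  classical
  rcases eq_or_ne t ⊤ with rfl | htop
  · have : Set.Icc (0 : ℝ≥0∞) ⊤ = Set.univ := by ext; simp
    rw [this, hS.total]
    exact h
  rw [Metric.tendsto_atTop] at h ⊢
  intro ε hε
  obtain ⟨π₀, hπ₀⟩ := h ε hε
  refine ⟨Partition.ofFinset t π₀.points, fun π hπ => ?_⟩
  -- This partition refines `π₀`, and below t it has the same points as `π`, since `π` already
  -- contains the points of `π₀` there.
  let π' : Partition (⊤ : ℝ≥0∞) := π₀ ∪ Partition.ofFinset ⊤ π.points
  have hπ' : ∀ p, p ∈ π'.points ↔ p ∈ π₀.points ∨ p ∈ π.points := by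
    intro p
    constructor
    · intro hp
      rcases Partition.mem_points.1 hp with rfl | ⟨h1, h2⟩
      · exact Or.inl (Partition.top_mem_points _)
      · rcases Finset.mem_union.1 h2 with h2 | h2
        · exact Or.inl (Partition.mem_points.2 (Or.inr ⟨h1, h2⟩))
        · right
          simpa [Partition.ofFinset] using h2
    · rintro (hp | hp)
      · exact Partition.points_mono Finset.subset_union_left hp
      · exact Partition.points_mono Finset.subset_union_right
          (Partition.mem_points_of_ofFinset_le le_rfl hp (Partition.pos_of_mem_points ht hp) le_top)
  have key := hS.apply_Icc_riemannSum (Φ := Φ) ht (π := π) (π' := π')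
    ((hπ' t).2 (Or.inr (Partition.top_mem_points _))) fun p hp => by
      rw [hπ', or_iff_right_iff_imp]
      exact fun h1 => Partition.mem_points_of_ofFinset_le hπ h1
        (Partition.pos_of_mem_points ENNReal.zero_lt_top h1) hp.le
  rw [← key, dist_eq_norm, ← map_sub]
  refine (hS.norm_apply_le measurableSet_Icc _).trans_lt ?_
  rw [← dist_eq_norm]
  exact hπ₀ π' Finset.subset_union_left

theorem tendsto_apply_Ioc_top (hS : IsSpectralMeasure S) (h : S {⊤} = 0) (x : F) :
    Tendsto (fun n : ℕ => S (Set.Ioc n ⊤) x) atTop (𝓝 0) := by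
  have hd : ∀ n : ℕ, S (Set.Ioc (n : ℝ≥0∞) ⊤) = S (Set.Ioo (n : ℝ≥0∞) ⊤) := by
    intro n
    rw [← add_zero (S (Set.Ioo (n : ℝ≥0∞) ⊤)), ← h, ← hS.apply_union measurableSet_Ioo
      (measurableSet_singleton _) (by simp)]
    congr 1
    ext s
    simp only [Set.mem_Ioc, Set.mem_union, Set.mem_Ioo, Set.mem_singleton_iff, le_top, and_true]
    constructor
    · intro hs
      rcases eq_or_ne s ⊤ with rfl | hne
      · exact Or.inr rfl
      · exact Or.inl ⟨hs, hne.lt_top⟩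
    · rintro (hs | rfl)
      · exact hs.1
      · exact ENNReal.natCast_lt_top n
  simp_rw [hd]
  refine hS.tendsto_apply_of_antitone (fun n => measurableSet_Ioo) (fun m n hmn => ?_) ?_ x
  · exact Set.Ioo_subset_Ioo_left (by exact_mod_cast hmn)
  · ext s
    simp only [Set.mem_iInter, Set.mem_Ioo, Set.mem_empty_iff_false, iff_false, not_forall]
    rcases eq_or_ne s ⊤ with rfl | hne
    · exact ⟨0, by simp⟩
    · obtain ⟨n, hn⟩ := ENNReal.exists_nat_gt hne
      exact ⟨n, fun h => absurd h.1 (not_lt.2 hn.le)⟩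

theorem tendsto_apply_Icc_nat (hS : IsSpectralMeasure S) (h : S {⊤} = 0) (x : F) :
    Tendsto (fun n : ℕ => S (Set.Icc 0 n) x) atTop (𝓝 x) := by
  have h1 : ∀ n : ℕ, S (Set.Icc 0 n) x = x - S (Set.Ioc n ⊤) x := by
    intro n
    rw [eq_sub_iff_add_eq, ← add_apply, ← hS.apply_union measurableSet_Icc measurableSet_Ioc]
    · have : Set.Icc 0 (n : ℝ≥0∞) ∪ Set.Ioc (n : ℝ≥0∞) ⊤ = Set.univ := by
        ext s
        simp
      rw [this, hS.total]
      rfl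
    · exact Set.disjoint_left.2 fun s h1 h2 => absurd h2.1 (not_lt.2 h1.2)
  simp_rw [h1]
  simpa using (tendsto_const_nhds (x := x)).sub (hS.tendsto_apply_Ioc_top h x)

/-- The value of the integrand at infinity does not matter. -/
theorem tendsto_riemannSum_congr (hS : IsSpectralMeasure S) (h : S {⊤} = 0) {v : F}
    (hΦ : Tendsto (riemannSum S ⊤ Φ) atTop (𝓝 v)) (he : ∀ s ≠ ⊤, Φ s = Ψ s) :
    Tendsto (riemannSum S ⊤ Ψ) atTop (𝓝 v) := by
  have hd : Tendsto (riemannSum S ⊤ fun s => Ψ s - Φ s) atTop (𝓝 0) := by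
    rw [Metric.tendsto_atTop]
    intro ε hε
    obtain ⟨n, hn⟩ := (Metric.tendsto_atTop.1 (hS.tendsto_apply_Ioc_top h (Ψ ⊤ - Φ ⊤))) ε hε
    specialize hn (n + 1) (Nat.le_succ n)
    rw [dist_zero_right] at hn
    -- Only the last cell sees the value at infinity, and it lies in (n + 1, ∞] once n + 1 is a
    -- partition point. Taking n + 1 instead of n ensures that this point is positive.
    refine ⟨Partition.ofFinset ⊤ {((n + 1 : ℕ) : ℝ≥0∞)}, fun π hπ => ?_⟩
    rw [dist_zero_right, riemannSum, Finset.sum_eq_single ⊤]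
    · refine lt_of_le_of_lt (hS.norm_apply_mono measurableSet_Ioc measurableSet_Ioc ?_ _) hn
      refine Set.Ioc_subset_Ioc_left (Partition.le_pred ?_ (ENNReal.natCast_lt_top _))
      exact Partition.mem_points_of_ofFinset_le hπ (by simp) (by positivity) le_top
    · intro p _ hp
      rw [he p hp, sub_self, map_zero]
    · exact fun h => absurd (Partition.top_mem_points π) h
  simpa [riemannSum_sub] using hd.add hΦ

end IsSpectralMeasure

end StopTime

/-! ### Stop flows, adaptedness and the projection E_S -/

namespace StopTime

set_option linter.unusedSectionVars false

noncomputable section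

/-- The structure of Fock space that stop times use: `M c y x` stands for `E_c y ⊗ Γ_c x`, and
`Ω` for the vacuum vector. -/
structure StopFlow (F : Type*) [NormedAddCommGroup F] [InnerProductSpace ℂ F] where
  M : ℝ≥0 → F →L[ℂ] F →L[ℂ] F
  Ω : F
  inner_M : ∀ c y x y' x', ⟪M c y x, M c y' x'⟫_ℂ = ⟪y, M c y' Ω⟫_ℂ * ⟪x, x'⟫_ℂ
  assoc : ∀ c d y x z, M (c + d) (M c y x) z = M c y (M d x z)
  M_zero : ∀ x, M 0 Ω x = x
  M_vac : ∀ c, M c Ω Ω = Ω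
  norm_vac : ‖Ω‖ = 1
  continuous_M : ∀ y x, Continuous fun c => M c y x
  gen : Set F
  gen_total : (Submodule.span ℂ gen).topologicalClosure = ⊤
  -- For e = ε(f) the tail is the exponential vector of f shifted to the left by c and cut off at 0.
  -- Factorising generators at every time is what yields totality.
  exists_tail : ∀ e ∈ gen, ∃ v : ℝ≥0 → F, Continuous v ∧ ∀ c, M c e (v c) = e

namespace StopFlow

variable {F : Type*} [NormedAddCommGroup F] [InnerProductSpace ℂ F] (W : StopFlow F)

/-- The projection `E_c`. -/
def E (c : ℝ≥0) : F →L[ℂ] F := (W.M c).flip W.Ω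

theorem E_apply (c : ℝ≥0) (y : F) : W.E c y = W.M c y W.Ω := rfl

/-- A vector that is known at time c carries the vacuum on [c, d), so the shift by d splits into a
shift by d - c followed by one by c. -/
theorem M_E_of_le {c d : ℝ≥0} (h : c ≤ d) (y x : F) :
    W.M d (W.E c y) x = W.M c y (W.M (d - c) W.Ω x) := by
  rw [← W.assoc, add_tsub_cancel_of_le h, E_apply]

theorem inner_E (c : ℝ≥0) (y y' : F) : ⟪W.E c y, W.E c y'⟫_ℂ = ⟪y, W.E c y'⟫_ℂ := by
  rw [E_apply, E_apply, W.inner_M, inner_self_eq_norm_sq_to_K, W.norm_vac]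
  simp

theorem E_E_of_le {c d : ℝ≥0} (h : c ≤ d) (y : F) : W.E d (W.E c y) = W.E c y := by
  rw [E_apply, W.M_E_of_le h, W.M_vac, E_apply]

theorem norm_M (c : ℝ≥0) (y x : F) : ‖W.M c y x‖ = ‖W.E c y‖ * ‖x‖ := by
  have h : ⟪W.M c y x, W.M c y x⟫_ℂ = ⟪W.E c y, W.E c y⟫_ℂ * ⟪x, x⟫_ℂ := by
    rw [W.inner_M, W.inner_E, E_apply]
  simp only [inner_self_eq_norm_sq_to_K] at h
  rw [← mul_pow] at h
  have h2 : ‖W.M c y x‖ ^ 2 = (‖W.E c y‖ * ‖x‖) ^ 2 := by exact_mod_cast h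
  exact (pow_left_inj₀ (norm_nonneg _) (by positivity) two_ne_zero).1 h2

/-- The operator `X` acts on the past of `c` only. -/
def Adapted (c : ℝ≥0) (X : F →L[ℂ] F) : Prop := ∀ y x, X (W.M c y x) = W.M c (X y) x

/-- `M c` at times in `[0, ∞]`, with value `0` at infinity. -/
def Me (s : ℝ≥0∞) : F →L[ℂ] F →L[ℂ] F := if s = ⊤ then 0 else W.M s.toNNReal

/-- `E c` at times in `[0, ∞]`, with value `1` at infinity. -/
def Ee (s : ℝ≥0∞) : F →L[ℂ] F := if s = ⊤ then 1 else W.E s.toNNReal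

@[simp] theorem Me_coe (c : ℝ≥0) : W.Me c = W.M c := by simp [Me]

@[simp] theorem Me_top : W.Me ⊤ = 0 := by simp [Me]

@[simp] theorem Ee_coe (c : ℝ≥0) : W.Ee c = W.E c := by simp [Ee]

@[simp] theorem Ee_top : W.Ee ⊤ = 1 := by simp [Ee]

variable [CompleteSpace F]

theorem isStarProjection_E (c : ℝ≥0) : IsStarProjection (W.E c) :=
  isStarProjection_of_inner (W.E_E_of_le le_rfl) fun x y => by
    rw [← W.inner_E c x y, ← inner_conj_symm (W.E c x) y, ← W.inner_E c y x, inner_conj_symm]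

theorem E_E_of_ge {c d : ℝ≥0} (h : c ≤ d) (y : F) : W.E c (W.E d y) = W.E c y := by
  refine ext_inner_left ℂ fun x => ?_
  rw [← proj_inner (W.isStarProjection_E c), ← proj_inner (W.isStarProjection_E d),
    W.E_E_of_le h, proj_inner (W.isStarProjection_E c)]

theorem norm_M_le (c : ℝ≥0) (y x : F) : ‖W.M c y x‖ ≤ ‖y‖ * ‖x‖ := by
  rw [W.norm_M]
  gcongr
  exact norm_proj_le (W.isStarProjection_E c) y

theorem isStarProjection_Ee (s : ℝ≥0∞) : IsStarProjection (W.Ee s) := by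
  rw [Ee]
  split_ifs
  · exact IsStarProjection.one _
  · exact W.isStarProjection_E _

theorem Ee_Ee_of_ge {p q : ℝ≥0∞} (h : p ≤ q) (y : F) : W.Ee p (W.Ee q y) = W.Ee p y := by
  induction q with
  | top => simp
  | coe q =>
    lift p to ℝ≥0 using (h.trans_lt ENNReal.coe_lt_top).ne
    simpa using W.E_E_of_ge (ENNReal.coe_le_coe.1 h) y

theorem ext_gen {G : Type*} [NormedAddCommGroup G] [NormedSpace ℂ G] {f g : F →L[ℂ] G}
    (h : ∀ e ∈ W.gen, f e = g e) : f = g :=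
  ContinuousLinearMap.ext_on ((Submodule.dense_iff_topologicalClosure_eq_top).2 W.gen_total) h

namespace Adapted

variable {W} {c d : ℝ≥0} {X Y : F →L[ℂ] F}

theorem comm_E (h : W.Adapted c X) (y : F) : X (W.E c y) = W.E c (X y) := h y W.Ω

/-- On a generator, written as M_c(e, v), both sides are computed by associativity; the generators
are total. -/
theorem mono (h : W.Adapted c X) (hcd : c ≤ d) : W.Adapted d X := by
  intro y x
  have : X.comp ((W.M d).flip x) = ((W.M d).flip x).comp X := by
    refine W.ext_gen fun e he => ?_
    obtain ⟨v, -, hv⟩ := W.exists_tail e he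
    obtain ⟨r, rfl⟩ := exists_add_of_le hcd
    change X (W.M (c + r) e x) = W.M (c + r) (X e) x
    rw [← hv c, W.assoc, h, h, W.assoc]
  exact congrArg (fun f : F →L[ℂ] F => f y) this

theorem sum {ι : Type*} {s : Finset ι} {X : ι → F →L[ℂ] F} (h : ∀ i ∈ s, W.Adapted c (X i)) :
    W.Adapted c (∑ i ∈ s, X i) := fun y x => by
  simp only [sum_apply, map_sum]
  exact Finset.sum_congr rfl fun i hi => h i hi y x

theorem zero : W.Adapted c 0 := fun y x => by simp

end Adapted

/-- A spectral measure on `[0, ∞]` that is adapted and has no mass at `0` and at `∞`. -/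
structure IsStop (S : Set ℝ≥0∞ → F →L[ℂ] F) : Prop extends IsSpectralMeasure S where
  adapted : ∀ t : ℝ≥0, 0 < t → W.Adapted t (S (Set.Icc 0 t))
  zero_eq : S {0} = 0
  top_eq : S {⊤} = 0

namespace IsStop

variable {W} {S : Set ℝ≥0∞ → F →L[ℂ] F}

theorem adapted_Icc (hS : W.IsStop S) (t : ℝ≥0) : W.Adapted t (S (Set.Icc 0 t)) := by
  rcases eq_zero_or_pos t with rfl | ht
  · have : Set.Icc (0 : ℝ≥0∞) (0 : ℝ≥0) = {0} := by simp
    rw [this, hS.zero_eq]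
    exact Adapted.zero
  · exact hS.adapted t ht

/-- Adaptedness on intervals passes to Borel sets through `intertwine`, applied to the operator y ↦
M_c(S([0, c])y, x): the half lines [0, s] form a generating π-system, and [0, s] ∩ [0, c] is again
an interval from 0. -/
theorem adapted_of_subset (hS : W.IsStop S) {A : Set ℝ≥0∞} (hA : MeasurableSet A) {c : ℝ≥0}
    (h : A ⊆ Set.Icc 0 c) : W.Adapted c (S A) := by
  intro y x
  have key := hS.intertwine hS.toIsSpectralMeasure (C := Set.range Set.Iic)
    (BorelSpace.measurable_eq.trans (borel_eq_generateFrom_Iic ℝ≥0∞)) isPiSystem_Iic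
    (((W.M c).flip x).comp (S (Set.Icc 0 c))) y (A := A) ?_ hA
  · simp only [ContinuousLinearMap.comp_apply, ContinuousLinearMap.flip_apply] at key
    rw [hS.apply_apply measurableSet_Icc hA, Set.inter_eq_right.2 h, ← hS.adapted_Icc c,
      hS.apply_apply_of_subset hA measurableSet_Icc h] at key
    exact key.symm
  · rintro _ ⟨s, rfl⟩
    simp only [ContinuousLinearMap.comp_apply, ContinuousLinearMap.flip_apply]
    rw [← hS.adapted_Icc c y x, hS.apply_apply measurableSet_Iic measurableSet_Icc,
      hS.apply_apply measurableSet_Icc measurableSet_Iic]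
    have h1 : Set.Iic s ∩ Set.Icc 0 (c : ℝ≥0∞) = Set.Icc 0 (min s c) := by
      ext r; simp
    have hlt : min s c ≠ ⊤ := ((min_le_right _ _).trans_lt ENNReal.coe_lt_top).ne
    have h2 : min s c = ((min s c).toNNReal : ℝ≥0∞) := (ENNReal.coe_toNNReal hlt).symm
    rw [Set.inter_comm, h1, h2]
    refine ((hS.adapted_Icc _).mono ?_ y x).symm
    rw [← ENNReal.coe_le_coe, ← h2]
    exact min_le_right _ _

theorem adapted_cell (hS : W.IsStop S) (a : ℝ≥0∞) (c : ℝ≥0) : W.Adapted c (S (Set.Ioc a c)) :=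
  hS.adapted_of_subset measurableSet_Ioc fun _ h => ⟨bot_le, h.2⟩

theorem apply_Me (hS : W.IsStop S) {A : Set ℝ≥0∞} (hA : MeasurableSet A) {p : ℝ≥0∞}
    (h : A ⊆ Set.Icc 0 p) (y x : F) : S A (W.Me p y x) = W.Me p (S A y) x := by
  induction p with
  | top => simp
  | coe p => simpa using hS.adapted_of_subset hA h y x

theorem apply_Ee (hS : W.IsStop S) {A : Set ℝ≥0∞} (hA : MeasurableSet A) {p : ℝ≥0∞}
    (h : A ⊆ Set.Icc 0 p) (y : F) : S A (W.Ee p y) = W.Ee p (S A y) := by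
  induction p with
  | top => simp
  | coe p => simpa using (hS.adapted_of_subset hA h).comm_E y

theorem cell_subset (a p : ℝ≥0∞) : Set.Ioc a p ⊆ Set.Icc 0 p := fun _ h => ⟨bot_le, h.2⟩

/-- The projection `∑ⱼ S((πⱼ₋₁, πⱼ]) E_{πⱼ}`. -/
def approx (W : StopFlow F) (S : Set ℝ≥0∞ → F →L[ℂ] F) (π : Partition (⊤ : ℝ≥0∞)) : F →L[ℂ] F :=
  ∑ p ∈ π.points, S (Set.Ioc (π.pred p) p) * W.Ee p

theorem approx_apply (π : Partition (⊤ : ℝ≥0∞)) (x : F) :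
    approx W S π x = riemannSum S ⊤ (fun s => W.Ee s x) π := by
  simp [approx, riemannSum]

theorem apply_cell_riemannSum (hS : W.IsStop S) {Φ : ℝ≥0∞ → F} {t : ℝ≥0∞} {π : Partition t}
    {p : ℝ≥0∞} (hp : p ∈ π.points) :
    S (Set.Ioc (π.pred p) p) (riemannSum S t Φ π) = S (Set.Ioc (π.pred p) p) (Φ p) := by
  rw [riemannSum, map_sum, Finset.sum_eq_single p]
  · exact proj_proj (hS.isStarProjection _ measurableSet_Ioc) _
  · exact fun q hq hne => hS.apply_apply_of_disjoint measurableSet_Ioc measurableSet_Ioc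
      (π.pairwiseDisjoint_cells hp hq hne.symm) _
  · exact fun h => absurd hp h

/-- The projection of a cell ending at p is adapted at p, hence commutes with E_p; the summands are
therefore projections onto orthogonal subspaces. -/
theorem isStarProjection_approx (hS : W.IsStop S) (π : Partition (⊤ : ℝ≥0∞)) :
    IsStarProjection (approx W S π) := by
  refine isStarProjection_of_inner (fun x => ?_) fun x y => ?_
  · rw [approx_apply, approx_apply, riemannSum]
    refine Finset.sum_congr rfl fun p hp => ?_
    rw [hS.apply_Ee measurableSet_Ioc (cell_subset _ _), hS.apply_cell_riemannSum hp,
      ← hS.apply_Ee measurableSet_Ioc (cell_subset _ _), proj_proj (W.isStarProjection_Ee p)]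
  · rw [approx, sum_apply, sum_apply, sum_inner, inner_sum]
    refine Finset.sum_congr rfl fun p hp => ?_
    change ⟪S _ (W.Ee p x), y⟫_ℂ = ⟪x, S _ (W.Ee p y)⟫_ℂ
    rw [proj_inner (hS.isStarProjection _ measurableSet_Ioc),
      proj_inner (W.isStarProjection_Ee p), hS.apply_Ee measurableSet_Ioc (cell_subset _ _)]

/-- The kernels grow under refinement: a fine point p precedes its coarse successor q, so E_p = E_p
E_q on the cell. -/
theorem approx_eq_zero_of_le (hS : W.IsStop S) {π π' : Partition (⊤ : ℝ≥0∞)} (h : π ≤ π') {x : F}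
    (hx : approx W S π x = 0) : approx W S π' x = 0 := by
  rw [approx_apply, hS.riemannSum_of_le ENNReal.zero_lt_top h] at hx
  rw [approx_apply, riemannSum]
  refine Finset.sum_eq_zero fun p hp => ?_
  have h1 := hS.apply_cell_riemannSum (Φ := fun p => W.Ee (π.next p) x) hp
  rw [hx, map_zero] at h1
  rw [← W.Ee_Ee_of_ge (π.next_mem le_top).2, hS.apply_Ee measurableSet_Ioc (cell_subset _ _),
    ← h1, map_zero]

/-- Monotonicity of the kernels replaces any estimate: the projections onto an increasing net of
subspaces converge strongly to the projection onto the closure of their union, and E_S is the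
complement of that limit. -/
theorem exists_stopProj (hS : W.IsStop S) : ∃ L : F →L[ℂ] F, IsStarProjection L ∧
    ∀ x, Tendsto (riemannSum S ⊤ fun s => W.Ee s x) atTop (𝓝 (L x)) := by
  let U : Partition (⊤ : ℝ≥0∞) → Submodule ℂ F := fun π => LinearMap.ker (approx W S π).toLinearMap
  have hUc : ∀ π, CompleteSpace (U π) := fun π =>
    (ContinuousLinearMap.isClosed_ker (approx W S π)).completeSpace_coe
  have hUo : ∀ π, (U π).HasOrthogonalProjection := fun π => .ofCompleteSpace _
  have hproj : ∀ π x, (U π).starProjection x = x - approx W S π x := by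
    intro π x
    refine Submodule.eq_starProjection_of_mem_of_inner_eq_zero (K := U π) ?_ fun w hw => ?_
    · change approx W S π (x - approx W S π x) = 0
      rw [map_sub, proj_proj (hS.isStarProjection_approx π), sub_self]
    · rw [sub_sub_cancel, proj_inner (hS.isStarProjection_approx π),
        show approx W S π w = 0 from hw, inner_zero_right]
  refine ⟨1 - (⨆ π, U π).topologicalClosure.starProjection,
    (isStarProjection_starProjection (U := (⨆ π, U π).topologicalClosure)).one_sub, fun x => ?_⟩
  have := (tendsto_const_nhds (x := x)).sub (Submodule.starProjection_tendsto_closure_iSup U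
    (fun π π' h x hx => hS.approx_eq_zero_of_le h hx) x)
  refine this.congr fun π => ?_
  rw [hproj, sub_sub_cancel, approx_apply]

/-- The projection `E_S`. -/
def proj (hS : W.IsStop S) : F →L[ℂ] F := hS.exists_stopProj.choose

theorem isStarProjection_proj (hS : W.IsStop S) : IsStarProjection hS.proj :=
  hS.exists_stopProj.choose_spec.1

theorem tendsto_proj (hS : W.IsStop S) (x : F) :
    Tendsto (riemannSum S ⊤ fun s => W.Ee s x) atTop (𝓝 (hS.proj x)) :=
  hS.exists_stopProj.choose_spec.2 x

theorem apply_proj (hS : W.IsStop S) {A : Set ℝ≥0∞} (hA : MeasurableSet A) (x : F) :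
    S A (hS.proj x) = hS.proj (S A x) := by
  refine tendsto_nhds_unique (((S A).continuous.tendsto _).comp (hS.tendsto_proj x))
    ((hS.tendsto_proj (S A x)).congr fun π => ?_)
  rw [Function.comp_apply, riemannSum, riemannSum, map_sum]
  refine Finset.sum_congr rfl fun p hp => ?_
  rw [hS.apply_apply hA measurableSet_Ioc, hS.apply_Ee (hA.inter measurableSet_Ioc)
    (Set.inter_subset_right.trans (cell_subset _ _)), hS.apply_Ee measurableSet_Ioc
    (cell_subset _ _), hS.apply_apply measurableSet_Ioc hA, Set.inter_comm]

/-- A vector in the range of E_S, restricted to stopping before c, is known at c: under S([0, c])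
only the projections E_p with p ≤ c survive in the Riemann sums, and E_c E_p = E_p. -/
theorem E_apply_proj (hS : W.IsStop S) {A : Set ℝ≥0∞} (hA : MeasurableSet A) {c : ℝ≥0}
    (h : A ⊆ Set.Icc 0 c) {y : F} (hy : hS.proj y = y) : W.E c (S A y) = S A y := by
  rcases eq_zero_or_pos c with rfl | hc
  · rw [hS.apply_eq_zero_of_subset hA (measurableSet_singleton 0) (by simpa using h) hS.zero_eq]
    simp
  have hcc : W.E c (S (Set.Icc 0 c) y) = S (Set.Icc 0 c) y := by
    have h1 := ((S (Set.Icc 0 c)).continuous.tendsto _).comp (hS.tendsto_proj y)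
    rw [hy] at h1
    refine tendsto_nhds_unique (((W.E c).continuous.tendsto _).comp h1) (h1.congr' ?_)
    filter_upwards [eventually_ge_atTop (Partition.ofFinset ⊤ {(c : ℝ≥0∞)})] with π hπ
    have hcm : (c : ℝ≥0∞) ∈ π.points := Partition.mem_points_of_ofFinset_le hπ (by simp)
      (by exact_mod_cast hc) le_top
    simp only [Function.comp_apply]
    rw [hS.apply_riemannSum measurableSet_Icc, map_sum]
    refine Finset.sum_congr rfl fun p hp => ?_
    rcases le_or_gt p c with hpc | hpc
    · lift p to ℝ≥0 using (hpc.trans_lt ENNReal.coe_lt_top).ne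
      rw [W.Ee_coe, ← ((hS.adapted_of_subset (measurableSet_Icc.inter measurableSet_Ioc)
        Set.inter_subset_left).comm_E _), W.E_E_of_le (ENNReal.coe_le_coe.1 hpc)]
    · have : Set.Icc 0 (c : ℝ≥0∞) ∩ Set.Ioc (π.pred p) p = ∅ := by
        rw [← Set.disjoint_iff_inter_eq_empty, Set.disjoint_left]
        exact fun s h1 h2 => absurd (h1.2.trans (Partition.le_pred hcm hpc)) (not_le.2 h2.1)
      rw [this, hS.apply_empty]
      simp
  rw [← hS.apply_apply_of_subset hA measurableSet_Icc h,
    ← ((hS.adapted_of_subset hA h).comm_E _), hcc]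

end IsStop

end StopFlow

/-- The partition is the grid of step 1/m on (0, N + 1] with 1/m ≤ δ. Having N + 1 as a point
separates the finely divided range from the rest, where localised vectors vanish. -/
theorem Partition.exists_fine (N : ℕ) {δ : ℝ≥0} (hδ : 0 < δ) : ∃ π₀ : Partition (⊤ : ℝ≥0∞),
    ((N + 1 : ℕ) : ℝ≥0∞) ∈ π₀.points ∧ ∀ r : ℝ≥0, 0 < r → r ≤ (N + 1 : ℕ) →
      ∃ q : ℝ≥0, (q : ℝ≥0∞) ∈ π₀.points ∧ r ≤ q ∧ q ≤ (N + 1 : ℕ) ∧ q ≤ r + δ := by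
  obtain ⟨m, hm⟩ := exists_nat_gt (1 / δ)
  have hm0 : (0 : ℝ≥0) < m := lt_of_le_of_lt (by positivity) hm
  have hmδ : 1 / (m : ℝ≥0) ≤ δ := by
    rw [div_le_iff₀ hm0, mul_comm, ← div_le_iff₀ hδ]
    exact hm.le
  have hgrid : ∀ j : ℕ, j ∈ Finset.range ((N + 1) * m + 1) → 0 < j →
      (((j / m : ℝ≥0) : ℝ≥0∞)) ∈ (Partition.ofFinset ⊤
        ((Finset.range ((N + 1) * m + 1)).image fun j : ℕ =>
          ((j / m : ℝ≥0) : ℝ≥0∞))).points := by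
    intro j hj h0
    refine Partition.mem_points_of_ofFinset_le le_rfl (Finset.mem_image_of_mem _ hj) ?_ le_top
    have : (0 : ℝ≥0) < j / m := div_pos (by exact_mod_cast h0) hm0
    exact_mod_cast this
  refine ⟨Partition.ofFinset ⊤ ((Finset.range ((N + 1) * m + 1)).image fun j : ℕ =>
    ((j / m : ℝ≥0) : ℝ≥0∞)), ?_, fun r hr hrN => ?_⟩
  · have := hgrid ((N + 1) * m) (by simp) (by have : 0 < m := by exact_mod_cast hm0
                                              positivity)
    have h2 : ((((N + 1) * m : ℕ) : ℝ≥0) / m : ℝ≥0) = ((N + 1 : ℕ) : ℝ≥0) := by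
      push_cast
      field_simp
    rw [h2] at this
    exact_mod_cast this
  · have h1 : ⌈r * m⌉₊ ≤ (N + 1) * m := by
      rw [Nat.ceil_le]
      push_cast
      have : r ≤ (N : ℝ≥0) + 1 := by exact_mod_cast hrN
      gcongr
    refine ⟨⌈r * m⌉₊ / m, hgrid _ (by simpa [Nat.lt_succ_iff] using h1)
      (Nat.ceil_pos.2 (by positivity)), ?_, ?_, ?_⟩
    · rw [le_div_iff₀ hm0]
      exact Nat.le_ceil _
    · rw [div_le_iff₀ hm0]
      exact_mod_cast h1
    · rw [div_le_iff₀ hm0]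
      calc ((⌈r * m⌉₊ : ℕ) : ℝ≥0) ≤ r * m + 1 := (Nat.ceil_lt_add_one (by positivity)).le
        _ ≤ r * m + δ * m := by
          gcongr
          rwa [← div_le_iff₀ hm0]
        _ = _ := by ring

/-- Disjoint cells kill vectors that are localised elsewhere. -/
theorem IsSpectralMeasure.apply_eq_zero_of_disjoint {α : Type*} [MeasurableSpace α] {F : Type*}
    [NormedAddCommGroup F] [InnerProductSpace ℂ F] [CompleteSpace F] {S : Set α → F →L[ℂ] F}
    (hS : IsSpectralMeasure S) {A B : Set α} (hA : MeasurableSet A) (hB : MeasurableSet B)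
    (hd : Disjoint A B) {y : F} (hy : S B y = y) : S A y = 0 := by
  rw [← hy, hS.apply_apply_of_disjoint hA hB hd]

/-! ### The joint stop integral of E_s y ⊗ Γ_s x -/

namespace StopFlow

variable {F : Type*} [NormedAddCommGroup F] [InnerProductSpace ℂ F] [CompleteSpace F]
  {W : StopFlow F}

theorem norm_Me_le (p : ℝ≥0∞) (y x : F) : ‖W.Me p y x‖ ≤ ‖W.Ee p y‖ * ‖x‖ := by
  induction p with
  | top => simpa using by positivity
  | coe p => simpa using (W.norm_M p y x).le

theorem norm_Me_le' (p : ℝ≥0∞) (y x : F) : ‖W.Me p y x‖ ≤ ‖y‖ * ‖x‖ := by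
  refine (norm_Me_le p y x).trans ?_
  gcongr
  exact norm_proj_le (W.isStarProjection_Ee p) y

theorem tendsto_shift (W : StopFlow F) (x : F) {ε : ℝ} (hε : 0 < ε) :
    ∃ δ : ℝ≥0, 0 < δ ∧ ∀ r ≤ δ, ‖W.M r W.Ω x - x‖ ≤ ε := by
  have h := (W.continuous_M W.Ω x).tendsto 0
  rw [W.M_zero, Metric.tendsto_nhds_nhds] at h
  obtain ⟨δ, hδ, h⟩ := h ε hε
  lift δ to ℝ≥0 using hδ.le
  have hδ' : 0 < δ := by exact_mod_cast hδ
  refine ⟨δ / 2, half_pos hδ', fun r hr => ?_⟩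
  rw [← dist_eq_norm]
  refine (h ?_).le
  rw [NNReal.dist_eq, NNReal.coe_zero, sub_zero, abs_of_nonneg r.coe_nonneg, NNReal.coe_lt_coe]
  exact hr.trans_lt (half_lt_self hδ')

namespace IsStop

variable {S : Set ℝ≥0∞ → F →L[ℂ] F}

/-- The terms of either sum are mutually orthogonal, so the factor ‖x‖ of each cell can be taken
out. The bound shows that the joint sums are controlled by E_S alone, whatever the partition. -/
theorem norm_riemannSum_Me_le (hS : W.IsStop S) (y x : F) (π : Partition (⊤ : ℝ≥0∞)) :
    ‖riemannSum S ⊤ (fun s => W.Me s y x) π‖ ≤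
      ‖riemannSum S ⊤ (fun s => W.Ee s y) π‖ * ‖x‖ := by
  refine (pow_le_pow_iff_left₀ (norm_nonneg _) (by positivity) two_ne_zero).1 ?_
  rw [mul_pow, riemannSum, riemannSum,
    hS.norm_sum_sq _ (fun p _ => π.measurableSet_cell p) π.pairwiseDisjoint_cells,
    hS.norm_sum_sq _ (fun p _ => π.measurableSet_cell p) π.pairwiseDisjoint_cells,
    Finset.sum_mul]
  refine Finset.sum_le_sum fun p hp => ?_
  rw [← mul_pow, hS.apply_Me measurableSet_Ioc (cell_subset _ _),
    hS.apply_Ee measurableSet_Ioc (cell_subset _ _)]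
  exact pow_le_pow_left₀ (norm_nonneg _) (norm_Me_le _ _ _) 2

theorem norm_riemannSum_Me_le' (hS : W.IsStop S) (y x : F) (π : Partition (⊤ : ℝ≥0∞)) :
    ‖riemannSum S ⊤ (fun s => W.Me s y x) π‖ ≤ ‖y‖ * ‖x‖ := by
  refine (hS.norm_riemannSum_Me_le y x π).trans ?_
  rw [← approx_apply]
  gcongr
  exact norm_proj_le (hS.isStarProjection_approx π) y

/-- On a fine cell ending at p with coarse successor r, the vector S(cell)y is fixed by E_p. Hence
M_r(S(cell)y, x) = M_p(S(cell)y, Γ_{r-p}x), and the difference of the two sums on the cell is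
controlled by ‖Γ_{r-p}x - x‖, small uniformly since r - p ≤ δ. -/
theorem cauchySeq_of_localised (hS : W.IsStop S) {y : F} (hy : hS.proj y = y) {N : ℕ}
    (hN : S (Set.Icc 0 (N + 1 : ℕ)) y = y) (x : F) :
    CauchySeq (riemannSum S ⊤ fun s => W.Me s y x) := by
  rw [Metric.cauchySeq_iff']
  intro ε hε
  have hε' : 0 < ε / (‖y‖ + 1) := by positivity
  obtain ⟨δ, hδ, hδx⟩ := tendsto_shift W x hε'
  obtain ⟨π₀, hN0, hfine⟩ := Partition.exists_fine N hδ
  refine ⟨π₀, fun π hπ => ?_⟩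
  rw [dist_eq_norm, hS.riemannSum_of_le ENNReal.zero_lt_top hπ, ← riemannSum_sub]
  refine lt_of_le_of_lt (hS.norm_riemannSum_le (ξ := y) hε'.le fun p hp => ?_) ?_
  · have hp0 := Partition.pos_of_mem_points ENNReal.zero_lt_top hp
    rw [map_sub, hS.apply_Me measurableSet_Ioc (cell_subset _ _), hS.apply_Me measurableSet_Ioc
      ((cell_subset _ _).trans (Set.Icc_subset_Icc_right (π₀.next_mem le_top).2))]
    rcases le_or_gt p (N + 1 : ℕ) with hpN | hpN
    · lift p to ℝ≥0 using (hpN.trans_lt (ENNReal.natCast_lt_top _)).ne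
      have hpN' : p ≤ (N + 1 : ℕ) := by exact_mod_cast hpN
      obtain ⟨q, hq, hpq, -, hqp⟩ := hfine p (by exact_mod_cast hp0) hpN'
      have h1 := Partition.next_le hq (ENNReal.coe_le_coe.2 hpq)
      have h2 := (π₀.next_mem (p := p) le_top).2
      generalize π₀.next p = r at h1 h2 ⊢
      lift r to ℝ≥0 using (h1.trans_lt ENNReal.coe_lt_top).ne
      have hpr : p ≤ r := by exact_mod_cast h2
      have hrp : r - p ≤ δ := tsub_le_iff_left.2 ((ENNReal.coe_le_coe.1 h1).trans hqp)
      rw [W.Me_coe, W.Me_coe]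
      have h3 := hS.E_apply_proj measurableSet_Ioc (cell_subset (π.pred p) (p : ℝ≥0∞)) hy
      have h4 := W.M_E_of_le hpr (S (Set.Ioc (π.pred p) p) y) x
      rw [h3] at h4
      rw [h4, ← map_sub]
      refine (W.norm_M_le _ _ _).trans ?_
      rw [mul_comm, norm_sub_rev]
      gcongr
      exact hδx _ hrp
    -- Such a cell starts at or after N + 1, where y has no mass, so no control of the mesh is
    -- needed.
    · have hNp : ((N + 1 : ℕ) : ℝ≥0∞) ≤ π.pred p :=
        Partition.le_pred (Partition.points_mono hπ hN0) hpN
      have : S (Set.Ioc (π.pred p) p) y = 0 :=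
        hS.apply_eq_zero_of_disjoint measurableSet_Ioc measurableSet_Icc
          (Set.disjoint_left.2 fun s h1 h2 => absurd (h2.2.trans hNp) (not_le.2 h1.1)) hN
      simp [this]
  · rw [div_mul_eq_mul_div, div_lt_iff₀ (by positivity)]
    nlinarith [norm_nonneg y]

theorem cauchySeq_of_approx (hS : W.IsStop S) {y x : F} {u : ℕ → F}
    (hu : Tendsto u atTop (𝓝 y))
    (h : ∀ n, CauchySeq (riemannSum S ⊤ fun s => W.Me s (u n) x)) :
    CauchySeq (riemannSum S ⊤ fun s => W.Me s y x) := by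
  rw [Metric.cauchySeq_iff']
  intro ε hε
  have hε' : 0 < ε / (4 * (‖x‖ + 1)) := by positivity
  obtain ⟨n, hn⟩ := (Metric.tendsto_atTop.1 hu) _ hε'
  have hn := hn n le_rfl
  rw [dist_comm, dist_eq_norm] at hn
  obtain ⟨π₀, hπ₀⟩ := (Metric.cauchySeq_iff'.1 (h n)) (ε / 4) (by positivity)
  have key : ∀ π, dist (riemannSum S ⊤ (fun s => W.Me s y x) π)
      (riemannSum S ⊤ (fun s => W.Me s (u n) x) π) ≤ ε / 4 := by
    intro π
    have h1 := hS.norm_riemannSum_Me_le' (y - u n) x π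
    simp only [map_sub, sub_apply, riemannSum_sub] at h1
    rw [dist_eq_norm]
    refine h1.trans ?_
    calc ‖y - u n‖ * ‖x‖ ≤ ε / (4 * (‖x‖ + 1)) * (‖x‖ + 1) := by
          gcongr
          linarith
      _ = ε / 4 := by field_simp
  refine ⟨π₀, fun π hπ => ?_⟩
  have h1 := dist_triangle4 (riemannSum S ⊤ (fun s => W.Me s y x) π)
      (riemannSum S ⊤ (fun s => W.Me s (u n) x) π) (riemannSum S ⊤ (fun s => W.Me s (u n) x) π₀)
      (riemannSum S ⊤ (fun s => W.Me s y x) π₀)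
  have h2 := key π
  have h3 := key π₀
  rw [dist_comm] at h3
  have h4 := hπ₀ π hπ
  linarith

/-- The range and the kernel of E_S are treated separately. Vectors of the range are limits of
localised ones; for a vector of the kernel the sums are bounded by ‖x‖ times the Riemann sums of
E_S, which tend to 0. -/
theorem exists_tendsto_joint (hS : W.IsStop S) (y x : F) :
    ∃ v, Tendsto (riemannSum S ⊤ fun s => W.Me s y x) atTop (𝓝 v) := by
  have hproj : hS.proj (hS.proj y) = hS.proj y := proj_proj hS.isStarProjection_proj y
  have h1 : CauchySeq (riemannSum S ⊤ fun s => W.Me s (hS.proj y) x) := by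
    refine hS.cauchySeq_of_approx (u := fun n : ℕ => S (Set.Icc 0 (n + 1 : ℕ)) (hS.proj y))
      ((hS.tendsto_apply_Icc_nat hS.top_eq (hS.proj y)).comp (tendsto_add_atTop_nat 1)) fun n => ?_
    refine hS.cauchySeq_of_localised (N := n) ?_ ?_ x
    · rw [← hS.apply_proj measurableSet_Icc, hproj]
    · exact proj_proj (hS.isStarProjection _ measurableSet_Icc) _
  obtain ⟨v, hv⟩ := cauchySeq_tendsto_of_complete h1
  refine ⟨v, ?_⟩
  have h2 : Tendsto (riemannSum S ⊤ fun s => W.Me s (y - hS.proj y) x) atTop (𝓝 0) := by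
    rw [tendsto_zero_iff_norm_tendsto_zero]
    have h3 := (hS.tendsto_proj (y - hS.proj y)).norm.mul_const ‖x‖
    rw [map_sub, hproj, sub_self, norm_zero, zero_mul] at h3
    exact squeeze_zero (fun _ => norm_nonneg _)
      (fun π => hS.norm_riemannSum_Me_le (y - hS.proj y) x π) h3
  have h4 := hv.add h2
  rw [add_zero] at h4
  refine h4.congr fun π => ?_
  rw [← riemannSum_add]
  simp

/-- The map `(y, x) ↦ ∫ S(ds) (E_s y ⊗ Γ_s x)`. -/
def joint (hS : W.IsStop S) : F →L[ℂ] F →L[ℂ] F :=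
  LinearMap.mkContinuous₂ (LinearMap.mk₂ ℂ (fun y x => (hS.exists_tendsto_joint y x).choose)
    (fun y y' x => tendsto_nhds_unique (hS.exists_tendsto_joint _ _).choose_spec
      (((hS.exists_tendsto_joint y x).choose_spec.add
        (hS.exists_tendsto_joint y' x).choose_spec).congr fun π => by
          rw [← riemannSum_add]; simp))
    (fun c y x => tendsto_nhds_unique (hS.exists_tendsto_joint _ _).choose_spec
      (((hS.exists_tendsto_joint y x).choose_spec.const_smul c).congr fun π => by
          rw [← riemannSum_smul]; simp))
    (fun y x x' => tendsto_nhds_unique (hS.exists_tendsto_joint _ _).choose_spec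
      (((hS.exists_tendsto_joint y x).choose_spec.add
        (hS.exists_tendsto_joint y x').choose_spec).congr fun π => by
          rw [← riemannSum_add]; simp))
    (fun c y x => tendsto_nhds_unique (hS.exists_tendsto_joint _ _).choose_spec
      (((hS.exists_tendsto_joint y x).choose_spec.const_smul c).congr fun π => by
          rw [← riemannSum_smul]; simp))) 1
    fun y x => by
      rw [one_mul]
      exact le_of_tendsto (hS.exists_tendsto_joint y x).choose_spec.norm
        (Eventually.of_forall fun π => hS.norm_riemannSum_Me_le' y x π)

theorem tendsto_joint (hS : W.IsStop S) (y x : F) :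
    Tendsto (riemannSum S ⊤ fun s => W.Me s y x) atTop (𝓝 (hS.joint y x)) :=
  (hS.exists_tendsto_joint y x).choose_spec

theorem joint_vac (hS : W.IsStop S) (y : F) : hS.joint y W.Ω = hS.proj y := by
  refine tendsto_nhds_unique (hS.tendsto_joint y W.Ω)
    (hS.tendsto_riemannSum_congr hS.top_eq (hS.tendsto_proj y) fun s hs => ?_)
  lift s to ℝ≥0 using hs
  simp [E_apply]

/-- Both integrals are taken along the same partition. A cell projection selects its own term from
the other sum, so cross terms vanish; on one cell it moves into the past argument, where `inner_M`
factorises the inner product. -/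
theorem inner_joint (hS : W.IsStop S) (y x y' x' : F) :
    ⟪hS.joint y x, hS.joint y' x'⟫_ℂ = ⟪y, hS.proj y'⟫_ℂ * ⟪x, x'⟫_ℂ := by
  rw [← hS.joint_vac]
  refine tendsto_nhds_unique ((hS.tendsto_joint y x).inner (hS.tendsto_joint y' x'))
    (((tendsto_const_nhds.inner (hS.tendsto_joint y' W.Ω)).mul_const _).congr fun π => ?_)
  rw [riemannSum, riemannSum, sum_inner, inner_sum, Finset.sum_mul]
  refine Finset.sum_congr rfl fun p hp => ?_
  have hD := hS.isStarProjection _ (π.measurableSet_cell p)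
  have h2 : ⟪W.Me p (S (Set.Ioc (π.pred p) p) y) x, W.Me p y' x'⟫_ℂ =
      ⟪S (Set.Ioc (π.pred p) p) y, W.Me p y' W.Ω⟫_ℂ * ⟪x, x'⟫_ℂ := by
    induction p with
    | top => simp
    | coe p => simpa using W.inner_M _ _ _ _ _
  calc _ = ⟪S (Set.Ioc (π.pred p) p) y, W.Me p y' W.Ω⟫_ℂ * ⟪x, x'⟫_ℂ := by rw [proj_inner hD]
    _ = ⟪S (Set.Ioc (π.pred p) p) (W.Me p y x), W.Me p y' x'⟫_ℂ := by
      rw [← h2, hS.apply_Me measurableSet_Ioc (cell_subset _ _)]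
    _ = ⟪W.Me p y x, S (Set.Ioc (π.pred p) p) (riemannSum S ⊤ (fun s => W.Me s y' x') π)⟫_ℂ := by
      rw [hS.apply_cell_riemannSum hp, proj_inner hD]
    _ = _ := by
      rw [← proj_inner hD]

theorem norm_joint (hS : W.IsStop S) (y x : F) : ‖hS.joint y x‖ = ‖hS.proj y‖ * ‖x‖ := by
  have h := hS.inner_joint y x y x
  rw [inner_proj_self hS.isStarProjection_proj] at h
  simp only [inner_self_eq_norm_sq_to_K] at h
  change ((‖hS.joint y x‖ : ℝ) : ℂ) ^ 2 = ((‖hS.proj y‖ ^ 2 : ℝ) : ℂ) * ((‖x‖ : ℝ) : ℂ) ^ 2 at h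
  have h2 : ‖hS.joint y x‖ ^ 2 = ‖hS.proj y‖ ^ 2 * ‖x‖ ^ 2 := by exact_mod_cast h
  rw [← mul_pow] at h2
  exact (pow_left_inj₀ (norm_nonneg _) (by positivity) two_ne_zero).1 h2

theorem joint_proj (hS : W.IsStop S) (y x : F) : hS.joint (hS.proj y) x = hS.joint y x := by
  rw [← sub_eq_zero, ← sub_apply, ← map_sub, ← norm_eq_zero, norm_joint, map_sub,
    proj_proj hS.isStarProjection_proj, sub_self, norm_zero, zero_mul]

/-- Only the part of A inside a cell ending at p matters, and its projection is adapted at p; so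
S(A) acts on the past argument alone. -/
theorem apply_joint (hS : W.IsStop S) {A : Set ℝ≥0∞} (hA : MeasurableSet A) (y x : F) :
    S A (hS.joint y x) = hS.joint (S A y) x := by
  refine tendsto_nhds_unique (((S A).continuous.tendsto _).comp (hS.tendsto_joint y x))
    ((hS.tendsto_joint (S A y) x).congr fun π => ?_)
  rw [Function.comp_apply, riemannSum, riemannSum, map_sum]
  refine Finset.sum_congr rfl fun p hp => ?_
  rw [hS.apply_apply hA measurableSet_Ioc, hS.apply_Me (hA.inter measurableSet_Ioc)
    (Set.inter_subset_right.trans (cell_subset _ _)), hS.apply_Me measurableSet_Ioc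
    (cell_subset _ _), hS.apply_apply measurableSet_Ioc hA, Set.inter_comm]

/-- A cell of a partition that contains `c` is disjoint from `(a, c]`, or it lies before `c`. -/
theorem cell_disjoint_or {a : ℝ≥0∞} {c : ℝ≥0∞} {π : Partition (⊤ : ℝ≥0∞)} (hc : c ∈ π.points)
    (q : ℝ≥0∞) : Disjoint (Set.Ioc (π.pred q) q) (Set.Ioc a c) ∨ (a < q ∧ q ≤ c) := by
  rcases le_or_gt q c with h | h
  · rcases le_or_gt q a with h' | h'
    · exact Or.inl (Set.disjoint_left.2 fun s h1 h2 => absurd (h1.2.trans h') (not_le.2 h2.1))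
    · exact Or.inr ⟨h', h⟩
  · exact Or.inl (Set.disjoint_left.2 fun s h1 h2 =>
      absurd (h2.2.trans (Partition.le_pred hc h)) (not_le.2 h1.1))

theorem eventually_mem_points {c : ℝ≥0∞} (hc : 0 < c) :
    ∀ᶠ π : Partition (⊤ : ℝ≥0∞) in atTop, c ∈ π.points := by
  filter_upwards [eventually_ge_atTop (Partition.ofFinset ⊤ {c})] with π hπ
  exact Partition.mem_points_of_ofFinset_le hπ (by simp) hc le_top

/-- If the second argument of the integrand varies little over `(a, c]`, then it may be replaced by
a constant. -/
theorem norm_sub_joint_le (hS : W.IsStop S) {a c : ℝ≥0} (hac : a < c) {y x V : F}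
    (hy : S (Set.Ioc a c) y = y) {v : ℝ≥0 → F} {η : ℝ} (hη : 0 ≤ η)
    (hv : ∀ r ∈ Set.Ioc a c, ‖v r - x‖ ≤ η)
    (hV : Tendsto (riemannSum S ⊤ fun s => W.Me s y (v s.toNNReal)) atTop (𝓝 V)) :
    ‖V - hS.joint y x‖ ≤ η * ‖y‖ := by
  refine le_of_tendsto (hV.sub (hS.tendsto_joint y x)).norm ?_
  filter_upwards [eventually_mem_points (c := (c : ℝ≥0∞))
    (by exact_mod_cast bot_le.trans_lt hac)] with π hπ
  rw [← riemannSum_sub]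
  refine hS.norm_riemannSum_le hη fun q hq => ?_
  rw [← map_sub, hS.apply_Me measurableSet_Ioc (cell_subset _ _)]
  rcases cell_disjoint_or (a := a) hπ q with h | ⟨h1, h2⟩
  · rw [hS.apply_eq_zero_of_disjoint measurableSet_Ioc measurableSet_Ioc h hy]
    simp
  · lift q to ℝ≥0 using (h2.trans_lt ENNReal.coe_lt_top).ne
    rw [mul_comm]
    refine (norm_Me_le' _ _ _).trans ?_
    gcongr
    exact hv q ⟨by exact_mod_cast h1, by exact_mod_cast h2⟩

/-- By associativity M_b(M_r(X, Y), z) = M_r(X, M_{b-r}(Y, z)), so the left term is a stop integral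
with a second argument that depends on r. When this varies little over (a, c], it may be frozen at
x. -/
theorem norm_M_joint_sub_le (hS : W.IsStop S) {a c b : ℝ≥0} (hac : a < c) (hcb : c ≤ b)
    {X : F} (hX : S (Set.Ioc a c) X = X) (Y z x : F) {η : ℝ} (hη : 0 ≤ η)
    (hv : ∀ r ∈ Set.Ioc a c, ‖W.M (b - r) Y z - x‖ ≤ η) :
    ‖W.M b (hS.joint X Y) z - hS.joint X x‖ ≤ η * ‖X‖ := by
  refine hS.norm_sub_joint_le hac hX hη hv ?_
  have h1 := (((W.M b).flip z).continuous.tendsto _).comp (hS.tendsto_joint X Y)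
  refine h1.congr' ?_
  filter_upwards [eventually_mem_points (c := (c : ℝ≥0∞))
    (by exact_mod_cast bot_le.trans_lt hac)] with π hπ
  rw [Function.comp_apply, riemannSum, riemannSum, map_sum]
  refine Finset.sum_congr rfl fun q hq => ?_
  rw [hS.apply_Me measurableSet_Ioc (cell_subset _ _), hS.apply_Me measurableSet_Ioc
    (cell_subset _ _)]
  rcases cell_disjoint_or (a := a) hπ q with h | ⟨h1, h2⟩
  · rw [hS.apply_eq_zero_of_disjoint measurableSet_Ioc measurableSet_Ioc h hX]
    simp
  · lift q to ℝ≥0 using (h2.trans_lt ENNReal.coe_lt_top).ne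
    have hqb : q ≤ b := (ENNReal.coe_le_coe.1 h2).trans hcb
    have := W.assoc q (b - q) (S (Set.Ioc (π.pred q) q) X) Y z
    rw [add_tsub_cancel_of_le hqb] at this
    simpa using this

end IsStop

end StopFlow

/-! ### Grids, and totality of the joint map -/

/-- The interval `(j / m, (j + 1) / m]`. -/
def gridCell (m j : ℕ) : Set ℝ≥0∞ :=
  Set.Ioc ((j / m : ℝ≥0) : ℝ≥0∞) (((j + 1 : ℕ) / m : ℝ≥0) : ℝ≥0∞)

theorem measurableSet_gridCell (m j : ℕ) : MeasurableSet (gridCell m j) := measurableSet_Ioc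

theorem monotone_grid (m : ℕ) : Monotone fun j : ℕ => ((j / m : ℝ≥0) : ℝ≥0∞) := fun i j h => by
  have : (i / m : ℝ≥0) ≤ j / m := by gcongr
  exact ENNReal.coe_le_coe.2 this

theorem pairwise_disjoint_gridCell (m : ℕ) : Pairwise (Function.onFun Disjoint (gridCell m)) :=
  (monotone_grid m).pairwise_disjoint_on_Ioc_succ

theorem biUnion_gridCell (m L : ℕ) :
    ⋃ j ∈ Finset.range L, gridCell m j = Set.Ioc 0 ((L / m : ℝ≥0) : ℝ≥0∞) := by
  induction L with
  | zero => simp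
  | succ L ih =>
    rw [Finset.range_add_one, Finset.set_biUnion_insert, ih, Set.union_comm, gridCell,
      Set.Ioc_union_Ioc_eq_Ioc zero_le (monotone_grid m L.le_succ)]

theorem exists_mem_gridCell {m : ℕ} (hm : 0 < m) {s : ℝ≥0} (hs : 0 < s) :
    ∃ j : ℕ, (s : ℝ≥0∞) ∈ gridCell m j ∧ (j : ℝ≥0) < s * m := by
  obtain ⟨L, hL⟩ := exists_nat_gt (s * m)
  have hm' : (0 : ℝ≥0) < m := by exact_mod_cast hm
  have : (s : ℝ≥0∞) ∈ ⋃ j ∈ Finset.range L, gridCell m j := by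
    rw [biUnion_gridCell]
    refine ⟨by exact_mod_cast hs, ?_⟩
    rw [ENNReal.coe_le_coe, le_div_iff₀ hm']
    exact hL.le
  simp only [Set.mem_iUnion, exists_prop] at this
  obtain ⟨j, -, hj⟩ := this
  refine ⟨j, hj, ?_⟩
  rw [← div_lt_iff₀ hm']
  exact_mod_cast hj.1

namespace StopFlow

variable {F : Type*} [NormedAddCommGroup F] [InnerProductSpace ℂ F] [CompleteSpace F]
  {W : StopFlow F}

namespace IsStop

variable {S : Set ℝ≥0∞ → F →L[ℂ] F}

theorem apply_Icc_eq_Ioc (hS : W.IsStop S) (t : ℝ≥0∞) : S (Set.Icc 0 t) = S (Set.Ioc 0 t) := by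
  rw [← add_zero (S (Set.Ioc 0 t)), ← hS.zero_eq, ← hS.apply_union measurableSet_Ioc
    (measurableSet_singleton 0) (by simp)]
  congr 1
  ext s
  rcases eq_or_ne s 0 with rfl | h
  · simp
  · simp

/-- The integrand is constant up to the cell projections: M_s(e, v(s)) = e at every finite s, and
the part of S(C) inside a cell passes through M_s by adaptedness. -/
theorem tendsto_tail (hS : W.IsStop S) {C : Set ℝ≥0∞} (hC : MeasurableSet C) {e : F}
    {v : ℝ≥0 → F} (hv : ∀ c, W.M c e (v c) = e) :
    Tendsto (riemannSum S ⊤ fun s => W.Me s (S C e) (v s.toNNReal)) atTop (𝓝 (S C e)) := by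
  classical
  have h1 : Tendsto (riemannSum S ⊤ fun _ => S C e) atTop (𝓝 (S C e)) :=
    tendsto_const_nhds.congr fun π => (hS.riemannSum_const hS.zero_eq π _).symm
  -- The constant integrand is reset to 0 at infinity to match the convention for `Me`.
  have h2 := hS.tendsto_riemannSum_congr (Ψ := fun s => if s = ⊤ then 0 else S C e) hS.top_eq h1
    fun s hs => by simp [hs]
  refine h2.congr fun π => Finset.sum_congr rfl fun q _ => ?_
  induction q with
  | top => simp
  | coe q =>
    have h3 := hS.adapted_of_subset (c := q)
      (measurableSet_Ioc.inter hC : MeasurableSet (Set.Ioc (π.pred q) (q : ℝ≥0∞) ∩ C))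
      (Set.inter_subset_left.trans (cell_subset _ _)) e (v q)
    dsimp only
    rw [if_neg ENNReal.coe_ne_top, hS.apply_Me measurableSet_Ioc (cell_subset _ _),
      hS.apply_apply measurableSet_Ioc hC, W.Me_coe, ENNReal.toNNReal_coe, ← h3, hv]

/-- A generator satisfies e = M_s(e, v(s)) with v continuous. After localisation to [0, N] and a
division into short cells, v is replaced on each cell by its value at the right end point, which
turns the integral into a finite sum of values of `joint`. -/
theorem joint_total (hS : W.IsStop S) : (Submodule.span ℂ
    (Set.range fun p : F × F => hS.joint p.1 p.2)).topologicalClosure = ⊤ := by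
  set K := (Submodule.span ℂ (Set.range fun p : F × F => hS.joint p.1 p.2)).topologicalClosure
    with hK
  have hKc : IsClosed (K : Set F) := Submodule.isClosed_topologicalClosure _
  have hmem : ∀ y x, hS.joint y x ∈ K := fun y x =>
    Submodule.le_topologicalClosure _ (Submodule.subset_span ⟨(y, x), rfl⟩)
  rw [eq_top_iff, ← W.gen_total]
  refine Submodule.topologicalClosure_minimal _ (Submodule.span_le.2 fun e he => ?_) hKc
  obtain ⟨v, hvc, hv⟩ := W.exists_tail e he
  refine hKc.mem_of_tendsto (hS.tendsto_apply_Icc_nat hS.top_eq e) (Eventually.of_forall fun N => ?_)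
  rw [← hKc.closure_eq, Metric.mem_closure_iff]
  intro ε hε
  have hε' : 0 < ε / (‖e‖ + 1) := by positivity
  have huc := isCompact_Icc.uniformContinuousOn_of_continuous (s := Set.Icc (0 : ℝ≥0) N)
    hvc.continuousOn
  obtain ⟨δ, hδ, huc⟩ := (Metric.uniformContinuousOn_iff.1 huc) _ hε'
  obtain ⟨m, hm⟩ := exists_nat_gt (1 / δ)
  have hm0 : (0 : ℝ) < m := lt_trans (by positivity) hm
  have hm1 : (0 : ℝ≥0) < m := by exact_mod_cast hm0
  refine ⟨∑ j ∈ Finset.range (N * m), hS.joint (S (gridCell m j) e) (v ((j + 1 : ℕ) / m)),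
    K.sum_mem fun j _ => hmem _ _, ?_⟩
  have hN : S (Set.Icc 0 N) e = ∑ j ∈ Finset.range (N * m), S (gridCell m j) e := by
    have h1 : (((N * m : ℕ) : ℝ≥0) / m : ℝ≥0) = N := by push_cast; field_simp
    rw [hS.apply_Icc_eq_Ioc, ← sum_apply, ← hS.apply_biUnion _
      (fun j _ => measurableSet_gridCell m j) ((pairwise_disjoint_gridCell m).set_pairwise _),
      biUnion_gridCell, h1]
    rfl
  have hd : S (Set.Icc 0 N) e -
      ∑ j ∈ Finset.range (N * m), hS.joint (S (gridCell m j) e) (v ((j + 1 : ℕ) / m)) =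
      ∑ j ∈ Finset.range (N * m), S (gridCell m j) (e - hS.joint e (v ((j + 1 : ℕ) / m))) := by
    rw [hN, ← Finset.sum_sub_distrib]
    refine Finset.sum_congr rfl fun j _ => ?_
    rw [map_sub, hS.apply_joint (measurableSet_gridCell m j)]
  rw [dist_eq_norm, hd]
  refine lt_of_le_of_lt (hS.norm_sum_le _ (fun j _ => measurableSet_gridCell m j)
    ((pairwise_disjoint_gridCell m).set_pairwise _) _ e hε'.le fun j hj => ?_) ?_
  · rw [map_sub, hS.apply_joint (measurableSet_gridCell m j)]
    have hj1 : ((j + 1 : ℕ) / m : ℝ≥0) ≤ N := by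
      rw [div_le_iff₀ hm1]
      exact_mod_cast Finset.mem_range.1 hj
    have hlt : (j / m : ℝ≥0) < (j + 1 : ℕ) / m := by
      rw [div_lt_div_iff_of_pos_right hm1]
      exact_mod_cast j.lt_succ_self
    refine hS.norm_sub_joint_le (v := v) hlt (proj_proj (hS.isStarProjection _
      (measurableSet_gridCell m j)) e) hε'.le (fun r hr => ?_) (hS.tendsto_tail
      (measurableSet_gridCell m j) hv)
    rw [← dist_eq_norm]
    refine (huc r ⟨bot_le, hr.2.trans hj1⟩ _ ⟨bot_le, hj1⟩ ?_).le
    rw [NNReal.dist_eq, abs_sub_comm, abs_of_nonneg (sub_nonneg.2 (NNReal.coe_le_coe.2 hr.2))]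
    have h1 : ((j / m : ℝ≥0) : ℝ) < r := by exact_mod_cast hr.1
    push_cast at h1 ⊢
    have h2 : 1 / (m : ℝ) < δ := by
      rw [div_lt_iff₀ hm0, mul_comm, ← div_lt_iff₀ hδ]
      exact hm
    have h3 : ((j : ℝ) + 1) / m = j / m + 1 / m := by ring
    linarith
  · rw [div_mul_eq_mul_div, div_lt_iff₀ (by positivity)]
    nlinarith [norm_nonneg e]

end IsStop

end StopFlow

/-! ### Products of complex measures and of spectral measures -/

/-- The variation is dominated by the sum of those of the real and imaginary parts. Finiteness is
what the product of complex measures requires. -/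
theorem isFiniteMeasure_variation {α : Type*} [MeasurableSpace α] (μ : ComplexMeasure α) :
    IsFiniteMeasure μ.variation := by
  refine isFiniteMeasure_of_le ((ComplexMeasure.re μ).totalVariation +
    (ComplexMeasure.im μ).totalVariation)
    (VectorMeasure.variation_le_of_forall_enorm_le fun A _ => ?_)
  rw [Measure.add_apply]
  have h1 : μ A = ((ComplexMeasure.re μ A : ℝ) : ℂ) + ((ComplexMeasure.im μ A : ℝ) : ℂ) *
    Complex.I := (Complex.re_add_im (μ A)).symm
  rw [h1]
  refine (enorm_add_le _ _).trans (add_le_add ?_ ?_)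
  · refine le_trans (le_of_eq ?_) (SignedMeasure.enorm_le_totalVariation _ A)
    rw [← ofReal_norm, ← ofReal_norm, Complex.norm_real]
  · refine le_trans (le_of_eq ?_) (SignedMeasure.enorm_le_totalVariation _ A)
    rw [← ofReal_norm, ← ofReal_norm, norm_mul, Complex.norm_I, mul_one,
      Complex.norm_real]

theorem exists_prod_complexMeasure {α β : Type*} [MeasurableSpace α] [MeasurableSpace β]
    (μ : ComplexMeasure α) (ν : ComplexMeasure β) : ∃ ρ : ComplexMeasure (α × β),
    ∀ A B, MeasurableSet A → MeasurableSet B → ρ (A ×ˢ B) = μ A * ν B := by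
  have := isFiniteMeasure_variation μ
  have h : VectorMeasure.HasProd μ ν (ContinuousLinearMap.mul ℝ ℂ) := inferInstance
  exact h.exists_prod

section

variable {E : Type*} [NormedAddCommGroup E] [InnerProductSpace ℂ E] [CompleteSpace E]

/-- The partial sums are increasing projections, hence converge strongly. Unconditional summation of
the matrix elements needs absolute convergence as well; it follows from |⟪x, Qₙ y⟫| ≤ ‖Qₙ x‖² + ‖Qₙ
y‖² and Bessel's inequality. -/
theorem exists_sum_of_orthogonal {Q : ℕ → E →L[ℂ] E} (hQ : ∀ n, IsStarProjection (Q n))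
    (ho : ∀ m n, m ≠ n → Q m * Q n = 0) : ∃ P : E →L[ℂ] E, IsStarProjection P ∧
      ∀ x y, HasSum (fun n => ⟪x, Q n y⟫_ℂ) ⟪x, P y⟫_ℂ := by
  have hps : ∀ n, IsStarProjection (∑ m ∈ Finset.range n, Q m) := by
    intro n
    induction n with
    | zero => simp
    | succ n ih =>
      rw [Finset.sum_range_succ]
      refine ih.add (hQ n) ?_
      rw [Finset.sum_mul]
      exact Finset.sum_eq_zero fun m hm => ho m n (Finset.mem_range.1 hm).ne
  choose hU hUe using fun n => isStarProjection_iff_eq_starProjection_range.1 (hps n)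
  let U : ℕ → Submodule ℂ E := fun n => (∑ m ∈ Finset.range n, Q m).range
  have hmono : Monotone U := by
    refine monotone_nat_of_le_succ fun n => ?_
    rintro _ ⟨x, rfl⟩
    refine ⟨(∑ m ∈ Finset.range n, Q m) x, ?_⟩
    change ((∑ m ∈ Finset.range (n + 1), Q m) * ∑ m ∈ Finset.range n, Q m) x =
      (∑ m ∈ Finset.range n, Q m) x
    rw [Finset.sum_range_succ, add_mul, (hps n).isIdempotentElem.eq, Finset.mul_sum,
      Finset.sum_eq_zero fun m hm => ho n m (Finset.mem_range.1 hm).ne', add_zero]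
  have hlim : ∀ y, Tendsto (fun n => (∑ m ∈ Finset.range n, Q m) y) atTop
      (𝓝 ((⨆ n, U n).topologicalClosure.starProjection y)) := by
    intro y
    refine (Submodule.starProjection_tendsto_closure_iSup U hmono y).congr fun n => ?_
    exact congrArg (fun f : E →L[ℂ] E => f y) (hUe n).symm
  refine ⟨(⨆ n, U n).topologicalClosure.starProjection, isStarProjection_starProjection,
    fun x y => ?_⟩
  have hsq : ∀ x, Summable fun n => ‖Q n x‖ ^ 2 := by
    intro x
    refine summable_of_sum_range_le (c := ‖x‖ * ‖x‖) (fun n => by positivity) fun n => ?_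
    have h1 : ((∑ m ∈ Finset.range n, ‖Q m x‖ ^ 2 : ℝ) : ℂ) =
        ⟪x, (∑ m ∈ Finset.range n, Q m) x⟫_ℂ := by
      rw [sum_apply, inner_sum]
      push_cast
      exact Finset.sum_congr rfl fun m _ => by rw [inner_proj_self (hQ m)]; push_cast; rfl
    have h2 : ‖((∑ m ∈ Finset.range n, ‖Q m x‖ ^ 2 : ℝ) : ℂ)‖ ≤ ‖x‖ * ‖x‖ := by
      rw [h1]
      refine (norm_inner_le_norm _ _).trans ?_
      gcongr
      exact norm_proj_le (hps n) x
    rwa [Complex.norm_real, Real.norm_of_nonneg (Finset.sum_nonneg fun _ _ => by positivity)] at h2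
  have hsum : Summable fun n => ⟪x, Q n y⟫_ℂ := by
    refine Summable.of_norm_bounded ((hsq x).add (hsq y)) fun n => ?_
    rw [← proj_proj (hQ n) y, ← proj_inner (hQ n)]
    refine (norm_inner_le_norm _ _).trans ?_
    rw [proj_proj (hQ n)]
    nlinarith [sq_nonneg (‖Q n x‖ - ‖Q n y‖), sq_nonneg (‖Q n x‖ + ‖Q n y‖)]
  rw [hsum.hasSum_iff_tendsto_nat]
  refine ((tendsto_const_nhds (x := x)).inner (hlim y)).congr fun n => ?_
  rw [sum_apply, inner_sum]

theorem clm_eq_of_inner_total {ι : Type*} {v : ι → E}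
    (hv : (Submodule.span ℂ (Set.range v)).topologicalClosure = ⊤) {Q Q' : E →L[ℂ] E}
    (h : ∀ i j, ⟪v i, Q (v j)⟫_ℂ = ⟪v i, Q' (v j)⟫_ℂ) : Q = Q' :=
  clm_ext_of_total hv fun j => eq_of_inner_total hv fun i => h i j

/-- A spectral measure is determined by its matrix elements with respect to a total family, and it
exists if these are complex measures that come from projections on a generating `π`-system whose
projections permute the family. -/
theorem exists_spectralMeasure {Z : Type*} [MeasurableSpace Z] {C : Set (Set Z)}
    (hC : ‹MeasurableSpace Z› = MeasurableSpace.generateFrom C) (hpi : IsPiSystem C)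
    {ι : Type*} {v : ι → E} (hv : (Submodule.span ℂ (Set.range v)).topologicalClosure = ⊤)
    (ρ : ι → ι → ComplexMeasure Z) (huniv : ∀ i j, ρ i j Set.univ = ⟪v i, v j⟫_ℂ)
    (R : Set Z → E →L[ℂ] E) (hR : ∀ A ∈ C, IsStarProjection (R A)) (σ : Set Z → ι → ι)
    (hσ : ∀ A ∈ C, ∀ j, R A (v j) = v (σ A j))
    (hρσ : ∀ A ∈ C, ∀ i j B, MeasurableSet B → ρ i (σ A j) B = ρ i j (B ∩ A)) :
    ∃ P : Set Z → E →L[ℂ] E, IsSpectralMeasure P ∧ ∀ A ∈ C, P A = R A := by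
  classical
  let Rep : (E →L[ℂ] E) → Set Z → Prop := fun Q B => ∀ i j, ⟪v i, Q (v j)⟫_ℂ = ρ i j B
  have hCm : ∀ A ∈ C, MeasurableSet A := fun A hA => by
    rw [hC]; exact MeasurableSpace.measurableSet_generateFrom hA
  have huniq : ∀ {Q Q' B}, Rep Q B → Rep Q' B → Q = Q' := fun h h' =>
    clm_eq_of_inner_total hv fun i j => (h i j).trans (h' i j).symm
  have hempty : Rep 0 ∅ := fun i j => by simp
  have hrepuniv : Rep 1 Set.univ := fun i j => (huniv i j).symm
  have hrepC : ∀ A ∈ C, Rep (R A) A := fun A hA i j => by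
    rw [hσ A hA, ← huniv, hρσ A hA _ _ _ .univ, Set.univ_inter]
  -- Representing the matrix elements on B by a projection is not enough for an induction over
  -- disjoint unions. The multiplicative clause makes the projections of disjoint sets orthogonal,
  -- so that their sum is again a projection.
  let Good : Set Z → Prop := fun B => ∃ Q, IsStarProjection Q ∧ Rep Q B ∧
    ∀ B' Q', MeasurableSet B' → Rep Q' B' → Rep (Q' * Q) (B' ∩ B)
  -- The summation clause refers to the chosen projections themselves, because the same statement
  -- later gives countable additivity of the measure `P`.
  have hgoodU : ∀ f : ℕ → Set Z, Pairwise (Function.onFun Disjoint f) →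
      (∀ i, MeasurableSet (f i)) → (hg : ∀ i, Good (f i)) → ∃ Q, IsStarProjection Q ∧
        Rep Q (⋃ i, f i) ∧ (∀ B' Q', MeasurableSet B' → Rep Q' B' →
          Rep (Q' * Q) (B' ∩ ⋃ i, f i)) ∧
          ∀ x y, HasSum (fun n => ⟪x, (hg n).choose y⟫_ℂ) ⟪x, Q y⟫_ℂ := by
    intro f hfd hfm hg
    have hs := fun n => (hg n).choose_spec
    set Q := fun n => (hg n).choose with hQ
    have ho : ∀ m n, m ≠ n → Q m * Q n = 0 := fun m n hmn => by
      have h1 := (hs n).2.2 _ _ (hfm m) (hs m).2.1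
      rw [(hfd hmn).inter_eq] at h1
      exact huniq h1 hempty
    obtain ⟨P, hP, hPs⟩ := exists_sum_of_orthogonal (fun n => (hs n).1) ho
    refine ⟨P, hP, fun i j => ?_, fun B' Q' hB' hQ' i j => ?_, hPs⟩
    · have h1 := VectorMeasure.hasSum_of_disjoint_iUnion (v := ρ i j) hfm hfd
      exact (hPs (v i) (v j)).unique (h1.congr_fun fun n => (hs n).2.1 i j)
    · have h1 := VectorMeasure.hasSum_of_disjoint_iUnion (v := ρ i j)
        (f := fun n => B' ∩ f n) (fun n => hB'.inter (hfm n))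
        (fun m n hmn => (hfd hmn).mono Set.inter_subset_right Set.inter_subset_right)
      rw [← Set.inter_iUnion] at h1
      have h2 := hPs (ContinuousLinearMap.adjoint Q' (v i)) (v j)
      rw [ContinuousLinearMap.adjoint_inner_left] at h2
      refine h2.unique (h1.congr_fun fun n => ?_)
      rw [ContinuousLinearMap.adjoint_inner_left]
      exact (hs n).2.2 _ _ hB' hQ' i j
  have hgood : ∀ B, MeasurableSet B → Good B := by
    intro B hB
    induction B, hB using MeasurableSpace.induction_on_inter hC hpi with
    | empty => exact ⟨0, IsStarProjection.zero _, hempty, fun B' Q' _ _ => by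
        rw [mul_zero, Set.inter_empty]; exact hempty⟩
    | basic A hA =>
      refine ⟨R A, hR A hA, hrepC A hA, fun B' Q' hB' hQ' i j => ?_⟩
      change ⟪v i, Q' (R A (v j))⟫_ℂ = _
      rw [hσ A hA, hQ', hρσ A hA _ _ _ hB']
    | compl A hA ih =>
      obtain ⟨Q, hQ, h1, h2⟩ := ih
      refine ⟨1 - Q, hQ.one_sub, fun i j => ?_, fun B' Q' hB' hQ' i j => ?_⟩
      · rw [VectorMeasure.of_compl hA, huniv, ← h1, sub_apply, inner_sub_right]
        rfl
      · rw [mul_sub, mul_one, sub_apply, inner_sub_right, hQ', h2 B' Q' hB' hQ', sub_eq_iff_eq_add,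
          ← VectorMeasure.of_union _ (hB'.inter hA.compl) (hB'.inter hA), ← Set.inter_union_distrib_left,
          Set.compl_union_self, Set.inter_univ]
        exact Set.disjoint_left.2 fun x h h' => h.2 h'.2
    | iUnion f hfd hfm ih =>
      obtain ⟨Q, h1, h2, h3, -⟩ := hgoodU f hfd hfm ih
      exact ⟨Q, h1, h2, h3⟩
  let P : Set Z → E →L[ℂ] E := fun B => if hB : MeasurableSet B then (hgood B hB).choose else 0
  have hPs : ∀ B (hB : MeasurableSet B), P B = (hgood B hB).choose := fun B hB => dif_pos hB
  have hPrep : ∀ B, MeasurableSet B → Rep (P B) B := fun B hB => by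
    rw [hPs B hB]; exact (hgood B hB).choose_spec.2.1
  refine ⟨P, ⟨fun B hB => ?_, fun x y => ?_, ?_⟩, fun A hA => ?_⟩
  · rw [hPs B hB]
    exact (hgood B hB).choose_spec.1
  · refine ⟨⟨fun B => ⟪x, P B y⟫_ℂ, ?_, fun B hB => ?_, fun f hfm hfd => ?_⟩, fun B _ => rfl⟩
    · rw [huniq (hPrep ∅ .empty) hempty]
      simp
    · simp [P, hB]
    · obtain ⟨Q, -, h2, -, h4⟩ := hgoodU f hfd hfm fun i => hgood _ (hfm i)
      rw [huniq (hPrep _ (MeasurableSet.iUnion hfm)) h2]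
      exact (h4 x y).congr_fun fun n => by rw [hPs _ (hfm n)]
  · exact huniq (hPrep _ .univ) hrepuniv
  · exact huniq (hPrep A (hCm A hA)) (hrepC A hA)

end

/-- The product of two spectral measures `S` and `T` that act on the two arguments of a bilinear map
with total range. -/
theorem exists_prod_spectralMeasure {F : Type*} [NormedAddCommGroup F] [InnerProductSpace ℂ F]
    [CompleteSpace F] {α β : Type*} [MeasurableSpace α] [MeasurableSpace β]
    {S : Set α → F →L[ℂ] F} {T : Set β → F →L[ℂ] F}
    (hS : IsSpectralMeasure S) (hT : IsSpectralMeasure T) {J : F → F → F} {p : F →L[ℂ] F}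
    (hJ : ∀ y x y' x', ⟪J y x, J y' x'⟫_ℂ = ⟪p y, y'⟫_ℂ * ⟪x, x'⟫_ℂ)
    (htot : (Submodule.span ℂ (Set.range fun q : F × F => J q.1 q.2)).topologicalClosure = ⊤)
    (hp : ∀ A, MeasurableSet A → ∀ y, p (S A y) = S A (p y))
    (R : Set α → Set β → F →L[ℂ] F) (hR : ∀ A B, MeasurableSet A → MeasurableSet B →
      ∀ y x, R A B (J y x) = J (S A y) (T B x)) :
    ∃ P : Set (α × β) → F →L[ℂ] F, IsSpectralMeasure P ∧
      ∀ A B, MeasurableSet A → MeasurableSet B → P (A ×ˢ B) = R A B := by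
  classical
  choose μ hμ using fun y y' => hS.complexMeasure (p y) y'
  choose ν hν using fun x x' => hT.complexMeasure x x'
  -- The matrix elements to be realised are products: ⟪J(y, x), J(S(A)y', T(B)x')⟫ = ⟪p y,
  -- S(A)y'⟫⟪x, T(B)x'⟫.
  choose ρ hρ using fun q q' : F × F => exists_prod_complexMeasure (μ q.1 q'.1) (ν q.2 q'.2)
  let C : Set (Set (α × β)) := Set.image2 (· ×ˢ ·) {s | MeasurableSet s} {t | MeasurableSet t}
  have hCn : ∀ D ∈ C, ∃ A B, MeasurableSet A ∧ MeasurableSet B ∧ D = A ×ˢ B := by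
    rintro D ⟨A, hA, B, hB, rfl⟩
    exact ⟨A, B, hA, hB, rfl⟩
  -- The sides of a rectangle are chosen, and those of an empty rectangle are not unique. The final
  -- identification with `R A B` therefore compares matrix elements, which depend on the rectangle
  -- only.
  let f : Set (α × β) → Set α × Set β := fun D =>
    if h : ∃ A B, MeasurableSet A ∧ MeasurableSet B ∧ D = A ×ˢ B then
      (h.choose, h.choose_spec.choose) else (∅, ∅)
  have hf : ∀ D ∈ C, MeasurableSet (f D).1 ∧ MeasurableSet (f D).2 ∧ D = (f D).1 ×ˢ (f D).2 := by
    intro D hD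
    have h := hCn D hD
    simp only [f, dif_pos h]
    exact h.choose_spec.choose_spec
  have hρ' : ∀ A B, MeasurableSet A → MeasurableSet B → ∀ q q' : F × F,
      ρ q q' (A ×ˢ B) = ⟪J q.1 q.2, J (S A q'.1) (T B q'.2)⟫_ℂ := by
    intro A B hA hB q q'
    rw [hρ _ _ _ _ hA hB, hμ _ _ _ hA, hν _ _ _ hB, hJ]
  have hRproj : ∀ A B, MeasurableSet A → MeasurableSet B → IsStarProjection (R A B) := by
    intro A B hA hB
    refine isStarProjection_of_inner (fun x => ?_) fun x y => ?_
    · refine congrArg (fun g : F →L[ℂ] F => g x) (clm_ext_of_total htot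
        (f := (R A B).comp (R A B)) (g := R A B) fun q => ?_)
      simp only [ContinuousLinearMap.comp_apply, hR A B hA hB,
        proj_proj (hS.isStarProjection A hA), proj_proj (hT.isStarProjection B hB)]
    · have : ContinuousLinearMap.adjoint (R A B) = R A B := by
        refine clm_eq_of_inner_total htot fun q q' => ?_
        rw [ContinuousLinearMap.adjoint_inner_right, hR A B hA hB, hR A B hA hB, hJ, hJ, hp A hA,
          proj_inner (hS.isStarProjection A hA), proj_inner (hT.isStarProjection B hB)]
      rw [← this, ContinuousLinearMap.adjoint_inner_left, this]
  -- Applying S(A) and T(B) to the second vector restricts the matrix element measure to the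
  -- rectangle: both measures agree on rectangles by multiplicativity of S and T. This supplies the
  -- hypothesis on `σ` in `exists_spectralMeasure`.
  have hinter : ∀ A B, MeasurableSet A → MeasurableSet B → ∀ q q' : F × F,
      ρ q (S A q'.1, T B q'.2) = (ρ q q').restrict (A ×ˢ B) := by
    intro A B hA hB q q'
    have hrect : ∀ A' B', MeasurableSet A' → MeasurableSet B' →
        ρ q (S A q'.1, T B q'.2) (A' ×ˢ B') = (ρ q q').restrict (A ×ˢ B) (A' ×ˢ B') := by
      intro A' B' hA' hB'
      rw [VectorMeasure.restrict_apply _ (hA.prod hB) (hA'.prod hB'), Set.prod_inter_prod,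
        hρ' _ _ hA' hB', hρ' _ _ (hA'.inter hA) (hB'.inter hB), hS.apply_apply hA' hA,
        hT.apply_apply hB' hB]
    refine VectorMeasure.ext_of_generateFrom C ?_ generateFrom_prod.symm isPiSystem_prod ?_
    · rintro _ ⟨A', hA', B', hB', rfl⟩
      exact hrect A' B' hA' hB'
    · rw [← Set.univ_prod_univ]
      exact hrect _ _ .univ .univ
  obtain ⟨P, hP, hPR⟩ := exists_spectralMeasure (C := C) generateFrom_prod.symm isPiSystem_prod
    htot ρ (fun q q' => by
      rw [← Set.univ_prod_univ, hρ' _ _ .univ .univ, hS.total, hT.total]; rfl)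
    (fun D => R (f D).1 (f D).2) (fun D hD => hRproj _ _ (hf D hD).1 (hf D hD).2.1)
    (fun D q => (S (f D).1 q.1, T (f D).2 q.2))
    (fun D hD q => hR _ _ (hf D hD).1 (hf D hD).2.1 _ _)
    (fun D hD q q' B hB => by
      rw [hinter _ _ (hf D hD).1 (hf D hD).2.1, ← (hf D hD).2.2, VectorMeasure.restrict_apply _
        (by rw [(hf D hD).2.2]; exact (hf D hD).1.prod (hf D hD).2.1) hB])
  refine ⟨P, hP, fun A B hA hB => ?_⟩
  have hD : A ×ˢ B ∈ C := ⟨A, hA, B, hB, rfl⟩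
  rw [hPR _ hD]
  refine clm_eq_of_inner_total htot fun q q' => ?_
  rw [hR _ _ (hf _ hD).1 (hf _ hD).2.1, hR _ _ hA hB, ← hρ' _ _ (hf _ hD).1 (hf _ hD).2.1,
    ← hρ' _ _ hA hB, ← (hf _ hD).2.2]

/-! ### Adaptedness of the tensor product on rectangles -/

namespace StopFlow

variable {F : Type*} [NormedAddCommGroup F] [InnerProductSpace ℂ F] [CompleteSpace F]
  {W : StopFlow F} {S T : Set ℝ≥0∞ → F →L[ℂ] F} {P : Set (ℝ≥0∞ × ℝ≥0∞) → F →L[ℂ] F}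

/-- Adaptedness is right continuous because c ↦ M_c(y, x) is continuous. It leaves room for the mesh
of a grid in later arguments. -/
theorem adapted_of_forall_gt {c : ℝ≥0} {X : F →L[ℂ] F} (h : ∀ b, c < b → W.Adapted b X) :
    W.Adapted c X := fun y x => by
  have h1 : Tendsto (fun n : ℕ => c + 1 / ((n : ℝ≥0) + 1)) atTop (𝓝 c) := by
    have := (tendsto_const_nhds (x := c)).add (tendsto_one_div_add_atTop_nhds_zero_nat (𝕜 := ℝ≥0))
    rwa [add_zero] at this
  have h2 := (X.continuous.tendsto _).comp (((W.continuous_M y x).tendsto c).comp h1)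
  refine tendsto_nhds_unique h2 ((((W.continuous_M (X y) x).tendsto c).comp h1).congr fun n => ?_)
  exact (h _ (lt_add_of_pos_right _ (by positivity)) y x).symm

/-- The spectral measure `P` is the tensor product of `S` and `T`. -/
structure IsTensor (hS : W.IsStop S) (hT : W.IsStop T) (P : Set (ℝ≥0∞ × ℝ≥0∞) → F →L[ℂ] F) :
    Prop extends IsSpectralMeasure P where
  apply_joint : ∀ A B, MeasurableSet A → MeasurableSet B → ∀ y x,
    P (A ×ˢ B) (hS.joint y x) = hS.joint (S A y) (T B x)

theorem exists_grid {f : ℝ≥0 → F} (hf : Continuous f) (b : ℝ≥0) {η : ℝ} (hη : 0 < η) :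
    ∃ δ : ℝ≥0, 0 < δ ∧ ∀ r ≤ b, ∀ s ≤ b, r ≤ s → s ≤ r + δ → ‖f s - f r‖ ≤ η := by
  have huc := isCompact_Icc.uniformContinuousOn_of_continuous (s := Set.Icc (0 : ℝ≥0) b)
    hf.continuousOn
  obtain ⟨δ, hδ, huc⟩ := (Metric.uniformContinuousOn_iff.1 huc) _ hη
  lift δ to ℝ≥0 using hδ.le
  have hδ' : 0 < δ := by exact_mod_cast hδ
  refine ⟨δ / 2, half_pos hδ', fun r hr s hs hrs hsr => ?_⟩
  rw [← dist_eq_norm]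
  refine (huc s ⟨bot_le, hs⟩ r ⟨bot_le, hr⟩ ?_).le
  rw [NNReal.dist_eq, abs_of_nonneg (sub_nonneg.2 (NNReal.coe_le_coe.2 hrs))]
  have h1 : (s : ℝ) ≤ r + δ / 2 := by exact_mod_cast hsr
  have h2 : (0 : ℝ) < δ := hδ
  linarith

theorem grid_lt {m : ℕ} (hm : 0 < m) (j : ℕ) : (j / m : ℝ≥0) < (j + 1 : ℕ) / m := by
  rw [div_lt_div_iff_of_pos_right (by exact_mod_cast hm)]
  exact_mod_cast j.lt_succ_self

theorem grid_succ (m j : ℕ) : (((j + 1 : ℕ) : ℝ≥0) / m : ℝ≥0) = j / m + 1 / m := by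
  push_cast
  rw [add_div]

theorem tsub_le_tsub_add_of_le {b q r δ : ℝ≥0} (hq : q ≤ b) (h : q ≤ r + δ) :
    b - r ≤ b - q + δ := by
  rw [tsub_le_iff_left]
  calc b = q + (b - q) := (add_tsub_cancel_of_le hq).symm
    _ ≤ (r + δ) + (b - q) := add_le_add h le_rfl
    _ = r + (b - q + δ) := by ring

namespace IsTensor

variable {hS : W.IsStop S} {hT : W.IsStop T}

theorem apply_prod_univ (hP : IsTensor hS hT P) {A : Set ℝ≥0∞} (hA : MeasurableSet A) :
    P (A ×ˢ Set.univ) = S A :=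
  clm_ext_of_total hS.joint_total fun p => by
    rw [hP.apply_joint _ _ hA MeasurableSet.univ, hT.total, hS.apply_joint hA]
    rfl

theorem apply_univ_prod_zero (hP : IsTensor hS hT P) : P (Set.univ ×ˢ {0}) = 0 :=
  clm_ext_of_total hS.joint_total fun p => by
    rw [hP.apply_joint _ _ MeasurableSet.univ (measurableSet_singleton _), hT.zero_eq]
    simp

theorem apply_univ_prod_top (hP : IsTensor hS hT P) : P (Set.univ ×ˢ {⊤}) = 0 :=
  clm_ext_of_total hS.joint_total fun p => by
    rw [hP.apply_joint _ _ MeasurableSet.univ (measurableSet_singleton _), hT.top_eq]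
    simp

theorem apply_comm_prod (hP : IsTensor hS hT P) {A B C : Set ℝ≥0∞} (hA : MeasurableSet A)
    (hB : MeasurableSet B) (hC : MeasurableSet C) (v : F) :
    S C (P (A ×ˢ B) v) = P (A ×ˢ B) (S C v) := by
  rw [← hP.apply_prod_univ hC, hP.apply_comm (hC.prod .univ) (hA.prod hB)]

/-- On one short cell both terms are within η‖y‖ of J_S(S(A)y, M_{b-q}(T(B)x, z)). For the first
this uses that T(B) is adapted at d, hence at b - q, and so passes through M_{b-q}. -/
theorem adapted_prod_aux (hP : IsTensor hS hT P) {A B : Set ℝ≥0∞} (hA : MeasurableSet A)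
    (hB : MeasurableSet B) {d b p q : ℝ≥0} (hBd : B ⊆ Set.Icc 0 d) (hpq : p < q) (hqb : q + d ≤ b)
    {y x z : F} (hy : S (Set.Ioc p q) y = y) {η : ℝ}
    (h1 : ∀ r ∈ Set.Ioc p q, ‖W.M (b - r) x z - W.M (b - q) x z‖ ≤ η)
    (h2 : ∀ r ∈ Set.Ioc p q, ‖W.M (b - r) (T B x) z - W.M (b - q) (T B x) z‖ ≤ η) :
    ‖P (A ×ˢ B) (W.M b (hS.joint y x) z) - W.M b (P (A ×ˢ B) (hS.joint y x)) z‖ ≤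
      2 * η * ‖y‖ := by
  have hη : 0 ≤ η := (norm_nonneg _).trans (h1 q ⟨hpq, le_rfl⟩)
  have hqb' : q ≤ b := le_self_add.trans hqb
  have h3 := hS.norm_M_joint_sub_le hpq hqb' hy x z _ hη h1
  have hy' : S (Set.Ioc p q) (S A y) = S A y := by
    rw [hS.apply_comm measurableSet_Ioc hA, hy]
  have h4 := hS.norm_M_joint_sub_le hpq hqb' hy' (T B x) z _ hη h2
  have had : W.Adapted (b - q) (T B) := (hT.adapted_of_subset hB hBd).mono
    (le_tsub_of_add_le_left hqb)
  have h5 := hP.apply_joint _ _ hA hB y (W.M (b - q) x z)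
  rw [had] at h5
  have h6 : P (A ×ˢ B) (W.M b (hS.joint y x) z) - W.M b (P (A ×ˢ B) (hS.joint y x)) z =
      P (A ×ˢ B) (W.M b (hS.joint y x) z - hS.joint y (W.M (b - q) x z)) -
      (W.M b (hS.joint (S A y) (T B x)) z - hS.joint (S A y) (W.M (b - q) (T B x) z)) := by
    rw [map_sub, h5, hP.apply_joint _ _ hA hB]
    abel
  rw [h6]
  refine (norm_sub_le _ _).trans ?_
  have h7 := hP.norm_apply_le (hA.prod hB) (W.M b (hS.joint y x) z - hS.joint y (W.M (b - q) x z))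
  have h8 := mul_le_mul_of_nonneg_left (hS.norm_apply_le hA y) hη
  linarith

/-- For b > c + d the failure of adaptedness at b commutes with the cell projections of S. The
one-cell bound of `adapted_prod_aux` therefore adds up orthogonally over a grid and can be made
arbitrarily small. -/
theorem adapted_prod (hP : IsTensor hS hT P) {A B : Set ℝ≥0∞} (hA : MeasurableSet A)
    (hB : MeasurableSet B) {c d : ℝ≥0} (hAc : A ⊆ Set.Icc 0 c) (hBd : B ⊆ Set.Icc 0 d) :
    W.Adapted (c + d) (P (A ×ˢ B)) := by
  refine adapted_of_forall_gt fun b hb g z => ?_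
  set Z := P (A ×ˢ B) with hZ
  obtain ⟨ρ, hρ⟩ := exists_add_of_le hb.le
  have hρ0 : 0 < ρ := by
    rw [hρ] at hb
    exact (lt_add_iff_pos_right _).1 hb
  have hcb : c ≤ b := le_self_add.trans hb.le
  have hZc : ∀ v, Z (S (Set.Icc 0 c) v) = Z v := fun v => by
    rw [← hP.apply_prod_univ measurableSet_Icc, hP.apply_apply_of_subset (hA.prod hB)
      (measurableSet_Icc.prod .univ) (Set.prod_mono hAc (Set.subset_univ _))]
  suffices h : Z.comp ((W.M b).flip z) = ((W.M b).flip z).comp Z from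
    congrArg (fun f : F →L[ℂ] F => f g) h
  refine clm_ext_of_total hS.joint_total fun ⟨y, x⟩ => ?_
  change Z (W.M b (hS.joint y x) z) = W.M b (Z (hS.joint y x)) z
  let D : F →L[ℂ] F := Z.comp (((W.M b).flip z).comp (hS.joint.flip x)) -
    ((W.M b).flip z).comp (Z.comp (hS.joint.flip x))
  have hD : ∀ v, D v = Z (W.M b (hS.joint v x) z) - W.M b (Z (hS.joint v x)) z := fun v => rfl
  suffices h : D y = 0 from sub_eq_zero.1 h
  -- The rectangle lies over [0, c], so only the part of y before c contributes and finitely many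
  -- cells suffice.
  have hDc : D (S (Set.Icc 0 c) y) = D y := by
    rw [hD, hD, ← hS.apply_joint measurableSet_Icc, hZc,
      ← (hS.adapted_Icc c).mono hcb, hZc]
  rw [← hDc]
  have hcomm : ∀ (p q : ℝ≥0) v, q ≤ b → S (Set.Ioc p q) (D v) = D (S (Set.Ioc p q) v) := by
    intro p q v hq
    have h1 := (hS.adapted_cell p q).mono hq
    rw [hD, hD, map_sub, hP.apply_comm_prod hA hB measurableSet_Ioc, h1, h1,
      hP.apply_comm_prod hA hB measurableSet_Ioc, hS.apply_joint measurableSet_Ioc]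
  rw [← norm_le_zero_iff]
  refine le_of_forall_pos_le_add fun ε hε => ?_
  set η := ε / (2 * (‖S (Set.Icc 0 c) y‖ + 1)) with hη
  have hη0 : 0 < η := by positivity
  obtain ⟨δ₁, hδ₁, hu₁⟩ := exists_grid (W.continuous_M x z) b hη0
  obtain ⟨δ₂, hδ₂, hu₂⟩ := exists_grid (W.continuous_M (T B x) z) b hη0
  -- The mesh is below ρ, so that the last cell may overshoot c and still end before b - d, and
  -- below the moduli of continuity of r ↦ M_r(x, z) and r ↦ M_r(T(B)x, z).
  obtain ⟨m, hm⟩ := exists_nat_gt (1 / min ρ (min δ₁ δ₂))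
  have hmin : 0 < min ρ (min δ₁ δ₂) := lt_min hρ0 (lt_min hδ₁ hδ₂)
  have hm0 : 0 < m := by
    have : (0 : ℝ≥0) < m := lt_of_le_of_lt bot_le hm
    exact_mod_cast this
  have hm1 : 1 / (m : ℝ≥0) ≤ min ρ (min δ₁ δ₂) := by
    rw [div_le_iff₀ (by exact_mod_cast hm0), mul_comm, ← div_le_iff₀ hmin]
    exact hm.le
  set L := ⌈c * m⌉₊ with hL
  have hcL : c ≤ (L : ℝ≥0) / m := by
    rw [le_div_iff₀ (by exact_mod_cast hm0)]
    exact Nat.le_ceil _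
  have hend : ∀ j ∈ Finset.range L, (((j + 1 : ℕ) : ℝ≥0) / m : ℝ≥0) + d ≤ b := by
    intro j hj
    have h1 : (j : ℝ≥0) / m ≤ c := by
      rw [div_le_iff₀ (by exact_mod_cast hm0)]
      exact (Nat.lt_ceil.1 (Finset.mem_range.1 hj)).le
    rw [grid_succ, hρ, add_right_comm]
    exact add_le_add (add_le_add h1 le_rfl) (hm1.trans (min_le_left _ _))
  have hsum : S (Set.Icc 0 c) y = ∑ j ∈ Finset.range L, S (gridCell m j) (S (Set.Icc 0 c) y) := by
    rw [← sum_apply, ← hS.apply_biUnion _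
      (fun j _ => measurableSet_gridCell m j) ((pairwise_disjoint_gridCell m).set_pairwise _),
      biUnion_gridCell, hS.apply_Icc_eq_Ioc, hS.apply_apply measurableSet_Ioc measurableSet_Ioc,
      Set.inter_eq_right.2 (Set.Ioc_subset_Ioc_right (by exact_mod_cast hcL))]
  set ξ := S (Set.Icc 0 c) y
  have hproj : ∀ j v, S (gridCell m j) (S (gridCell m j) v) = S (gridCell m j) v := fun j v =>
    proj_proj (hS.isStarProjection _ (measurableSet_gridCell m j)) v
  have key : ‖∑ j ∈ Finset.range L, S (gridCell m j) (D (S (gridCell m j) ξ))‖ ≤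
      2 * η * ‖ξ‖ := by
    refine hS.norm_sum_le _ (fun j _ => measurableSet_gridCell m j)
      ((pairwise_disjoint_gridCell m).set_pairwise _) _ ξ (by positivity) fun j hj => ?_
    refine (hS.norm_apply_le (measurableSet_gridCell m j) _).trans ?_
    have hj1 := hend j hj
    have hj2 : (((j + 1 : ℕ) : ℝ≥0) / m : ℝ≥0) ≤ b := le_self_add.trans hj1
    have hsub : ∀ r ∈ Set.Ioc ((j : ℝ≥0) / m : ℝ≥0) ((j + 1 : ℕ) / m),
        b - r ≤ b - ((j + 1 : ℕ) / m : ℝ≥0) + min ρ (min δ₁ δ₂) := by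
      intro r hr
      refine tsub_le_tsub_add_of_le hj2 ?_
      rw [grid_succ]
      exact add_le_add hr.1.le hm1
    have hj3 := grid_lt hm0 j
    have hj4 := hproj j ξ
    rw [hD, gridCell]
    rw [gridCell] at hj4
    generalize (((j + 1 : ℕ) : ℝ≥0) / m : ℝ≥0) = q at hj1 hj2 hj3 hj4 hsub ⊢
    generalize ((j : ℝ≥0) / m : ℝ≥0) = p at hj3 hj4 hsub ⊢
    have h7 : ∀ r ∈ Set.Ioc p q, ‖W.M (b - r) x z - W.M (b - q) x z‖ ≤ η := fun r hr =>
      hu₁ _ tsub_le_self _ tsub_le_self (tsub_le_tsub_left hr.2 b) ((hsub r hr).trans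
        (add_le_add_right ((min_le_right _ _).trans (min_le_left _ _)) _))
    have h8 : ∀ r ∈ Set.Ioc p q, ‖W.M (b - r) (T B x) z - W.M (b - q) (T B x) z‖ ≤ η :=
      fun r hr => hu₂ _ tsub_le_self _ tsub_le_self (tsub_le_tsub_left hr.2 b)
        ((hsub r hr).trans (add_le_add_right ((min_le_right _ _).trans (min_le_right _ _)) _))
    exact hP.adapted_prod_aux hA hB hBd hj3 hj1 hj4 h7 h8
  have hfin : D ξ = ∑ j ∈ Finset.range L, S (gridCell m j) (D (S (gridCell m j) ξ)) := by
    conv_lhs => rw [hsum, map_sum]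
    refine Finset.sum_congr rfl fun j hj => ?_
    rw [gridCell, hcomm _ _ _ (le_self_add.trans (hend j hj)), ← gridCell, hproj]
  rw [hfin]
  refine key.trans ?_
  rw [zero_add, hη]
  calc 2 * (ε / (2 * (‖ξ‖ + 1))) * ‖ξ‖ ≤ 2 * (ε / (2 * (‖ξ‖ + 1))) * (‖ξ‖ + 1) := by
        gcongr
        linarith
    _ = ε := by field_simp

end IsTensor

end StopFlow

namespace IsSpectralMeasure

variable {α : Type*} [MeasurableSpace α] {E : Type*} [NormedAddCommGroup E]
  [InnerProductSpace ℂ E] [CompleteSpace E] {P : Set α → E →L[ℂ] E}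

theorem apply_union_null (hP : IsSpectralMeasure P) {A B : Set α} (hA : MeasurableSet A)
    (hB : MeasurableSet B) (h0 : P B = 0) : P (A ∪ B) = P A := by
  rw [← Set.union_sdiff_self, hP.apply_union hA (hB.diff hA) Set.disjoint_sdiff_right,
    hP.apply_eq_zero_of_subset (hB.diff hA) hB Set.sdiff_subset h0, add_zero]

theorem norm_apply_sub_le (hP : IsSpectralMeasure P) {A B C D : Set α} (hA : MeasurableSet A)
    (hB : MeasurableSet B) (hC : MeasurableSet C) (hD : MeasurableSet D) (h1 : A ⊆ B ∪ C)
    (h2 : B ⊆ A ∪ D) (v : E) : ‖P A v - P B v‖ ≤ ‖P C v‖ + ‖P D v‖ := by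
  have h3 := hP.apply_diff hA (hA.inter hB) Set.inter_subset_left
  have h4 := hP.apply_diff hB (hA.inter hB) Set.inter_subset_right
  have h5 : P A v - P B v = P (A \ (A ∩ B)) v - P (B \ (A ∩ B)) v := by
    rw [h3, h4]
    simp
  rw [h5]
  refine (norm_sub_le _ _).trans (add_le_add ?_ ?_)
  · refine hP.norm_apply_mono (hA.diff (hA.inter hB)) hC (fun s hs => ?_) v
    exact (h1 hs.1).resolve_left fun h => hs.2 ⟨hs.1, h⟩
  · refine hP.norm_apply_mono (hB.diff (hA.inter hB)) hD (fun s hs => ?_) v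
    exact (h2 hs.1).resolve_left fun h => hs.2 ⟨h, hs.1⟩

end IsSpectralMeasure

/-! ### Convolution: diagonal strips approximated by rectangles -/

namespace StopFlow

variable {F : Type*} [NormedAddCommGroup F] [InnerProductSpace ℂ F] [CompleteSpace F]
  {W : StopFlow F} {S T : Set ℝ≥0∞ → F →L[ℂ] F} {P : Set (ℝ≥0∞ × ℝ≥0∞) → F →L[ℂ] F}

/-- The vectors `(s, u)` of `(0, ∞]²` with `s ∈ (j / m, (j + 1) / m]` and
`u ∈ (a - j / m, b - j / m]`. -/
def stripCell (a b : ℝ≥0) (m j : ℕ) : Set (ℝ≥0∞ × ℝ≥0∞) :=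
  gridCell m j ×ˢ Set.Ioc ((a - j / m : ℝ≥0) : ℝ≥0∞) ((b - j / m : ℝ≥0) : ℝ≥0∞)

/-- A union of rectangles that approximates `{(s, u) | a < s + u ≤ b}`. -/
def strip (a b : ℝ≥0) (m : ℕ) : Set (ℝ≥0∞ × ℝ≥0∞) :=
  ⋃ j ∈ Finset.range ⌈b * m⌉₊, stripCell a b m j

theorem measurableSet_stripCell (a b : ℝ≥0) (m j : ℕ) : MeasurableSet (stripCell a b m j) :=
  (measurableSet_gridCell m j).prod measurableSet_Ioc

theorem measurableSet_strip (a b : ℝ≥0) (m : ℕ) : MeasurableSet (strip a b m) :=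
  Finset.measurableSet_biUnion _ fun j _ => measurableSet_stripCell a b m j

theorem pairwise_disjoint_stripCell (a b : ℝ≥0) (m : ℕ) :
    Pairwise (Function.onFun Disjoint (stripCell a b m)) := fun _ _ h =>
  Set.disjoint_prod.2 (Or.inl (pairwise_disjoint_gridCell m h))

theorem tsub_lt_of_lt_add {a c u : ℝ≥0} (hu : 0 < u) (h : a < c + u) : a - c < u := by
  rcases le_total a c with h' | h'
  · rwa [tsub_eq_zero_of_le h']
  · rwa [tsub_lt_iff_left h']

/-- Since j/m < s ≤ (j + 1)/m and a - j/m < u ≤ b - j/m, the sum exceeds a and overshoots b by at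
most 1/m. The second side is nonempty only if j/m < b, so truncated subtraction is harmless. -/
theorem sum_mem_of_mem_strip {a b : ℝ≥0} {m : ℕ} {p : ℝ≥0∞ × ℝ≥0∞} (hp : p ∈ strip a b m) :
    p.1 + p.2 ∈ Set.Ioc (a : ℝ≥0∞) b ∪ Set.Ioc (b : ℝ≥0∞) ((b + 1 / m : ℝ≥0) : ℝ≥0∞) := by
  obtain ⟨s, u⟩ := p
  simp only [strip, Set.mem_iUnion, stripCell, gridCell, exists_prop, Set.mem_prod] at hp
  obtain ⟨j, -, ⟨h1, h2⟩, h3, h4⟩ := hp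
  lift s to ℝ≥0 using (h2.trans_lt ENNReal.coe_lt_top).ne
  lift u to ℝ≥0 using (h4.trans_lt ENNReal.coe_lt_top).ne
  rw [ENNReal.coe_lt_coe] at h1 h3
  rw [ENNReal.coe_le_coe] at h2 h4
  rw [grid_succ] at h2
  have h5 : (j : ℝ≥0) / m < b := tsub_pos_iff_lt.1 ((bot_le.trans_lt h3).trans_le h4)
  have h6 : a < s + u := by
    calc a ≤ j / m + (a - j / m) := le_add_tsub
      _ < s + u := add_lt_add h1 h3
  have h7 : s + u ≤ b + 1 / m := by
    calc s + u ≤ (j / m + 1 / m) + (b - j / m) := add_le_add h2 h4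
      _ = (j / m + (b - j / m)) + 1 / m := by ring
      _ = b + 1 / m := by rw [add_tsub_cancel_of_le h5.le]
  dsimp only
  rw [← ENNReal.coe_add]
  rcases le_or_gt (s + u) b with h | h
  · exact Or.inl ⟨by exact_mod_cast h6, by exact_mod_cast h⟩
  · exact Or.inr ⟨by exact_mod_cast h, by exact_mod_cast h7⟩

/-- With s in the cell starting at j/m, the only condition that can fail is a - j/m < u, and then s
+ u ≤ a + 1/m. Zero coordinates are excluded because the sides are open on the left. -/
theorem mem_strip_of_sum_mem {a b : ℝ≥0} {m : ℕ} (hm : 0 < m) {s u : ℝ≥0∞} (hs : s ≠ 0)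
    (hu : u ≠ 0) (h : s + u ∈ Set.Ioc (a : ℝ≥0∞) b) :
    (s, u) ∈ strip a b m ∨ s + u ∈ Set.Ioc (a : ℝ≥0∞) ((a + 1 / m : ℝ≥0) : ℝ≥0∞) := by
  obtain ⟨h1, h2⟩ := h
  have htop : s + u < ⊤ := h2.trans_lt ENNReal.coe_lt_top
  lift s to ℝ≥0 using (le_self_add.trans_lt htop).ne
  lift u to ℝ≥0 using (le_add_self.trans_lt htop).ne
  rw [← ENNReal.coe_add, ENNReal.coe_lt_coe] at h1
  rw [← ENNReal.coe_add, ENNReal.coe_le_coe] at h2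
  have hs0 : 0 < s := pos_iff_ne_zero.2 (by exact_mod_cast hs)
  have hu0 : 0 < u := pos_iff_ne_zero.2 (by exact_mod_cast hu)
  rcases le_or_gt (s + u) (a + 1 / m) with h | h
  · exact Or.inr ⟨by exact_mod_cast h1, by rw [← ENNReal.coe_add]; exact_mod_cast h⟩
  obtain ⟨j, hj, hjs⟩ := exists_mem_gridCell hm hs0
  have hj' := hj
  rw [gridCell, grid_succ] at hj'
  have h3 : (j : ℝ≥0) / m < s := by exact_mod_cast hj'.1
  have h4 : s ≤ j / m + 1 / m := ENNReal.coe_le_coe.1 hj'.2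
  refine Or.inl (Set.mem_biUnion (x := j) ?_ ⟨hj, ?_, ?_⟩)
  · rw [Finset.mem_coe, Finset.mem_range, Nat.lt_ceil]
    refine hjs.trans_le ?_
    gcongr
    exact le_self_add.trans h2
  · refine ENNReal.coe_lt_coe.2 (tsub_lt_of_lt_add hu0 ?_)
    have h5 : a + 1 / m < (j / m + u) + 1 / m := by
      calc a + 1 / m < s + u := h
        _ ≤ (j / m + 1 / m) + u := add_le_add h4 le_rfl
        _ = _ := by ring
    exact lt_of_add_lt_add_right h5
  · refine ENNReal.coe_le_coe.2 (le_tsub_of_add_le_left ?_)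
    exact (add_le_add h3.le le_rfl).trans h2

/-- The image of `P` under addition. -/
def conv (P : Set (ℝ≥0∞ × ℝ≥0∞) → F →L[ℂ] F) (C : Set ℝ≥0∞) : F →L[ℂ] F :=
  P {p | p.1 + p.2 ∈ C}

theorem measurableSet_sum_mem {C : Set ℝ≥0∞} (hC : MeasurableSet C) :
    MeasurableSet {p : ℝ≥0∞ × ℝ≥0∞ | p.1 + p.2 ∈ C} :=
  (measurable_fst.add measurable_snd) hC

namespace IsTensor

variable {hS : W.IsStop S} {hT : W.IsStop T}

theorem isSpectralMeasure_conv (hP : IsTensor hS hT P) : IsSpectralMeasure (conv P) :=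
  hP.map (measurable_fst.add measurable_snd)

theorem apply_axes (hP : IsTensor hS hT P) :
    P (({0} : Set ℝ≥0∞) ×ˢ Set.univ ∪ Set.univ ×ˢ ({0} : Set ℝ≥0∞)) = 0 := by
  rw [hP.apply_union_null ((measurableSet_singleton _).prod .univ)
    (.prod .univ (measurableSet_singleton _)) hP.apply_univ_prod_zero,
    hP.apply_prod_univ (measurableSet_singleton _), hS.zero_eq]

/-- Up to the axes, which are null because S and T have no mass at 0, the strip and the true set
differ only where the sum lies within 1/m above a or above b. -/
theorem norm_conv_sub_strip_le (hP : IsTensor hS hT P) (a b : ℝ≥0) {m : ℕ} (hm : 0 < m) (v : F) :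
    ‖conv P (Set.Ioc (a : ℝ≥0∞) b) v - P (strip a b m) v‖ ≤
      ‖conv P (Set.Ioc (a : ℝ≥0∞) ((a + 1 / m : ℝ≥0) : ℝ≥0∞)) v‖ +
      ‖conv P (Set.Ioc (b : ℝ≥0∞) ((b + 1 / m : ℝ≥0) : ℝ≥0∞)) v‖ := by
  have hax : MeasurableSet (({0} : Set ℝ≥0∞) ×ˢ Set.univ ∪ Set.univ ×ˢ ({0} : Set ℝ≥0∞)) :=
    ((measurableSet_singleton _).prod .univ).union (.prod .univ (measurableSet_singleton _))
  have hm : ∀ c d : ℝ≥0∞, MeasurableSet {p : ℝ≥0∞ × ℝ≥0∞ | p.1 + p.2 ∈ Set.Ioc c d} :=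
    fun c d => measurableSet_sum_mem measurableSet_Ioc
  have h := hP.norm_apply_sub_le (hm a b) (measurableSet_strip a b m)
    ((hm a (a + 1 / m : ℝ≥0)).union hax) (hm b (b + 1 / m : ℝ≥0)) (fun p hp => ?_)
    (fun p hp => sum_mem_of_mem_strip hp) v
  · rwa [hP.apply_union_null (hm _ _) hax hP.apply_axes] at h
  · obtain ⟨s, u⟩ := p
    by_cases hs : s = 0
    · exact Or.inr (Or.inr (Or.inl ⟨hs, trivial⟩))
    by_cases hu : u = 0
    · exact Or.inr (Or.inr (Or.inr ⟨trivial, hu⟩))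
    exact (mem_strip_of_sum_mem ‹_› hs hu hp).imp id Or.inl

theorem tendsto_conv_small (hP : IsTensor hS hT P) (a : ℝ≥0) (v : F) :
    Tendsto (fun m : ℕ => conv P (Set.Ioc (a : ℝ≥0∞) ((a + 1 / (m + 1 : ℕ) : ℝ≥0) : ℝ≥0∞)) v) atTop
      (𝓝 0) := by
  have h1 : Antitone fun m : ℕ => (a + 1 / (m + 1 : ℕ) : ℝ≥0) := fun i j h => by
    dsimp only
    gcongr
  refine hP.isSpectralMeasure_conv.tendsto_apply_of_antitone (fun _ => measurableSet_Ioc)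
    (fun i j h => Set.Ioc_subset_Ioc_right (ENNReal.coe_le_coe.2 (h1 h))) ?_ v
  rw [Set.eq_empty_iff_forall_notMem]
  intro s hs
  rw [Set.mem_iInter] at hs
  have h2 := (hs 0).1
  lift s to ℝ≥0 using ((hs 0).2.trans_lt ENNReal.coe_lt_top).ne
  have h3 : Tendsto (fun m : ℕ => (a + 1 / (m + 1 : ℕ) : ℝ≥0)) atTop (𝓝 a) := by
    have := (tendsto_const_nhds (x := a)).add (tendsto_one_div_add_atTop_nhds_zero_nat (𝕜 := ℝ≥0))
    simpa using this
  exact absurd (ge_of_tendsto' h3 fun m => ENNReal.coe_le_coe.1 (hs m).2)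
    (not_le.2 (ENNReal.coe_lt_coe.1 h2))

theorem tendsto_strip (hP : IsTensor hS hT P) (a b : ℝ≥0) (v : F) :
    Tendsto (fun m : ℕ => P (strip a b (m + 1)) v) atTop (𝓝 (conv P (Set.Ioc (a : ℝ≥0∞) b) v)) := by
  rw [tendsto_iff_norm_sub_tendsto_zero]
  have h := (hP.tendsto_conv_small a v).norm.add (hP.tendsto_conv_small b v).norm
  rw [norm_zero, add_zero] at h
  refine squeeze_zero (fun _ => norm_nonneg _) (fun m => ?_) h
  rw [norm_sub_rev]
  exact hP.norm_conv_sub_strip_le a b m.succ_pos v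

theorem apply_strip (hP : IsTensor hS hT P) (a b : ℝ≥0) (m : ℕ) :
    P (strip a b m) = ∑ j ∈ Finset.range ⌈b * m⌉₊, P (stripCell a b m j) :=
  hP.apply_biUnion _ (fun j _ => measurableSet_stripCell a b m j)
    ((pairwise_disjoint_stripCell a b m).set_pairwise _)

theorem grid_lt_of_mem {b : ℝ≥0} {m j : ℕ} (hm : 0 < m) (hj : j ∈ Finset.range ⌈b * m⌉₊) :
    (j : ℝ≥0) / m < b := by
  rw [div_lt_iff₀ (by exact_mod_cast hm)]
  exact Nat.lt_ceil.1 (Finset.mem_range.1 hj)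

theorem grid_add_tsub {b : ℝ≥0} {m j : ℕ} (h : (j : ℝ≥0) / m ≤ b) :
    (((j + 1 : ℕ) : ℝ≥0) / m : ℝ≥0) + (b - j / m) = b + 1 / m := by
  rw [grid_succ, add_right_comm, add_tsub_cancel_of_le h]

theorem adapted_strip (hP : IsTensor hS hT P) (a b : ℝ≥0) {m : ℕ} (hm : 0 < m) :
    W.Adapted (b + 1 / m) (P (strip a b m)) := by
  rw [hP.apply_strip]
  refine Adapted.sum fun j hj => ?_
  rw [← grid_add_tsub (grid_lt_of_mem hm hj).le]
  exact hP.adapted_prod (measurableSet_gridCell m j) measurableSet_Ioc (IsStop.cell_subset _ _)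
    (IsStop.cell_subset _ _)

theorem conv_zero (hP : IsTensor hS hT P) : conv P {0} = 0 := by
  refine hP.apply_eq_zero_of_subset (measurableSet_sum_mem (measurableSet_singleton 0))
    ((measurableSet_singleton 0).prod .univ) (fun p hp => ?_)
    ((hP.apply_prod_univ (measurableSet_singleton 0)).trans hS.zero_eq)
  exact ⟨(add_eq_zero.1 hp).1, trivial⟩

theorem isStop_conv (hP : IsTensor hS hT P) : W.IsStop (conv P) where
  toIsSpectralMeasure := hP.isSpectralMeasure_conv
  zero_eq := hP.conv_zero
  top_eq := by
    refine hP.apply_eq_zero_of_subset (measurableSet_sum_mem (measurableSet_singleton ⊤))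
      (((measurableSet_singleton (⊤ : ℝ≥0∞)).prod .univ).union
        (.prod .univ (measurableSet_singleton (⊤ : ℝ≥0∞)))) (fun p hp => ?_) ?_
    · exact (ENNReal.add_eq_top.1 hp).imp (fun h => ⟨h, trivial⟩) fun h => ⟨trivial, h⟩
    · rw [hP.apply_union_null ((measurableSet_singleton _).prod .univ)
        (.prod .univ (measurableSet_singleton _)) hP.apply_univ_prod_top,
        hP.apply_prod_univ (measurableSet_singleton _), hS.top_eq]
  adapted t ht := by
    have hI : Set.Icc 0 (t : ℝ≥0∞) = Set.Ioc ((0 : ℝ≥0) : ℝ≥0∞) t ∪ {0} := by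
      ext s
      rcases eq_or_ne s 0 with rfl | h
      · simp
      · simp
    rw [hI, hP.isSpectralMeasure_conv.apply_union_null measurableSet_Ioc
      (measurableSet_singleton 0) hP.conv_zero]
    -- The strips for the interval (0, t] are adapted at t + 1/m, hence at b for large m, and they
    -- converge strongly to the convolution.
    refine adapted_of_forall_gt fun b hb y x => ?_
    have h1 := hP.tendsto_strip 0 t (W.M b y x)
    have h2 := (((W.M b).flip x).continuous.tendsto _).comp (hP.tendsto_strip 0 t y)
    refine tendsto_nhds_unique h1 (h2.congr' ?_)
    have h3 : Tendsto (fun m : ℕ => (t + 1 / (m + 1 : ℕ) : ℝ≥0)) atTop (𝓝 t) := by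
      have := (tendsto_const_nhds (x := t)).add
        (tendsto_one_div_add_atTop_nhds_zero_nat (𝕜 := ℝ≥0))
      simpa using this
    filter_upwards [h3.eventually_lt_const hb] with m hm
    exact ((hP.adapted_strip 0 t m.succ_pos).mono hm.le y x).symm

end IsTensor

end StopFlow

/-! ### Associativity of stopping -/

namespace StopFlow

variable {F : Type*} [NormedAddCommGroup F] [InnerProductSpace ℂ F] [CompleteSpace F]
  {W : StopFlow F} {S T : Set ℝ≥0∞ → F →L[ℂ] F} {P : Set (ℝ≥0∞ × ℝ≥0∞) → F →L[ℂ] F}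

/-- Associativity is used twice, for S at r in (p, c] and for T at s in (q, d]. What remains of M_b
is a shift of z by b - r - s ≤ b - p - q, which barely moves z. -/
theorem norm_M_joint_joint_sub_le (hS : W.IsStop S) (hT : W.IsStop T) {p c q d b : ℝ≥0}
    (hpc : p < c) (hqd : q < d) (hb : c + d ≤ b) {X Y : F} (hX : S (Set.Ioc p c) X = X)
    (hY : T (Set.Ioc q d) Y = Y) (hY' : hT.proj Y = Y) (z : F) {ω : ℝ} (hω : 0 ≤ ω)
    (h : ∀ r ≤ b - p - q, ‖W.M r W.Ω z - z‖ ≤ ω) :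
    ‖W.M b (hS.joint X Y) z - hS.joint X (hT.joint Y z)‖ ≤ ω * ‖Y‖ * ‖X‖ := by
  refine hS.norm_M_joint_sub_le hpc (le_self_add.trans hb) hX Y z _ (by positivity) fun r hr => ?_
  have h1 := hT.norm_M_joint_sub_le (b := b - r) hqd
    (le_tsub_of_add_le_left ((add_le_add hr.2 le_rfl).trans hb)) hY W.Ω z z hω fun s hs =>
      h _ (tsub_le_tsub (tsub_le_tsub_left hr.1.le b) hs.1.le)
  rwa [hT.joint_vac, hY'] at h1

namespace IsTensor

variable {hS : W.IsStop S} {hT : W.IsStop T}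

/-- The rectangle (p, c] × (q, d] has c + d = b + 1/m, and p + q ≥ a; the leftover shift is
therefore at most b + 1/m - a. -/
theorem norm_stripCell_sub_le (hP : IsTensor hS hT P) {a b : ℝ≥0} (hab : a < b) {m j : ℕ}
    (hm : 0 < m) (hj : j ∈ Finset.range ⌈b * m⌉₊) (x y z : F) {ω : ℝ} (hω : 0 ≤ ω)
    (h : ∀ r ≤ b + 1 / m - a, ‖W.M r W.Ω z - z‖ ≤ ω) :
    ‖W.M (b + 1 / m) (P (stripCell a b m j) (hS.joint x (hT.proj y))) z -
      P (stripCell a b m j) (hS.joint x (hT.joint y z))‖ ≤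
      ω * ‖P (stripCell a b m j) (hS.joint x (hT.proj y))‖ := by
  have hjb := grid_lt_of_mem hm hj
  have hg := measurableSet_gridCell m j
  rw [stripCell, hP.apply_joint _ _ hg measurableSet_Ioc, hP.apply_joint _ _ hg measurableSet_Ioc,
    hT.apply_joint measurableSet_Ioc, hT.apply_proj measurableSet_Ioc]
  set Y := T (Set.Ioc ((a - j / m : ℝ≥0) : ℝ≥0∞) ((b - j / m : ℝ≥0) : ℝ≥0∞)) y
  set X := S (gridCell m j) x with hX
  rw [← hS.joint_proj X, ← hS.joint_proj X, ← hT.joint_proj Y, hS.norm_joint,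
    proj_proj hS.isStarProjection_proj, mul_comm ‖_‖ ‖_‖, ← mul_assoc]
  refine norm_M_joint_joint_sub_le hS hT (grid_lt hm j)
    (q := a - j / m) (d := b - j / m) ?_ (grid_add_tsub hjb.le).le ?_ ?_ ?_ z hω fun r hr => ?_
  · exact tsub_lt_of_lt_add (tsub_pos_of_lt hjb) (by rwa [add_tsub_cancel_of_le hjb.le])
  · rw [← gridCell, hS.apply_proj hg, hX, proj_proj (hS.isStarProjection _ hg)]
  · rw [hT.apply_proj measurableSet_Ioc, proj_proj (hT.isStarProjection _ measurableSet_Ioc)]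
  · exact proj_proj hT.isStarProjection_proj _
  · refine h r (hr.trans ?_)
    rw [tsub_tsub]
    exact tsub_le_tsub_left le_add_tsub _

theorem apply_gridCell_stripCell (hP : IsTensor hS hT P) (a b : ℝ≥0) (m j : ℕ) (v : F) :
    S (gridCell m j) (P (stripCell a b m j) v) = P (stripCell a b m j) v := by
  rw [← hP.apply_prod_univ (measurableSet_gridCell m j), hP.apply_apply
    ((measurableSet_gridCell m j).prod .univ) (measurableSet_stripCell a b m j)]
  congr 2
  exact Set.inter_eq_right.2 fun _ h => ⟨h.1, trivial⟩

theorem apply_gridCell_strip (hP : IsTensor hS hT P) (a b : ℝ≥0) {m j : ℕ}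
    (hj : j ∈ Finset.range ⌈b * m⌉₊) (v : F) :
    S (gridCell m j) (P (strip a b m) v) = P (stripCell a b m j) v := by
  rw [hP.apply_strip, sum_apply, map_sum, Finset.sum_eq_single j]
  · exact hP.apply_gridCell_stripCell a b m j v
  · intro i _ hij
    rw [← hP.apply_gridCell_stripCell, hS.apply_apply_of_disjoint (measurableSet_gridCell m j)
      (measurableSet_gridCell m i) (pairwise_disjoint_gridCell m hij.symm)]
  · exact fun h => absurd hj h

/-- The rectangles lie over disjoint grid cells in the first coordinate, and the cell projections of
S separate both terms, so the errors are orthogonal. -/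
theorem norm_strip_sub_le (hP : IsTensor hS hT P) {a b : ℝ≥0} (hab : a < b) {m : ℕ}
    (hm : 0 < m) (x y z : F) {ω : ℝ} (hω : 0 ≤ ω)
    (h : ∀ r ≤ b + 1 / m - a, ‖W.M r W.Ω z - z‖ ≤ ω) :
    ‖W.M (b + 1 / m) (P (strip a b m) (hS.joint x (hT.proj y))) z -
      P (strip a b m) (hS.joint x (hT.joint y z))‖ ≤
      ω * ‖P (strip a b m) (hS.joint x (hT.proj y))‖ := by
  set w := hS.joint x (hT.proj y)
  set u := hS.joint x (hT.joint y z)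
  set b' := b + 1 / m with hb'
  have hcell : ∀ j ∈ Finset.range ⌈b * m⌉₊, ∀ v, S (gridCell m j) (W.M b' v z) =
      W.M b' (S (gridCell m j) v) z := fun j hj v => by
    have h1 : (((j + 1 : ℕ) : ℝ≥0) / m : ℝ≥0) ≤ b' := by
      rw [grid_succ]
      exact add_le_add (grid_lt_of_mem hm hj).le le_rfl
    exact ((hS.adapted_cell _ _).mono h1) v z
  have h1 : W.M b' (P (strip a b m) w) z - P (strip a b m) u = ∑ j ∈ Finset.range ⌈b * m⌉₊,
      S (gridCell m j) (W.M b' (P (stripCell a b m j) w) z - P (stripCell a b m j) u) := by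
    rw [hP.apply_strip, sum_apply, sum_apply, map_sum, sum_apply, ← Finset.sum_sub_distrib]
    refine Finset.sum_congr rfl fun j hj => ?_
    rw [map_sub, hcell j hj, hP.apply_gridCell_stripCell, hP.apply_gridCell_stripCell]
  rw [h1]
  refine hS.norm_sum_le _ (fun j _ => measurableSet_gridCell m j)
    ((pairwise_disjoint_gridCell m).set_pairwise _) _ _ hω fun j hj => ?_
  rw [hP.apply_gridCell_strip a b hj]
  exact (hS.norm_apply_le (measurableSet_gridCell m j) _).trans
    (hP.norm_stripCell_sub_le hab hm hj x y z hω h)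

/-- This is the limit of the strip estimate. The time b + 1/m and the vector inside M vary together,
which strong continuity and the uniform bound `norm_M_le` allow. -/
theorem norm_conv_sub_le (hP : IsTensor hS hT P) {a b δ : ℝ≥0} (hab : a < b) (hδ : b < a + δ)
    (x y z : F) {ω : ℝ} (hω : 0 ≤ ω) (h : ∀ r ≤ δ, ‖W.M r W.Ω z - z‖ ≤ ω) :
    ‖W.M b (conv P (Set.Ioc (a : ℝ≥0∞) b) (hS.joint x (hT.proj y))) z -
      conv P (Set.Ioc (a : ℝ≥0∞) b) (hS.joint x (hT.joint y z))‖ ≤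
      ω * ‖conv P (Set.Ioc (a : ℝ≥0∞) b) (hS.joint x (hT.proj y))‖ := by
  set w := hS.joint x (hT.proj y)
  set u := hS.joint x (hT.joint y z)
  have h3 : Tendsto (fun m : ℕ => (b + 1 / (m + 1 : ℕ) : ℝ≥0)) atTop (𝓝 b) := by
    have := (tendsto_const_nhds (x := b)).add
      (tendsto_one_div_add_atTop_nhds_zero_nat (𝕜 := ℝ≥0))
    simpa using this
  have hw := hP.tendsto_strip a b w
  have h4 : Tendsto (fun m : ℕ => W.M (b + 1 / (m + 1 : ℕ)) (P (strip a b (m + 1)) w) z) atTop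
      (𝓝 (W.M b (conv P (Set.Ioc (a : ℝ≥0∞) b) w) z)) := by
    have h5 := ((W.continuous_M (conv P (Set.Ioc (a : ℝ≥0∞) b) w) z).tendsto b).comp h3
    have h6 : Tendsto (fun m : ℕ => W.M (b + 1 / (m + 1 : ℕ))
        (P (strip a b (m + 1)) w - conv P (Set.Ioc (a : ℝ≥0∞) b) w) z) atTop (𝓝 0) := by
      rw [tendsto_zero_iff_norm_tendsto_zero]
      have h7 := ((tendsto_iff_norm_sub_tendsto_zero.1 hw).mul_const ‖z‖)
      rw [zero_mul] at h7
      exact squeeze_zero (fun _ => norm_nonneg _) (fun m => W.norm_M_le _ _ _) h7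
    have h8 := h5.add h6
    rw [add_zero] at h8
    refine h8.congr fun m => ?_
    simp
  refine le_of_tendsto_of_tendsto (h4.sub (hP.tendsto_strip a b u)).norm (hw.norm.const_mul ω) ?_
  filter_upwards [h3.eventually_lt_const hδ] with m hm
  exact hP.norm_strip_sub_le hab m.succ_pos x y z hω fun r hr =>
    h r (hr.trans (tsub_le_iff_left.2 hm.le))

/-- Stopping at the convolution of two stop times is stopping at the first and then at the
second. -/
theorem joint_conv (hP : IsTensor hS hT P) (x y z : F) :
    hP.isStop_conv.joint (hS.joint x (hT.proj y)) z = hS.joint x (hT.joint y z) := by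
  set w := hS.joint x (hT.proj y)
  set u := hS.joint x (hT.joint y z)
  have hR := hP.isStop_conv
  -- Restriction to [0, N + 1] makes a uniformly fine partition possible; the remaining mass
  -- vanishes as N grows.
  have key : ∀ N : ℕ, conv P (Set.Icc 0 (N + 1 : ℕ)) (hR.joint w z) =
      conv P (Set.Icc 0 (N + 1 : ℕ)) u := by
    intro N
    rw [← sub_eq_zero, ← map_sub, ← norm_le_zero_iff]
    refine le_of_forall_pos_le_add fun ε hε => ?_
    have hω : 0 < ε / (‖w‖ + 1) := by positivity
    obtain ⟨δ, hδ, h⟩ := tendsto_shift W z hω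
    obtain ⟨π₀, hN, hfine⟩ := Partition.exists_fine N (half_pos hδ)
    have hlim := (((conv P (Set.Icc 0 (N + 1 : ℕ))).continuous.tendsto _).comp
      ((hR.tendsto_joint w z).sub_const u)).norm
    refine le_of_tendsto hlim ?_
    filter_upwards [eventually_ge_atTop π₀] with π hπ
    -- The vector u is written as the Riemann sum of a constant, so that the difference becomes a
    -- single sum to which the cellwise bound of `norm_conv_sub_le` applies.
    rw [Function.comp_apply, ← hR.riemannSum_const hR.zero_eq π u, ← riemannSum_sub]
    refine (hR.norm_apply_riemannSum_le (ξ := w) measurableSet_Icc hω.le fun p hp => ?_).trans ?_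
    · have hp0 := Partition.pos_of_mem_points ENNReal.zero_lt_top hp
      have hNπ := Partition.points_mono hπ hN
      rcases le_or_gt p (N + 1 : ℕ) with hpN | hpN
      · have hI : Set.Icc 0 ((N + 1 : ℕ) : ℝ≥0∞) ∩ Set.Ioc (π.pred p) p = Set.Ioc (π.pred p) p :=
          Set.inter_eq_right.2 fun s hs => ⟨bot_le, hs.2.trans hpN⟩
        rw [hI]
        lift p to ℝ≥0 using (hpN.trans_lt (ENNReal.natCast_lt_top _)).ne
        have hlt := Partition.pred_lt (π := π) hp0
        have hpred : ∀ q : ℝ≥0, (q : ℝ≥0∞) ∈ π₀.points → q < p → (q : ℝ≥0∞) ≤ π.pred p :=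
          fun q hq h => Partition.le_pred (Partition.points_mono hπ hq) (by exact_mod_cast h)
        rw [map_sub, hR.apply_Me measurableSet_Ioc (IsStop.cell_subset _ _), W.Me_coe]
        generalize π.pred (p : ℝ≥0∞) = a at hlt hpred ⊢
        lift a to ℝ≥0 using (hlt.trans ENNReal.coe_lt_top).ne
        have hap : a < p := by exact_mod_cast hlt
        refine hP.norm_conv_sub_le hap ?_ x y z hω.le h
        -- If the cell had length at least δ, the grid of mesh δ/2 would have a point between a +
        -- δ/4 and a + 3δ/4. It would lie strictly inside the cell, against the choice of a as
        -- predecessor. The offset δ/4 also keeps the argument of `hfine` positive when a = 0.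
        by_contra hc
        have hpa : a + δ ≤ p := not_lt.1 hc
        have hδ2 : a + δ / 2 < p := lt_of_lt_of_le (by gcongr; exact half_lt_self hδ) hpa
        have hsmall : 0 < δ / 4 := by positivity
        obtain ⟨q, hq, hq1, -, hq2⟩ := hfine (a + δ / 4) (by positivity)
          (le_trans (by
            have : δ / 4 ≤ δ / 2 := by
              gcongr
              norm_num
            exact (add_le_add le_rfl this).trans hδ2.le) (by exact_mod_cast hpN))
        have hqp : q < p := by
          refine lt_of_le_of_lt hq2 (lt_of_lt_of_le ?_ hpa)
          rw [add_assoc]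
          gcongr
          rw [← NNReal.coe_lt_coe]
          have : (0 : ℝ) < δ := hδ
          push_cast
          linarith
        have h1 := ENNReal.coe_le_coe.1 (hpred q hq hqp)
        exact absurd (hq1.trans h1) (not_le.2 (lt_add_of_pos_right _ hsmall))
      · have hNp : ((N + 1 : ℕ) : ℝ≥0∞) ≤ π.pred p := Partition.le_pred hNπ hpN
        have hI : Set.Icc 0 ((N + 1 : ℕ) : ℝ≥0∞) ∩ Set.Ioc (π.pred p) p = ∅ := by
          rw [← Set.disjoint_iff_inter_eq_empty, Set.disjoint_left]
          exact fun s h1 h2 => absurd (h1.2.trans hNp) (not_le.2 h2.1)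
        rw [hI, hR.apply_empty]
        simp
    · rw [zero_add, div_mul_eq_mul_div, div_le_iff₀ (by positivity)]
      nlinarith [norm_nonneg w]
  refine tendsto_nhds_unique ((hR.tendsto_apply_Icc_nat hR.top_eq _).comp (tendsto_add_atTop_nat 1))
    (((hR.tendsto_apply_Icc_nat hR.top_eq u).comp (tendsto_add_atTop_nat 1)).congr fun N => ?_)
  exact (key N).symm

theorem proj_conv (hP : IsTensor hS hT P) (x y : F) :
    hP.isStop_conv.proj (hS.joint x (hT.proj y)) = hS.joint x (hT.proj y) := by
  rw [← IsStop.joint_vac, hP.joint_conv, hT.joint_vac]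

end IsTensor

end StopFlow

/-! ### Shifts and cuts on L²([0, ∞); k) -/

section OneParticle

variable {k : Type*} [NormedAddCommGroup k] [InnerProductSpace ℂ k] {A B : Set ℝ}

theorem coeFn_extendL2 (hA : MeasurableSet A) (hAB : A ⊆ B) (f : L2 k A) :
    (extendL2 hA hAB f : ℝ → k) =ᵐ[volume.restrict B] A.indicator f :=
  (memLp_indicator hA hAB f).coeFn_toLp

theorem coeFn_restrictL2 (hAB : A ⊆ B) (f : L2 k B) :
    (restrictL2 hAB f : ℝ → k) =ᵐ[volume.restrict A] f :=
  ((Lp.memLp f).mono_measure (Measure.restrict_mono hAB le_rfl)).coeFn_toLp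

theorem coeFn_shiftL2 (t : ℝ≥0) (f : L2 k (Set.Ici 0)) :
    (shiftL2 t f : ℝ → k) =ᵐ[volume.restrict (Set.Ici (t : ℝ))] f ∘ fun s => s - t :=
  Lp.coeFn_compMeasurePreserving f (measurePreserving_shift t)

theorem extendL2_restrictL2_add (t : ℝ≥0) (f : L2 k (Set.Ici 0)) :
    extendL2 measurableSet_Ico (Ico_subset_halfLine t) (restrictL2 (Ico_subset_halfLine t) f) +
      extendL2 measurableSet_Ici (Ici_subset_halfLine t) (restrictL2 (Ici_subset_halfLine t) f) =
      f := by
  refine Lp.ext ?_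
  filter_upwards [Lp.coeFn_add (extendL2 measurableSet_Ico (Ico_subset_halfLine t)
      (restrictL2 (Ico_subset_halfLine t) f)) (extendL2 measurableSet_Ici (Ici_subset_halfLine t)
      (restrictL2 (Ici_subset_halfLine t) f)),
    coeFn_extendL2 measurableSet_Ico (Ico_subset_halfLine t)
      (restrictL2 (Ico_subset_halfLine t) f),
    coeFn_extendL2 measurableSet_Ici (Ici_subset_halfLine t)
      (restrictL2 (Ici_subset_halfLine t) f),
    indicator_ae_eq measurableSet_Ico (Ico_subset_halfLine t)
      (coeFn_restrictL2 (Ico_subset_halfLine t) f),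
    indicator_ae_eq measurableSet_Ici (Ici_subset_halfLine t)
      (coeFn_restrictL2 (Ici_subset_halfLine t) f), ae_restrict_mem measurableSet_Ici]
    with x h1 h2 h3 h4 h5 h6
  rw [h1, Pi.add_apply, h2, h3, h4, h5]
  rcases lt_or_ge x t with h | h
  · rw [Set.indicator_of_mem (show x ∈ Set.Ico 0 (t : ℝ) from ⟨h6, h⟩),
      Set.indicator_of_notMem (by simpa using h), add_zero]
  · rw [Set.indicator_of_notMem (by simp [h]), Set.indicator_of_mem (show x ∈ Set.Ici (t : ℝ) from h),
      zero_add]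

variable (k) in
/-- The right shift on `L²([0, ∞); k)`. -/
def shiftR (t : ℝ≥0) : L2 k (Set.Ici 0) →ₗᵢ[ℂ] L2 k (Set.Ici 0) :=
  (extendL2 measurableSet_Ici (Ici_subset_halfLine t)).comp (shiftL2 t)

theorem coeFn_shiftR (t : ℝ≥0) (f : L2 k (Set.Ici 0)) :
    (shiftR k t f : ℝ → k) =ᵐ[volume.restrict (Set.Ici 0)]
      (Set.Ici (t : ℝ)).indicator (f ∘ fun s => s - t) :=
  (coeFn_extendL2 measurableSet_Ici (Ici_subset_halfLine t) (shiftL2 t f)).trans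
    (indicator_ae_eq measurableSet_Ici (Ici_subset_halfLine t) (coeFn_shiftL2 t f))

theorem measurePreserving_sub (a : ℝ) : MeasurePreserving (fun s : ℝ => s - a)
    (volume.restrict Set.univ) (volume.restrict Set.univ) := by
  simpa using measurePreserving_sub_right (volume : Measure ℝ) a

variable (k) in
/-- Translation on `L²(ℝ; k)`. -/
def translate (a : ℝ) : L2 k Set.univ →ₗᵢ[ℂ] L2 k Set.univ :=
  Lp.compMeasurePreservingₗᵢ ℂ (fun s : ℝ => s - a) (measurePreserving_sub a)

theorem coeFn_translate (a : ℝ) (f : L2 k Set.univ) :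
    (translate k a f : ℝ → k) =ᵐ[volume.restrict Set.univ] f ∘ fun s => s - a :=
  Lp.coeFn_compMeasurePreserving f (measurePreserving_sub a)

theorem translate_translate (a b : ℝ) (f : L2 k Set.univ) :
    translate k a (translate k b f) = translate k (a + b) f := by
  refine Lp.ext ?_
  filter_upwards [coeFn_translate a (translate k b f), coeFn_translate (a + b) f,
    (measurePreserving_sub a).quasiMeasurePreserving.ae (coeFn_translate b f)] with x h1 h2 h3
  rw [h1, h2, Function.comp_apply, h3]
  simp [sub_sub]

theorem translate_zero (f : L2 k Set.univ) : translate k 0 f = f := by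
  refine Lp.ext ?_
  filter_upwards [coeFn_translate 0 f] with x h1
  rw [h1]
  simp

theorem continuous_translate {X : Type*} [TopologicalSpace X] {a : X → ℝ} (ha : Continuous a)
    {f : X → L2 k Set.univ} (hf : Continuous f) : Continuous fun x => translate k (a x) (f x) := by
  let g : X → C(ℝ, ℝ) := fun x => ⟨fun s => s - a x, by fun_prop⟩
  have hg : Continuous g := ContinuousMap.continuous_of_continuous_uncurry _
    (show Continuous fun p : X × ℝ => p.2 - a p.1 by fun_prop)
  exact hf.compMeasurePreservingLp hg (fun x => measurePreserving_sub (a x)) (by simp)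

variable (k) in
/-- Extension by zero from the half line to the line. -/
def extendR : L2 k (Set.Ici 0) →ₗᵢ[ℂ] L2 k Set.univ :=
  extendL2 measurableSet_Ici (Set.subset_univ _)

/-- Translations of the whole line form a group and have no boundary terms; this identity transfers
their composition law and continuity to the half line. -/
theorem extendR_shiftR (t : ℝ≥0) (f : L2 k (Set.Ici 0)) :
    extendR k (shiftR k t f) = translate k t (extendR k f) := by
  refine Lp.ext ?_
  filter_upwards [coeFn_extendL2 measurableSet_Ici (Set.subset_univ _) (shiftR k t f),
    indicator_ae_eq measurableSet_Ici (Set.subset_univ _) (coeFn_shiftR t f),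
    coeFn_translate t (extendR k f), (measurePreserving_sub t).quasiMeasurePreserving.ae
      (coeFn_extendL2 measurableSet_Ici (Set.subset_univ _) f)] with x h1 h2 h3 h4
  rw [h3, Function.comp_apply, extendR, h1, h2, h4]
  by_cases hx : (t : ℝ) ≤ x
  · rw [Set.indicator_of_mem (show x ∈ Set.Ici (0 : ℝ) from t.2.trans hx),
      Set.indicator_of_mem (show x ∈ Set.Ici (t : ℝ) from hx),
      Set.indicator_of_mem (show x - t ∈ Set.Ici (0 : ℝ) from sub_nonneg.2 hx)]
    rfl
  · rw [Set.indicator_of_notMem (show x - t ∉ Set.Ici (0 : ℝ) by simpa using hx)]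
    refine Set.indicator_apply_eq_zero.2 fun _ => ?_
    rw [Set.indicator_of_notMem (show x ∉ Set.Ici (t : ℝ) from hx)]

theorem shiftR_add (c d : ℝ≥0) (f : L2 k (Set.Ici 0)) :
    shiftR k (c + d) f = shiftR k c (shiftR k d f) := by
  apply (extendR k).injective
  simp_rw [extendR_shiftR]
  rw [translate_translate, NNReal.coe_add]

theorem shiftR_zero (f : L2 k (Set.Ici 0)) : shiftR k 0 f = f := by
  apply (extendR k).injective
  rw [extendR_shiftR, NNReal.coe_zero, translate_zero]

theorem measurePreserving_unshift (t : ℝ≥0) : MeasurePreserving (fun s : ℝ => s + t)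
    (volume.restrict (Set.Ici 0)) (volume.restrict (Set.Ici (t : ℝ))) := by
  have h := (measurePreserving_add_right (volume : Measure ℝ) (t : ℝ)).restrict_preimage
    (s := Set.Ici (t : ℝ)) measurableSet_Ici
  have h2 : (fun s : ℝ => s + t) ⁻¹' Set.Ici (t : ℝ) = Set.Ici 0 := by
    ext s
    simp
  rwa [h2] at h

theorem shiftL2_surjective (t : ℝ≥0) : Function.Surjective (shiftL2 (k := k) t) := by
  intro g
  refine ⟨Lp.compMeasurePreserving _ (measurePreserving_unshift t) g, Lp.ext ?_⟩
  filter_upwards [coeFn_shiftL2 t (Lp.compMeasurePreserving _ (measurePreserving_unshift t) g),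
    (measurePreserving_shift t).quasiMeasurePreserving.ae
      (Lp.coeFn_compMeasurePreserving g (measurePreserving_unshift t))] with x h1 h2
  rw [h1, Function.comp_apply, h2]
  simp

variable [CompleteSpace k]

theorem disjoint_Ico_Ici (t : ℝ) : Disjoint (Set.Ico 0 t) (Set.Ici t) :=
  Set.disjoint_left.2 fun _ h h' => absurd h.2 (not_lt.2 h')

theorem inner_extendL2_Ico_Ici (t : ℝ≥0) (f : L2 k (Set.Ico 0 (t : ℝ)))
    (g : L2 k (Set.Ici (t : ℝ))) :
    ⟪extendL2 measurableSet_Ico (Ico_subset_halfLine t) f,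
      extendL2 measurableSet_Ici (Ici_subset_halfLine t) g⟫_ℂ = 0 :=
  extendL2_inner measurableSet_Ico (Ico_subset_halfLine t) measurableSet_Ici
    (Ici_subset_halfLine t) (disjoint_Ico_Ici t) f g

theorem adjoint_extendL2_Ico (t : ℝ≥0) (f : L2 k (Set.Ici 0)) :
    ContinuousLinearMap.adjoint (extendL2 measurableSet_Ico
      (Ico_subset_halfLine t)).toContinuousLinearMap f = restrictL2 (Ico_subset_halfLine t) f := by
  refine ext_inner_left ℂ fun g => ?_
  rw [ContinuousLinearMap.adjoint_inner_right]
  conv_lhs => rw [← extendL2_restrictL2_add t f]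
  rw [inner_add_right, LinearIsometry.coe_toContinuousLinearMap, LinearIsometry.inner_map_map,
    inner_extendL2_Ico_Ici, add_zero]

theorem adjoint_extendL2_Ici (t : ℝ≥0) (f : L2 k (Set.Ici 0)) :
    ContinuousLinearMap.adjoint (extendL2 measurableSet_Ici
      (Ici_subset_halfLine t)).toContinuousLinearMap f = restrictL2 (Ici_subset_halfLine t) f := by
  refine ext_inner_left ℂ fun g => ?_
  rw [ContinuousLinearMap.adjoint_inner_right]
  conv_lhs => rw [← extendL2_restrictL2_add t f]
  rw [inner_add_right, LinearIsometry.coe_toContinuousLinearMap, LinearIsometry.inner_map_map,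
    ← inner_conj_symm, inner_extendL2_Ico_Ici, map_zero, zero_add]

variable (k) in
/-- The left shift on `L²([0, ∞); k)`. -/
def unshiftR (t : ℝ≥0) : L2 k (Set.Ici 0) →L[ℂ] L2 k (Set.Ici 0) :=
  ContinuousLinearMap.adjoint (shiftR k t).toContinuousLinearMap

theorem adjoint_isometry_apply {E E' : Type*} [NormedAddCommGroup E] [InnerProductSpace ℂ E]
    [CompleteSpace E] [NormedAddCommGroup E'] [InnerProductSpace ℂ E'] [CompleteSpace E']
    (V : E →ₗᵢ[ℂ] E') (x : E) :
    ContinuousLinearMap.adjoint V.toContinuousLinearMap (V x) = x := by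
  refine ext_inner_left ℂ fun y => ?_
  rw [ContinuousLinearMap.adjoint_inner_right]
  exact V.inner_map_map y x

theorem unshiftR_shiftR (t : ℝ≥0) (f : L2 k (Set.Ici 0)) : unshiftR k t (shiftR k t f) = f :=
  adjoint_isometry_apply (shiftR k t) f

/-- The shift maps onto L²([t, ∞); k), so its adjoint restricts to [t, ∞) and shifts back; shifting
again gives the projection onto functions supported there. -/
theorem shiftR_unshiftR (t : ℝ≥0) (f : L2 k (Set.Ici 0)) : shiftR k t (unshiftR k t f) =
    extendL2 measurableSet_Ici (Ici_subset_halfLine t) (restrictL2 (Ici_subset_halfLine t) f) := by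
  obtain ⟨g, hg⟩ := shiftL2_surjective t (restrictL2 (Ici_subset_halfLine t) f)
  have h : unshiftR k t f = g := by
    refine ext_inner_left ℂ fun y => ?_
    rw [unshiftR, ContinuousLinearMap.adjoint_inner_right]
    change ⟪extendL2 measurableSet_Ici (Ici_subset_halfLine t) (shiftL2 t y), f⟫_ℂ = _
    rw [← LinearIsometry.coe_toContinuousLinearMap, ← ContinuousLinearMap.adjoint_inner_right,
      adjoint_extendL2_Ici, ← hg, LinearIsometry.inner_map_map]
  rw [h, ← hg]
  rfl

theorem unshiftR_add (c d : ℝ≥0) (f : L2 k (Set.Ici 0)) :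
    unshiftR k (c + d) f = unshiftR k d (unshiftR k c f) := by
  refine ext_inner_left ℂ fun y => ?_
  simp only [unshiftR, ContinuousLinearMap.adjoint_inner_right,
    LinearIsometry.coe_toContinuousLinearMap]
  rw [shiftR_add]

theorem continuous_shiftR {X : Type*} [TopologicalSpace X] {a : X → ℝ≥0} (ha : Continuous a)
    {f : X → L2 k (Set.Ici 0)} (hf : Continuous f) : Continuous fun x => shiftR k (a x) (f x) := by
  have h := continuous_translate (k := k) (NNReal.continuous_coe.comp ha)
    ((extendR k).continuous.comp hf)
  refine (extendR k).isometry.comp_continuous_iff.1 (h.congr fun x => ?_)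
  exact (extendR_shiftR _ _).symm

theorem continuous_unshiftR (f : L2 k (Set.Ici 0)) : Continuous fun t => unshiftR k t f := by
  -- The left shift is the compression to the half line of the translation by -t.
  have h : ∀ t, unshiftR k t f = ContinuousLinearMap.adjoint (extendR k).toContinuousLinearMap
      (translate k (-(t : ℝ)) (extendR k f)) := fun t => by
    refine ext_inner_left ℂ fun y => ?_
    rw [unshiftR, ContinuousLinearMap.adjoint_inner_right, ContinuousLinearMap.adjoint_inner_right,
      LinearIsometry.coe_toContinuousLinearMap, LinearIsometry.coe_toContinuousLinearMap,
      ← (extendR k).inner_map_map, extendR_shiftR, ← (translate k (-(t : ℝ))).inner_map_map,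
      translate_translate, neg_add_cancel, translate_zero]
  simp_rw [h]
  exact (ContinuousLinearMap.continuous _).comp
    (continuous_translate (NNReal.continuous_coe.neg) continuous_const)

variable (k) in
/-- The projection of `L²([0, ∞); k)` onto `L²([0, t); k)`. -/
def cutR (t : ℝ≥0) : L2 k (Set.Ici 0) →L[ℂ] L2 k (Set.Ici 0) :=
  1 - (shiftR k t).toContinuousLinearMap * unshiftR k t

theorem cutR_apply (t : ℝ≥0) (f : L2 k (Set.Ici 0)) :
    cutR k t f = f - shiftR k t (unshiftR k t f) := rfl

theorem cutR_eq (t : ℝ≥0) (f : L2 k (Set.Ici 0)) : cutR k t f =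
    extendL2 measurableSet_Ico (Ico_subset_halfLine t) (restrictL2 (Ico_subset_halfLine t) f) := by
  rw [cutR_apply, shiftR_unshiftR, sub_eq_iff_eq_add, extendL2_restrictL2_add]

theorem cutR_shiftR (c d : ℝ≥0) (f : L2 k (Set.Ici 0)) :
    cutR k (c + d) (shiftR k c f) = shiftR k c (cutR k d f) := by
  rw [cutR_apply, cutR_apply, map_sub, shiftR_add, unshiftR_add, unshiftR_shiftR]

theorem cutR_cutR (c d : ℝ≥0) (f : L2 k (Set.Ici 0)) :
    cutR k (c + d) (cutR k c f) = cutR k c f := by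
  rw [cutR_apply c, map_sub, cutR_shiftR, cutR_apply, cutR_apply, shiftR_add, unshiftR_add]
  simp

theorem continuous_cutR (f : L2 k (Set.Ici 0)) : Continuous fun t => cutR k t f := by
  simp_rw [cutR_apply]
  exact continuous_const.sub (continuous_shiftR continuous_id (continuous_unshiftR f))

end OneParticle

/-! ### Fock space as a stop flow -/

theorem continuous_expVec {H : Type*} [NormedAddCommGroup H] [InnerProductSpace ℂ H] :
    Continuous (expVec : H → Fock H) := by
  have h : ∀ f g : H, ‖expVec g - expVec f‖ ^ 2 = RCLike.re (Complex.exp ⟪g, g⟫_ℂ) -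
      2 * RCLike.re (Complex.exp ⟪g, f⟫_ℂ) + RCLike.re (Complex.exp ⟪f, f⟫_ℂ) := fun f g => by
    rw [norm_sub_sq (𝕜 := ℂ), ← inner_self_eq_norm_sq (𝕜 := ℂ), ← inner_self_eq_norm_sq (𝕜 := ℂ),
      inner_expVec, inner_expVec, inner_expVec]
  rw [continuous_iff_continuousAt]
  intro f
  rw [ContinuousAt, tendsto_iff_norm_sub_tendsto_zero]
  have h1 : Continuous fun g : H => Real.sqrt (RCLike.re (Complex.exp ⟪g, g⟫_ℂ) -
      2 * RCLike.re (Complex.exp ⟪g, f⟫_ℂ) + RCLike.re (Complex.exp ⟪f, f⟫_ℂ)) := by fun_prop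
  have h2 := h1.tendsto f
  have h3 : ∀ a : ℝ, a - 2 * a + a = 0 := fun a => by ring
  rw [h3, Real.sqrt_zero] at h2
  refine h2.congr fun g => ?_
  rw [← h, Real.sqrt_sq (norm_nonneg _)]

section Tensor

variable {E F : Type*} [NormedAddCommGroup E] [InnerProductSpace ℂ E]
  [NormedAddCommGroup F] [InnerProductSpace ℂ F]

variable (E F) in
/-- The elementary tensor as a bounded bilinear map. -/
def htmulL : E →L[ℂ] F →L[ℂ] E ⊗ᴴ F :=
  (ContinuousLinearMap.compL ℂ F (E ⊗[ℂ] F) (E ⊗ᴴ F) UniformSpace.Completion.toComplL).comp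
    (TensorProduct.mkL ℂ E F)

theorem norm_htmul (x : E) (y : F) : ‖htmul x y‖ = ‖x‖ * ‖y‖ := by
  rw [htmul, UniformSpace.Completion.norm_coe, TensorProduct.norm_tmul]

end Tensor

theorem norm_adjoint_isometry_le {E E' : Type*} [NormedAddCommGroup E] [InnerProductSpace ℂ E]
    [CompleteSpace E] [NormedAddCommGroup E'] [InnerProductSpace ℂ E'] [CompleteSpace E']
    (V : E →ₗᵢ[ℂ] E') (x : E') :
    ‖ContinuousLinearMap.adjoint V.toContinuousLinearMap x‖ ≤ ‖x‖ := by
  refine (ContinuousLinearMap.le_opNorm _ x).trans ?_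
  rw [LinearIsometryEquiv.norm_map]
  exact mul_le_of_le_one_left (norm_nonneg _) V.norm_toContinuousLinearMap_le

/-- Under a uniform bound, approximation of the vector is uniform in the parameter, and uniform
limits of continuous functions are continuous. -/
theorem continuous_apply_of_total {X ι E G : Type*} [TopologicalSpace X] [NormedAddCommGroup E]
    [InnerProductSpace ℂ E] [NormedAddCommGroup G] [NormedSpace ℂ G] {A : X → E →L[ℂ] G} {C : ℝ}
    (hC : ∀ c v, ‖A c v‖ ≤ C * ‖v‖) {a : ι → E}
    (ha : (Submodule.span ℂ (Set.range a)).topologicalClosure = ⊤)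
    (h : ∀ i, Continuous fun c => A c (a i)) (v : E) : Continuous fun c => A c v := by
  let K : Submodule ℂ E :=
    { carrier := {v | Continuous fun c => A c v}
      add_mem' := fun {v w} hv hw => by
        simp only [Set.mem_ofPred_eq, map_add] at *
        exact hv.add hw
      zero_mem' := by simpa using continuous_const
      smul_mem' := fun r v hv => by
        simp only [Set.mem_ofPred_eq, map_smul] at *
        exact hv.const_smul r }
  have hK : Submodule.span ℂ (Set.range a) ≤ K := Submodule.span_le.2 fun _ ⟨i, hi⟩ => hi ▸ h i
  have hv : v ∈ (Submodule.span ℂ (Set.range a)).topologicalClosure := ha ▸ Submodule.mem_top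
  refine continuous_of_uniform_approx_of_continuous fun u hu => ?_
  obtain ⟨ε, hε, hu⟩ := Metric.mem_uniformity_dist.1 hu
  obtain ⟨w, hw, hvw⟩ := Metric.mem_closure_iff.1 hv (ε / (|C| + 1)) (by positivity)
  refine ⟨fun c => A c w, hK hw, fun c => hu ?_⟩
  rw [dist_eq_norm, ← map_sub]
  rw [dist_eq_norm, lt_div_iff₀ (by positivity)] at hvw
  refine (hC c _).trans_lt (lt_of_le_of_lt ?_ hvw)
  rw [mul_comm]
  gcongr
  linarith [le_abs_self C]

theorem adjoint_secondQuant {H H' : Type*} [NormedAddCommGroup H] [InnerProductSpace ℂ H]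
    [CompleteSpace H] [NormedAddCommGroup H'] [InnerProductSpace ℂ H'] [CompleteSpace H']
    (V : H →ₗᵢ[ℂ] H') (f : H') :
    ContinuousLinearMap.adjoint (secondQuant V).toContinuousLinearMap (expVec f) =
      expVec (ContinuousLinearMap.adjoint V.toContinuousLinearMap f) := by
  refine eq_of_inner_total expVec_total fun g => ?_
  rw [ContinuousLinearMap.adjoint_inner_right, LinearIsometry.coe_toContinuousLinearMap,
    secondQuant_expVec, inner_expVec, inner_expVec, ContinuousLinearMap.adjoint_inner_right,
    LinearIsometry.coe_toContinuousLinearMap]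

section Flow

variable {k : Type*} [NormedAddCommGroup k] [InnerProductSpace ℂ k] [CompleteSpace k]

variable (k) in
/-- The embedding `y ↦ y ⊗ ε(0)` of the Fock space over `L²([0, t); k)`. -/
def pastIncl (t : ℝ≥0) : Fock (L2 k (Set.Ico 0 (t : ℝ))) →ₗᵢ[ℂ] FockR k :=
  secondQuant (extendL2 measurableSet_Ico (Ico_subset_halfLine t))

variable (k) in
/-- The adjoint of `y ↦ y ⊗ ε(0)`. -/
def pastProj (t : ℝ≥0) : FockR k →L[ℂ] Fock (L2 k (Set.Ico 0 (t : ℝ))) :=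
  ContinuousLinearMap.adjoint (pastIncl k t).toContinuousLinearMap

theorem pastProj_expVec (t : ℝ≥0) (f : L2 k (Set.Ici 0)) :
    pastProj k t (expVec f) = expVec (restrictL2 (Ico_subset_halfLine t) f) := by
  rw [pastProj, pastIncl, adjoint_secondQuant, adjoint_extendL2_Ico]

theorem pastProj_pastIncl (t : ℝ≥0) (a : Fock (L2 k (Set.Ico 0 (t : ℝ)))) :
    pastProj k t (pastIncl k t a) = a := adjoint_isometry_apply _ a

theorem inner_pastIncl (t : ℝ≥0) (a : Fock (L2 k (Set.Ico 0 (t : ℝ)))) (y : FockR k) :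
    ⟪pastIncl k t a, y⟫_ℂ = ⟪a, pastProj k t y⟫_ℂ :=
  (ContinuousLinearMap.adjoint_inner_right _ _ _).symm

theorem splitAt_expVec (t : ℝ≥0) (f : L2 k (Set.Ico 0 (t : ℝ))) (g : L2 k (Set.Ici (t : ℝ))) :
    splitAt t (htmul (expVec f) (expVec g)) =
      expVec (extendL2 measurableSet_Ico (Ico_subset_halfLine t) f +
        extendL2 measurableSet_Ici (Ici_subset_halfLine t) g) :=
  fockMul_htmul _ _ _ f g

theorem splitAt_htmul_expVec_zero (t : ℝ≥0) (a : Fock (L2 k (Set.Ico 0 (t : ℝ)))) :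
    splitAt t (htmul a (expVec 0)) = pastIncl k t a := by
  have h : (splitAt t).toContinuousLinearMap.comp ((htmulL _ _).flip (expVec 0)) =
      (pastIncl k t).toContinuousLinearMap := clm_ext_of_total expVec_total fun f => by
    change splitAt t (htmul (expVec f) (expVec 0)) = pastIncl k t (expVec f)
    rw [splitAt_expVec, map_zero, add_zero, pastIncl, secondQuant_expVec]
  exact congrArg (fun f : _ →L[ℂ] FockR k => f a) h

/-- The map `(y, x) ↦ E_t y ⊗ Γ_t x`. -/
def fockM (t : ℝ≥0) : FockR k →L[ℂ] FockR k →L[ℂ] FockR k :=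
  (ContinuousLinearMap.compL ℂ (FockR k) _ (FockR k) (splitAt t).toContinuousLinearMap).comp
    ((htmulL _ _).bilinearComp (pastProj k t) (secondQuant (shiftL2 t)).toContinuousLinearMap)

theorem fockM_apply (t : ℝ≥0) (y x : FockR k) :
    fockM t y x = splitAt t (htmul (pastProj k t y) (secondQuant (shiftL2 t) x)) := rfl

theorem fockM_expVec (t : ℝ≥0) (f g : L2 k (Set.Ici 0)) :
    fockM t (expVec f) (expVec g) = expVec (cutR k t f + shiftR k t g) := by
  rw [fockM_apply, pastProj_expVec, secondQuant_expVec, splitAt_expVec, cutR_eq]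
  rfl

theorem fockM_vac (t : ℝ≥0) (y : FockR k) : fockM t y vac = pastIncl k t (pastProj k t y) := by
  rw [fockM_apply, vac, secondQuant_expVec, map_zero, splitAt_htmul_expVec_zero]

theorem norm_fockM_le (t : ℝ≥0) (y x : FockR k) : ‖fockM t y x‖ ≤ ‖y‖ * ‖x‖ := by
  rw [fockM_apply, LinearIsometry.norm_map, norm_htmul, LinearIsometry.norm_map]
  gcongr
  exact norm_adjoint_isometry_le _ y

/-- Trilinearity and boundedness reduce this to exponential vectors, one slot at a time; there it
says that cutting and shifting one-particle functions compose correctly. -/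
theorem fockM_assoc (c d : ℝ≥0) (y x z : FockR k) :
    fockM (c + d) (fockM c y x) z = fockM c y (fockM d x z) := by
  have h1 : ∀ f g z, fockM (c + d) (fockM c (expVec f) (expVec g)) z =
      fockM c (expVec f) (fockM d (expVec g) (z : FockR k)) := fun f g z => by
    refine congrArg (fun F : FockR k →L[ℂ] FockR k => F z) (clm_ext_of_total
      (f := fockM (c + d) (fockM c (expVec f) (expVec g)))
      (g := (fockM c (expVec f)).comp (fockM d (expVec g))) expVec_total fun h => ?_)
    rw [ContinuousLinearMap.comp_apply]
    simp_rw [fockM_expVec]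
    rw [map_add, map_add, cutR_cutR, cutR_shiftR, shiftR_add, add_assoc]
  have h2 : ∀ f x z, fockM (c + d) (fockM c (expVec f) x) z =
      fockM c (expVec f) (fockM d x (z : FockR k)) := fun f x z =>
    congrArg (fun F : FockR k →L[ℂ] FockR k => F x) (clm_ext_of_total
      (f := ((fockM (c + d)).flip z).comp (fockM c (expVec f)))
      (g := (fockM c (expVec f)).comp ((fockM d).flip z)) expVec_total fun g => h1 f g z)
  exact congrArg (fun F : FockR k →L[ℂ] FockR k => F y) (clm_ext_of_total
      (f := ((fockM (c + d)).flip z).comp ((fockM c).flip x))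
      (g := (fockM c).flip (fockM d x z)) expVec_total fun f => h2 f x z)

theorem continuous_fockM (y x : FockR k) : Continuous fun t => fockM t y x := by
  have h1 : ∀ (f : L2 k (Set.Ici 0)) (x : FockR k), Continuous fun t => fockM t (expVec f) x :=
    fun f => continuous_apply_of_total (fun t x => norm_fockM_le t _ x) expVec_total fun g => by
      simp_rw [fockM_expVec]
      exact continuous_expVec.comp ((continuous_cutR f).add
        (continuous_shiftR continuous_id continuous_const))
  exact continuous_apply_of_total (A := fun t => (fockM t).flip x) (C := ‖x‖)
    (fun t y => (norm_fockM_le t y x).trans_eq (mul_comm _ _)) expVec_total (fun f => h1 f x) y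

variable (k) in
/-- The Fock space over `L²([0, ∞); k)` with the splittings of the half line. -/
def fockFlow : StopFlow (FockR k) where
  M := fockM
  Ω := vac
  inner_M c y x y' x' := by
    rw [fockM_vac, fockM_apply, fockM_apply, LinearIsometry.inner_map_map, inner_htmul,
      LinearIsometry.inner_map_map, ← inner_conj_symm y, inner_pastIncl, inner_conj_symm]
  assoc := fockM_assoc
  M_zero x := by
    refine congrArg (fun F : FockR k →L[ℂ] FockR k => F x) (clm_ext_of_total (f := fockM 0 vac)
      (g := ContinuousLinearMap.id ℂ _) expVec_total fun g => ?_)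
    rw [vac, fockM_expVec, map_zero, zero_add, shiftR_zero]
    rfl
  M_vac c := by
    rw [vac, fockM_expVec, map_zero, map_zero, zero_add]
  norm_vac := by
    have h := inner_expVec (0 : L2 k (Set.Ici 0)) 0
    change ⟪(vac : FockR k), vac⟫_ℂ = _ at h
    rw [inner_self_eq_norm_sq_to_K, inner_zero_left, Complex.exp_zero] at h
    have h1 : ((‖(vac : FockR k)‖ : ℝ) : ℂ) ^ 2 = 1 := h
    have h2 : ‖(vac : FockR k)‖ ^ 2 = 1 := by exact_mod_cast h1
    exact (pow_eq_one_iff_of_nonneg (norm_nonneg _) two_ne_zero).1 h2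
  continuous_M := continuous_fockM
  gen := Set.range expVec
  gen_total := expVec_total
  exists_tail := by
    rintro _ ⟨f, rfl⟩
    refine ⟨fun c => expVec (unshiftR k c f), continuous_expVec.comp (continuous_unshiftR f),
      fun c => ?_⟩
    rw [fockM_expVec, cutR_apply, sub_add_cancel]

theorem fockFlow_M (c : ℝ≥0) : (fockFlow k).M c = fockM c := rfl

theorem starProjection_eq_E (c : ℝ≥0) :
    (Submodule.span ℂ (Set.range fun x : Fock (L2 k (Set.Ico 0 (c : ℝ))) =>
      splitAt c (htmul x (expVec 0)))).topologicalClosure.starProjection = (fockFlow k).E c := by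
  have hE := (fockFlow k).isStarProjection_E c
  have hEa : ∀ y, (fockFlow k).E c y = pastIncl k c (pastProj k c y) := fockM_vac c
  refine ContinuousLinearMap.ext fun y => ?_
  refine Submodule.eq_starProjection_of_mem_of_inner_eq_zero ?_ fun w hw => ?_
  · refine Submodule.le_topologicalClosure _ (Submodule.subset_span ⟨pastProj k c y, ?_⟩)
    rw [hEa]
    exact splitAt_htmul_expVec_zero c _
  · have hle : (Submodule.span ℂ (Set.range fun x : Fock (L2 k (Set.Ico 0 (c : ℝ))) =>
        splitAt c (htmul x (expVec 0)))).topologicalClosure ≤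
        LinearMap.eqLocus ((fockFlow k).E c).toLinearMap LinearMap.id := by
      refine Submodule.topologicalClosure_minimal _ (Submodule.span_le.2 ?_)
        (isClosed_eq ((fockFlow k).E c).continuous continuous_id)
      rintro _ ⟨a, rfl⟩
      change (fockFlow k).E c (splitAt c (htmul a (expVec 0))) = splitAt c (htmul a (expVec 0))
      rw [splitAt_htmul_expVec_zero, hEa, pastProj_pastIncl]
    have hw' : (fockFlow k).E c w = w := hle hw
    rw [← hw', ← proj_inner hE, map_sub, proj_proj hE, sub_self, inner_zero_left]

theorem timeProj_eq (s : ℝ≥0∞) : timeProj k s = (fockFlow k).Ee s := by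
  by_cases hs : s = ⊤
  · rw [timeProj, StopFlow.Ee, if_pos hs, if_pos hs]
  · rw [timeProj, StopFlow.Ee, if_neg hs, if_neg hs]
    exact starProjection_eq_E _

theorem secondQuant_shiftR (c : ℝ≥0) :
    (secondQuant (shiftR k c)).toContinuousLinearMap = fockM c vac :=
  clm_ext_of_total expVec_total fun g => by
    rw [vac, fockM_expVec, map_zero, zero_add]
    exact secondQuant_expVec _ g

theorem shiftOp_eq {s : ℝ≥0∞} (hs : s ≠ ⊤) (x : FockR k) :
    shiftOp k s x = (fockFlow k).Me s vac x := by
  rw [shiftOp, StopFlow.Me, if_neg hs, if_neg hs]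
  exact congrArg (fun F : FockR k →L[ℂ] FockR k => F x) (secondQuant_shiftR _)

theorem isoIntegrand_eq {s : ℝ≥0∞} (hs : s ≠ ⊤) (f : L2 k (Set.Ici 0)) (x : FockR k) :
    isoIntegrand f x s = (fockFlow k).Me s (expVec f) x := by
  rw [isoIntegrand, StopFlow.Me, if_neg hs, if_neg hs, fockFlow_M, fockM_apply, pastProj_expVec]

theorem pastProj_splitAt (t : ℝ≥0) (a : Fock (L2 k (Set.Ico 0 (t : ℝ))))
    (g : L2 k (Set.Ici (t : ℝ))) : pastProj k t (splitAt t (htmul a (expVec g))) = a := by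
  refine ext_inner_left ℂ fun b => ?_
  rw [← inner_pastIncl, ← splitAt_htmul_expVec_zero, LinearIsometry.inner_map_map, inner_htmul,
    inner_expVec, inner_zero_left, Complex.exp_zero, mul_one]

/-- The operator on the past is recovered by compressing A with the vacuum of the future. In this
direction surjectivity of the shift onto L²([t, ∞); k) is needed, to reach every exponential vector
of the future from some Γ_t ε(g). -/
theorem adapted_iff (t : ℝ≥0) (A : FockR k →L[ℂ] FockR k) :
    (∃ X : Fock (L2 k (Set.Ico 0 (t : ℝ))) →L[ℂ] Fock (L2 k (Set.Ico 0 (t : ℝ))),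
      ∀ z, A (splitAt t z) = splitAt t (hmap X (ContinuousLinearMap.id ℂ _) z)) ↔
      (fockFlow k).Adapted t A := by
  constructor
  · rintro ⟨X, hX⟩ y x
    have h : (pastProj k t).comp A = X.comp (pastProj k t) :=
      clm_ext_of_total expVec_total fun f => by
        rw [ContinuousLinearMap.comp_apply, ContinuousLinearMap.comp_apply, pastProj_expVec]
        conv_lhs => rw [← extendL2_restrictL2_add t f, ← splitAt_expVec, hX, hmap_htmul]
        exact pastProj_splitAt t _ _
    rw [fockFlow_M, fockM_apply, fockM_apply, hX, hmap_htmul]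
    exact congrArg (fun a => splitAt t (htmul a _))
      (congrArg (fun F : FockR k →L[ℂ] _ => F y) h).symm
  · intro h
    let X := (pastProj k t).comp (A.comp (pastIncl k t).toContinuousLinearMap)
    refine ⟨X, fun z => ?_⟩
    refine congrArg (fun F : _ →L[ℂ] FockR k => F z) (clm_ext_of_total
      (f := A.comp (splitAt t).toContinuousLinearMap)
      (g := (splitAt t).toContinuousLinearMap.comp (hmap X (ContinuousLinearMap.id ℂ _)))
      (htmul_total expVec_total expVec_total) fun ⟨f, g⟩ => ?_)
    obtain ⟨g, rfl⟩ := shiftL2_surjective t g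
    have h1 := h (pastIncl k t (expVec f)) (expVec g)
    rw [fockFlow_M, fockM_apply, fockM_apply, pastProj_pastIncl, secondQuant_expVec] at h1
    change A (splitAt t _) = splitAt t (hmap X _ _)
    rw [h1, hmap_htmul]
    rfl

theorem isFiniteStopTime_iff (S : Set ℝ≥0∞ → FockR k →L[ℂ] FockR k) :
    IsFiniteStopTime S ↔ (fockFlow k).IsStop S :=
  ⟨fun h => ⟨h.toIsSpectralMeasure, fun t ht => (adapted_iff t _).1 (h.adapted t ht), h.zero_eq,
    h.top_eq⟩, fun h => ⟨⟨h.toIsSpectralMeasure, ⟨0, by rw [h.zero_eq, zero_smul]⟩,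
    fun t ht => (adapted_iff t _).2 (h.adapted t ht)⟩, h.zero_eq, h.top_eq⟩⟩

end Flow

/-! ### Isometric isomorphisms determined by total families -/

theorem exists_isometryEquiv_of_total {ι E F : Type*} [NormedAddCommGroup E]
    [InnerProductSpace ℂ E] [CompleteSpace E] [NormedAddCommGroup F] [InnerProductSpace ℂ F]
    [CompleteSpace F] {a : ι → E} {b : ι → F}
    (ha : (Submodule.span ℂ (Set.range a)).topologicalClosure = ⊤)
    (hb : (Submodule.span ℂ (Set.range b)).topologicalClosure = ⊤)
    (h : ∀ i j, ⟪b i, b j⟫_ℂ = ⟪a i, a j⟫_ℂ) : ∃ e : E ≃ₗᵢ[ℂ] F, ∀ i, e (a i) = b i := by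
  let V := isometryOfTotal a b ha h
  have hV : ∀ i, V (a i) = b i := isometryOfTotal_apply a b ha h
  have hcl : IsClosed (LinearMap.range V.toLinearMap : Set F) := by
    rw [LinearMap.coe_range]
    exact V.isometry.isClosedEmbedding.isClosed_range
  have hsurj : Function.Surjective V := by
    have h1 : (Submodule.span ℂ (Set.range b)).topologicalClosure ≤ LinearMap.range V.toLinearMap :=
      Submodule.topologicalClosure_minimal _
        (Submodule.span_le.2 fun _ ⟨i, hi⟩ => hi ▸ ⟨a i, hV i⟩) hcl
    rw [hb] at h1
    exact fun y => h1 Submodule.mem_top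
  exact ⟨LinearIsometryEquiv.ofSurjective V hsurj, hV⟩

theorem image_closedSpan {E F : Type*} [NormedAddCommGroup E] [InnerProductSpace ℂ E]
    [NormedAddCommGroup F] [InnerProductSpace ℂ F] (e : E ≃ₗᵢ[ℂ] F) (s : Set E) :
    e '' closedSpan s = closedSpan (e '' s) := by
  rw [closedSpan, closedSpan, Submodule.topologicalClosure_coe, Submodule.topologicalClosure_coe]
  change e.toHomeomorph '' _ = _
  rw [e.toHomeomorph.image_closure]
  change closure ((e.toLinearEquiv.toLinearMap : E → F) '' _) =
    closure (Submodule.span ℂ ((e.toLinearEquiv.toLinearMap : E → F) '' s) : Set F)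
  rw [← Submodule.map_span, Submodule.map_coe]

theorem total_of_surjective {ι E : Type*} [NormedAddCommGroup E] [InnerProductSpace ℂ E]
    {a : ι → E} (ha : Function.Surjective a) :
    (Submodule.span ℂ (Set.range a)).topologicalClosure = ⊤ := by
  rw [ha.range_eq, Submodule.span_univ]
  exact top_le_iff.1 (Submodule.le_topologicalClosure (⊤ : Submodule ℂ E))

section

variable {ι κ τ A B C F : Type*} [NormedAddCommGroup A] [InnerProductSpace ℂ A]
  [NormedAddCommGroup B] [InnerProductSpace ℂ B] [NormedAddCommGroup C] [InnerProductSpace ℂ C]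
  [NormedAddCommGroup F] [InnerProductSpace ℂ F] {a : ι → A} {b : κ → B} {c : τ → C}

theorem htmul_total_of_surjective (ha : Function.Surjective a) (hb : Function.Surjective b) :
    (Submodule.span ℂ (Set.range fun p : ι × κ => htmul (a p.1) (b p.2))).topologicalClosure = ⊤ :=
  htmul_total (total_of_surjective ha) (total_of_surjective hb)

theorem htmul_htmul_total_of_surjective (ha : Function.Surjective a) (hb : Function.Surjective b)
    (hc : Function.Surjective c) : (Submodule.span ℂ (Set.range fun p : (ι × κ) × τ =>
      htmul (htmul (a p.1.1) (b p.1.2)) (c p.2))).topologicalClosure = ⊤ :=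
  htmul_total (a := fun p : ι × κ => htmul (a p.1) (b p.2)) (b := c)
    (htmul_total_of_surjective ha hb) (total_of_surjective hc)

theorem exists_isometryEquiv_htmul_htmul [CompleteSpace F] (ha : Function.Surjective a)
    (hb : Function.Surjective b) (hc : Function.Surjective c) {d : (ι × κ) × τ → F}
    (hd : (Submodule.span ℂ (Set.range d)).topologicalClosure = ⊤)
    (h : ∀ p q, ⟪d p, d q⟫_ℂ = ⟪a p.1.1, a q.1.1⟫_ℂ * ⟪b p.1.2, b q.1.2⟫_ℂ * ⟪c p.2, c q.2⟫_ℂ) :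
    ∃ j : (A ⊗ᴴ B) ⊗ᴴ C ≃ₗᵢ[ℂ] F,
      ∀ x y z, j (htmul (htmul (a x) (b y)) (c z)) = d ((x, y), z) := by
  obtain ⟨j, hj⟩ := exists_isometryEquiv_of_total
    (a := fun p : (ι × κ) × τ => htmul (htmul (a p.1.1) (b p.1.2)) (c p.2))
    (htmul_htmul_total_of_surjective ha hb hc) hd fun p q => by
      rw [inner_htmul, inner_htmul, h]
  exact ⟨j, fun x y z => hj ((x, y), z)⟩

/-- The operator `j (X ⊗ Y) j^*`. -/
def conjTensor (j : A ⊗ᴴ B ≃ₗᵢ[ℂ] F) (X : A →L[ℂ] A) (Y : B →L[ℂ] B) : F →L[ℂ] F :=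
  (j.toContinuousLinearEquiv : _ →L[ℂ] F).comp ((hmap X Y).comp
    (j.symm.toContinuousLinearEquiv : F →L[ℂ] _))

theorem conjTensor_apply (j : A ⊗ᴴ B ≃ₗᵢ[ℂ] F) (X : A →L[ℂ] A) (Y : B →L[ℂ] B) (z : F) :
    conjTensor j X Y z = j (hmap X Y (j.symm z)) := rfl

theorem conjTensor_htmul (j : A ⊗ᴴ B ≃ₗᵢ[ℂ] F) (X : A →L[ℂ] A) (Y : B →L[ℂ] B) (x : A) (y : B) :
    conjTensor j X Y (j (htmul x y)) = j (htmul (X x) (Y y)) := by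
  rw [conjTensor_apply, j.symm_apply_apply, hmap_htmul]

end

/-! ### Ranges of E_S, Γ_S and E_{S ⋆ T} -/

namespace StopFlow

variable {F : Type*} [NormedAddCommGroup F] [InnerProductSpace ℂ F] [CompleteSpace F]
  {W : StopFlow F} {S T : Set ℝ≥0∞ → F →L[ℂ] F} {P : Set (ℝ≥0∞ × ℝ≥0∞) → F →L[ℂ] F}

namespace IsStop

theorem proj_vac (hS : W.IsStop S) : hS.proj W.Ω = W.Ω := by
  refine tendsto_nhds_unique (hS.tendsto_proj W.Ω) (tendsto_const_nhds.congr fun π => ?_)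
  have h : ∀ s, W.Ee s W.Ω = W.Ω := fun s => by
    induction s with
    | top => simp
    | coe c => rw [Ee_coe, E_apply, W.M_vac]
  simp_rw [h]
  exact (hS.riemannSum_const hS.zero_eq π _).symm

theorem inner_joint_vac (hS : W.IsStop S) (x x' : F) :
    ⟪hS.joint W.Ω x, hS.joint W.Ω x'⟫_ℂ = ⟪x, x'⟫_ℂ := by
  rw [hS.inner_joint, hS.proj_vac, inner_self_eq_norm_sq_to_K, W.norm_vac]
  simp

theorem inner_proj_proj (hS : W.IsStop S) (y y' : F) :
    ⟪hS.proj y, hS.proj y'⟫_ℂ = ⟪y, hS.proj y'⟫_ℂ := by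
  rw [proj_inner hS.isStarProjection_proj, proj_proj hS.isStarProjection_proj]

theorem isometry_joint_vac (hS : W.IsStop S) : Isometry (hS.joint W.Ω) :=
  AddMonoidHomClass.isometry_of_norm _ fun x => by
    rw [hS.norm_joint, hS.proj_vac, W.norm_vac, one_mul]

theorem adjoint_joint_vac (hS : W.IsStop S) (x : F) :
    ContinuousLinearMap.adjoint (hS.joint W.Ω) (hS.joint W.Ω x) = x := by
  refine ext_inner_left ℂ fun y => ?_
  rw [ContinuousLinearMap.adjoint_inner_right, hS.inner_joint_vac]

theorem isStarProjection_apply_proj (hS : W.IsStop S) {A : Set ℝ≥0∞} (hA : MeasurableSet A) :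
    IsStarProjection (S A * hS.proj) := by
  have h1 := hS.isStarProjection A hA
  have h2 := hS.isStarProjection_proj
  refine isStarProjection_of_inner (fun x => ?_) fun x y => ?_
  · change S A (hS.proj (S A (hS.proj x))) = S A (hS.proj x)
    rw [← hS.apply_proj hA, proj_proj h2, proj_proj h1]
  · change ⟪S A (hS.proj x), y⟫_ℂ = ⟪x, S A (hS.proj y)⟫_ℂ
    rw [proj_inner h1, proj_inner h2, hS.apply_proj hA]

theorem joint_joint_total (hS : W.IsStop S) (hT : W.IsStop T) :
    (Submodule.span ℂ (Set.range fun p : (F × F) × F =>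
      hS.joint p.1.1 (hT.joint p.1.2 p.2))).topologicalClosure = ⊤ := by
  set K := (Submodule.span ℂ (Set.range fun p : (F × F) × F =>
      hS.joint p.1.1 (hT.joint p.1.2 p.2))).topologicalClosure
  have hK : IsClosed (K : Set F) := Submodule.isClosed_topologicalClosure _
  have h : ∀ x v, hS.joint x v ∈ K := fun x v => by
    have hle : (Submodule.span ℂ (Set.range fun p : F × F =>
        hT.joint p.1 p.2)).topologicalClosure ≤ K.comap (hS.joint x).toLinearMap :=
      Submodule.topologicalClosure_minimal _ (Submodule.span_le.2 fun _ ⟨p, hp⟩ => hp ▸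
        Submodule.le_topologicalClosure _ (Submodule.subset_span ⟨((x, p.1), p.2), rfl⟩))
        (hK.preimage (hS.joint x).continuous)
    rw [hT.joint_total] at hle
    exact hle (Submodule.mem_top (x := v))
  rw [eq_top_iff, ← hS.joint_total]
  exact Submodule.topologicalClosure_minimal _
    (Submodule.span_le.2 fun _ ⟨p, hp⟩ => hp ▸ h p.1 p.2) hK

theorem closedSpan_joint_vac (hS : W.IsStop S) (hT : W.IsStop T) :
    closedSpan {w | ∃ y z, w = hS.joint W.Ω (hT.joint y z)} =
      LinearMap.range (hS.joint W.Ω).toLinearMap := by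
  refine Set.Subset.antisymm ?_ ?_
  · refine Submodule.topologicalClosure_minimal (t := LinearMap.range (hS.joint W.Ω).toLinearMap) _
      (Submodule.span_le.2 ?_) ?_
    · rintro _ ⟨y, z, rfl⟩
      exact ⟨_, rfl⟩
    · rw [LinearMap.coe_range]
      exact hS.isometry_joint_vac.isClosedEmbedding.isClosed_range
  · rintro _ ⟨v, rfl⟩
    set K := (Submodule.span ℂ {w | ∃ y z, w = hS.joint W.Ω (hT.joint y z)}).topologicalClosure
    have hK : IsClosed (K : Set F) := Submodule.isClosed_topologicalClosure _
    have hle : (Submodule.span ℂ (Set.range fun p : F × F =>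
        hT.joint p.1 p.2)).topologicalClosure ≤ K.comap (hS.joint W.Ω).toLinearMap :=
      Submodule.topologicalClosure_minimal _ (Submodule.span_le.2 fun _ ⟨p, hp⟩ => hp ▸
        Submodule.le_topologicalClosure _ (Submodule.subset_span ⟨p.1, p.2, rfl⟩))
        (hK.preimage (hS.joint W.Ω).continuous)
    rw [hT.joint_total] at hle
    exact hle (Submodule.mem_top (x := v))

end IsStop

theorem IsTensor.closedSpan_joint_proj {hS : W.IsStop S} {hT : W.IsStop T}
    (hP : IsTensor hS hT P) : closedSpan {w | ∃ x y, w = hS.joint x (hT.proj y)} =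
      LinearMap.range hP.isStop_conv.proj.toLinearMap := by
  have hR := hP.isStop_conv
  have hp := hR.isStarProjection_proj
  set K := (Submodule.span ℂ {w | ∃ x y, w = hS.joint x (hT.proj y)}).topologicalClosure with hKdef
  have hK : IsClosed (K : Set F) := Submodule.isClosed_topologicalClosure _
  have hKp : ∀ w ∈ K, hR.proj w = w := by
    have : K ≤ LinearMap.eqLocus hR.proj.toLinearMap LinearMap.id := by
      refine Submodule.topologicalClosure_minimal _ (Submodule.span_le.2 ?_)
        (isClosed_eq hR.proj.continuous continuous_id)
      rintro _ ⟨x, y, rfl⟩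
      exact hP.proj_conv x y
    exact fun w hw => this hw
  refine Set.Subset.antisymm (fun w hw => ⟨w, hKp w hw⟩) ?_
  rintro _ ⟨v, rfl⟩
  have : CompleteSpace K := hK.completeSpace_coe
  -- Here g is the part of E_{S⋆T} v orthogonal to the closed span. As g = J_{S⋆T}(g, Ω),
  -- `joint_conv` gives ⟪g, J_S(x, J_T(y, z))⟫ = ⟪g, J_S(x, E_T y)⟫⟪Ω, z⟫ = 0, and these vectors are
  -- total.
  set g := hR.proj v - K.starProjection (hR.proj v) with hg
  have hgp : hR.proj g = g := by
    rw [hg, map_sub, proj_proj hp, hKp _ (Submodule.starProjection_apply_mem _ _)]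
  have hgK : ∀ w ∈ K, ⟪g, w⟫_ℂ = 0 := fun w hw =>
    Submodule.starProjection_inner_eq_zero _ w hw
  have hg0 : g = 0 := by
    refine eq_of_inner_total (IsStop.joint_joint_total hS hT) fun p => ?_
    rw [inner_zero_right, ← inner_conj_symm, ← hP.joint_conv, ← hgp, ← hR.joint_vac g,
      hR.inner_joint, hP.proj_conv, hgK _ (Submodule.le_topologicalClosure _
        (Submodule.subset_span ⟨_, _, rfl⟩)), zero_mul, map_zero]
  change hR.proj v ∈ K
  rw [sub_eq_zero.1 hg0]
  exact Submodule.starProjection_apply_mem _ _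

end StopFlow

/-! ### From stop flows to the stated definitions -/

section Bridge

variable {k : Type*} [NormedAddCommGroup k] [InnerProductSpace ℂ k] [CompleteSpace k]
  {S T : Set ℝ≥0∞ → FockR k →L[ℂ] FockR k}

theorem isStopProj_apply_proj (hS : (fockFlow k).IsStop S) {t : ℝ≥0∞} (ht : 0 < t) :
    IsStopProj S t (S (Set.Icc 0 t) * hS.proj) := by
  refine ⟨hS.isStarProjection_apply_proj measurableSet_Icc, fun f => ?_⟩
  simp_rw [timeProj_eq]
  exact hS.tendsto_riemannSum_Icc (hS.tendsto_proj (expVec f)) ht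

theorem isStopProj_stopProj (hS : (fockFlow k).IsStop S) {t : ℝ≥0∞} (ht : 0 < t) :
    IsStopProj S t (stopProj S t) := by
  have h : ∃ L, IsStopProj S t L := ⟨_, isStopProj_apply_proj hS ht⟩
  rw [stopProj, dif_pos h]
  exact h.choose_spec

/-- The chosen operator is pinned down by uniqueness of limits on exponential vectors, and integrals
over [0, t] are those over [0, ∞] cut by S([0, t]). -/
theorem stopProj_eq (hS : (fockFlow k).IsStop S) {t : ℝ≥0∞} (ht : 0 < t) :
    stopProj S t = S (Set.Icc 0 t) * hS.proj :=
  clm_ext_of_total expVec_total fun f => tendsto_nhds_unique ((isStopProj_stopProj hS ht).2 f)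
    ((isStopProj_apply_proj hS ht).2 f)

theorem stopProj_top (hS : (fockFlow k).IsStop S) : stopProj S ⊤ = hS.proj := by
  rw [stopProj_eq hS ENNReal.zero_lt_top, show Set.Icc (0 : ℝ≥0∞) ⊤ = Set.univ from
    Set.Icc_bot_top, hS.total, one_mul]

theorem isStopShift_joint_vac (hS : (fockFlow k).IsStop S) : IsStopShift S (hS.joint vac) :=
  ⟨hS.isometry_joint_vac, fun x => hS.tendsto_riemannSum_congr hS.top_eq (hS.tendsto_joint vac x)
    fun _ hs => (shiftOp_eq hs x).symm⟩

theorem isStopShift_stopShift (hS : (fockFlow k).IsStop S) : IsStopShift S (stopShift S) := by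
  have h : ∃ L, IsStopShift S L := ⟨_, isStopShift_joint_vac hS⟩
  rw [stopShift, dif_pos h]
  exact h.choose_spec

theorem stopShift_eq (hS : (fockFlow k).IsStop S) : stopShift S = hS.joint vac :=
  ContinuousLinearMap.ext fun x => tendsto_nhds_unique ((isStopShift_stopShift hS).2 x)
    ((isStopShift_joint_vac hS).2 x)

theorem coe_toPre (hS : (fockFlow k).IsStop S) (y : FockR k) : (toPre S y : FockR k) = hS.proj y := by
  rw [← stopProj_top hS]
  rfl

theorem coe_toPost (hS : (fockFlow k).IsStop S) (x : FockR k) :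
    (toPost S x : FockR k) = hS.joint vac x := by
  rw [← stopShift_eq hS]
  rfl

theorem coe_toShiftedPre (hS : (fockFlow k).IsStop S) (hT : (fockFlow k).IsStop T) (y : FockR k) :
    (toShiftedPre S T y : FockR k) = hS.joint vac (hT.proj y) := by
  rw [← stopShift_eq hS, ← stopProj_top hT]
  rfl

theorem toPre_surjective (S : Set ℝ≥0∞ → FockR k →L[ℂ] FockR k) :
    Function.Surjective (toPre S) := fun ⟨_, y, hy⟩ => ⟨y, Subtype.ext hy⟩

theorem toPost_surjective (S : Set ℝ≥0∞ → FockR k →L[ℂ] FockR k) :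
    Function.Surjective (toPost S) := fun ⟨_, y, hy⟩ => ⟨y, Subtype.ext hy⟩

theorem toShiftedPre_surjective (S T : Set ℝ≥0∞ → FockR k →L[ℂ] FockR k) :
    Function.Surjective (toShiftedPre S T) := fun ⟨_, _, ⟨y, rfl⟩, hy⟩ => ⟨y, Subtype.ext hy⟩

theorem inner_toPre (hS : (fockFlow k).IsStop S) (y y' : FockR k) :
    ⟪toPre S y, toPre S y'⟫_ℂ = ⟪y, hS.proj y'⟫_ℂ := by
  rw [Submodule.coe_inner, coe_toPre hS, coe_toPre hS, hS.inner_proj_proj]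

theorem inner_toPost (hS : (fockFlow k).IsStop S) (x x' : FockR k) :
    ⟪toPost S x, toPost S x'⟫_ℂ = ⟪x, x'⟫_ℂ := by
  rw [Submodule.coe_inner, coe_toPost hS, coe_toPost hS]
  exact hS.inner_joint_vac x x'

theorem inner_toShiftedPre (hS : (fockFlow k).IsStop S) (hT : (fockFlow k).IsStop T)
    (y y' : FockR k) : ⟪toShiftedPre S T y, toShiftedPre S T y'⟫_ℂ = ⟪y, hT.proj y'⟫_ℂ := by
  rw [Submodule.coe_inner, coe_toShiftedPre hS hT, coe_toShiftedPre hS hT, ← hT.inner_proj_proj]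
  exact hS.inner_joint_vac _ _

theorem exists_stopIso (hS : (fockFlow k).IsStop S) :
    ∃ j : preSpace S ⊗ᴴ postSpace S ≃ₗᵢ[ℂ] FockR k,
      ∀ y x, j (htmul (toPre S y) (toPost S x)) = hS.joint y x := by
  obtain ⟨j, hj⟩ := exists_isometryEquiv_of_total
    (a := fun p : FockR k × FockR k => htmul (toPre S p.1) (toPost S p.2))
    (htmul_total_of_surjective (toPre_surjective S) (toPost_surjective S)) hS.joint_total fun p q => by
        rw [inner_htmul, inner_toPre hS, inner_toPost hS, hS.inner_joint]
  exact ⟨j, fun y x => hj (y, x)⟩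

/-- The condition for every t follows from t = ∞: E_{S,t} ε(f) = E_S S([0, t]) ε(f), and S([0, t])
passes out of the joint integral. -/
theorem isStopIso_of_joint (hS : (fockFlow k).IsStop S)
    {j : preSpace S ⊗ᴴ postSpace S ≃ₗᵢ[ℂ] FockR k}
    (hj : ∀ y x, j (htmul (toPre S y) (toPost S x)) = hS.joint y x) : IsStopIso S j := by
  intro t ht f x
  have h1 : stopProj S t (expVec f) = toPre S (S (Set.Icc 0 t) (expVec f)) := by
    rw [stopProj_eq hS ht, coe_toPre hS, ← hS.apply_proj measurableSet_Icc]
    rfl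
  have h2 : stopProj S t (expVec f) ∈ preSpace S := h1 ▸ (toPre S _).2
  refine ⟨h2, ?_⟩
  have h3 : (⟨stopProj S t (expVec f), h2⟩ : preSpace S) = toPre S (S (Set.Icc 0 t) (expVec f)) :=
    Subtype.ext h1
  rw [h3, hj, ← hS.apply_joint measurableSet_Icc]
  exact hS.tendsto_riemannSum_Icc (hS.tendsto_riemannSum_congr hS.top_eq
    (hS.tendsto_joint (expVec f) x) fun _ hs => (isoIntegrand_eq hs f x).symm) ht

theorem exists_stopTensor (hS : (fockFlow k).IsStop S) (hT : (fockFlow k).IsStop T)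
    {j : preSpace S ⊗ᴴ postSpace S ≃ₗᵢ[ℂ] FockR k}
    (hj : ∀ y x, j (htmul (toPre S y) (toPost S x)) = hS.joint y x) :
    ∃ P, IsStopTensor S T j P ∧ StopFlow.IsTensor hS hT P := by
  -- The outer E_S only serves to land in the pre-S space; S(A) commutes with E_S, so it changes
  -- nothing.
  let X : Set ℝ≥0∞ → preSpace S →L[ℂ] preSpace S := fun A =>
    ((stopProj S ⊤).comp ((S A).comp (preSpace S).subtypeL)).codRestrict (preSpace S)
      fun _ => LinearMap.mem_range_self _ _
  let Y : Set ℝ≥0∞ → postSpace S →L[ℂ] postSpace S := fun B =>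
    ((stopShift S).comp ((T B).comp ((ContinuousLinearMap.adjoint (stopShift S)).comp
      (postSpace S).subtypeL))).codRestrict (postSpace S) fun _ => LinearMap.mem_range_self _ _
  have hX : ∀ A, MeasurableSet A → ∀ a, (X A a : FockR k) = S A a := fun A hA a => by
    obtain ⟨y, rfl⟩ := toPre_surjective S a
    change stopProj S ⊤ (S A (toPre S y)) = S A (toPre S y)
    rw [stopProj_top hS, coe_toPre hS, ← hS.apply_proj hA, proj_proj hS.isStarProjection_proj]
  have hX' : ∀ A, MeasurableSet A → ∀ y, X A (toPre S y) = toPre S (S A y) := fun A hA y => by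
    apply Subtype.ext
    rw [hX A hA, coe_toPre hS, coe_toPre hS, hS.apply_proj hA]
  have hY' : ∀ B x, Y B (toPost S x) = toPost S (T B x) := fun B x => by
    apply Subtype.ext
    change stopShift S (T B (ContinuousLinearMap.adjoint (stopShift S) (toPost S x))) = _
    rw [coe_toPost hS, coe_toPost hS, stopShift_eq hS]
    exact congrArg (fun v => hS.joint vac (T B v)) (hS.adjoint_joint_vac x)
  have hR : ∀ A B, MeasurableSet A → MeasurableSet B → ∀ y x,
      conjTensor j (X A) (Y B) (hS.joint y x) = hS.joint (S A y) (T B x) := fun A B hA _ y x => by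
    rw [← hj, conjTensor_htmul, hX' A hA, hY', hj]
  obtain ⟨P, hP, hPR⟩ := exists_prod_spectralMeasure hS.toIsSpectralMeasure hT.toIsSpectralMeasure
    (J := fun y x => hS.joint y x) (p := hS.proj)
    (fun y x y' x' => by rw [hS.inner_joint, proj_inner hS.isStarProjection_proj]) hS.joint_total
    (fun A hA y => (hS.apply_proj hA y).symm)
    (fun A B => conjTensor j (X A) (Y B)) hR
  refine ⟨P, ⟨hP, fun A B hA hB => ⟨X A, Y B, hX A hA, fun _ => rfl, fun z => ?_⟩⟩, hP,
    fun A B hA hB y x => ?_⟩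
  · rw [hPR A B hA hB, conjTensor_apply]
  · rw [hPR A B hA hB, hR A B hA hB]

theorem exists_stopIso_conv (hS : (fockFlow k).IsStop S) (hT : (fockFlow k).IsStop T)
    {R : Set ℝ≥0∞ → FockR k →L[ℂ] FockR k} (hR : (fockFlow k).IsStop R) :
    ∃ j : (preSpace S ⊗ᴴ shiftedPre S T) ⊗ᴴ postSpace R ≃ₗᵢ[ℂ] FockR k, ∀ x y z,
      j (htmul (htmul (toPre S x) (toShiftedPre S T y)) (toPost R z)) =
        hS.joint x (hT.joint y z) := by
  exact exists_isometryEquiv_htmul_htmul (toPre_surjective S) (toShiftedPre_surjective S T)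
    (toPost_surjective R) (d := fun p => hS.joint p.1.1 (hT.joint p.1.2 p.2))
    (hS.joint_joint_total hT) fun p q => by
      rw [inner_toPre hS, inner_toShiftedPre hS hT, inner_toPost hR, hS.inner_joint,
        hT.inner_joint, mul_assoc]

end Bridge

/-! ### Images of the tensor subspaces and the factorisation -/

variable {k : Type*} [NormedAddCommGroup k] [InnerProductSpace ℂ k] [CompleteSpace k]
  {S T : Set ℝ≥0∞ → FockR k →L[ℂ] FockR k}

theorem coe_shiftedPreIncl (S T : Set ℝ≥0∞ → FockR k →L[ℂ] FockR k) (y : FockR k) :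
    shiftedPreIncl S T (toShiftedPre S T y) = toPost S (stopProj T ⊤ y) := rfl

theorem stopIso_shiftedPreIncl (hS : (fockFlow k).IsStop S) (hT : (fockFlow k).IsStop T)
    {j : preSpace S ⊗ᴴ postSpace S ≃ₗᵢ[ℂ] FockR k}
    (hj : ∀ y x, j (htmul (toPre S y) (toPost S x)) = hS.joint y x) (x y : FockR k) :
    j (htmul (toPre S x) (shiftedPreIncl S T (toShiftedPre S T y))) =
      hS.joint x (hT.proj y) := by
  rw [coe_shiftedPreIncl, hj, stopProj_top hT]

theorem coe_preSpace (hS : (fockFlow k).IsStop S) :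
    (preSpace S : Set (FockR k)) = LinearMap.range hS.proj.toLinearMap := by
  rw [preSpace, stopProj_top hS]

theorem coe_postSpace (hS : (fockFlow k).IsStop S) :
    (postSpace S : Set (FockR k)) = LinearMap.range (hS.joint vac).toLinearMap := by
  rw [postSpace, stopShift_eq hS]

theorem vac_mem_preSpace (hS : (fockFlow k).IsStop S) : vac ∈ preSpace S :=
  ⟨vac, by rw [stopProj_top hS]; exact hS.proj_vac⟩

theorem vac_mem_postSpace (hS : (fockFlow k).IsStop S) : vac ∈ postSpace S :=
  ⟨vac, by rw [stopShift_eq hS]; exact (hS.joint_vac vac).trans hS.proj_vac⟩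

theorem toPre_vac (hS : (fockFlow k).IsStop S) : toPre S vac = ⟨vac, vac_mem_preSpace hS⟩ :=
  Subtype.ext ((coe_toPre hS vac).trans hS.proj_vac)

theorem toPost_vac (hS : (fockFlow k).IsStop S) : toPost S vac = ⟨vac, vac_mem_postSpace hS⟩ :=
  Subtype.ext ((coe_toPost hS vac).trans ((hS.joint_vac vac).trans hS.proj_vac))

theorem image_closedSpan_of_surjective {ι κ A B E F : Type*} [NormedAddCommGroup E]
    [InnerProductSpace ℂ E] [NormedAddCommGroup F] [InnerProductSpace ℂ F] {a : ι → A} {b : κ → B}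
    (ha : Function.Surjective a) (hb : Function.Surjective b) (e : E ≃ₗᵢ[ℂ] F) (g : A → B → E)
    {d : ι → κ → F} (h : ∀ x y, e (g (a x) (b y)) = d x y) :
    e '' closedSpan {w | ∃ x y, w = g x y} = closedSpan {w | ∃ x y, w = d x y} := by
  rw [image_closedSpan]
  congr 1
  ext v
  constructor
  · rintro ⟨_, ⟨x, y, rfl⟩, rfl⟩
    obtain ⟨x, rfl⟩ := ha x
    obtain ⟨y, rfl⟩ := hb y
    exact ⟨x, y, h x y⟩
  · rintro ⟨x, y, rfl⟩
    exact ⟨_, ⟨a x, b y, rfl⟩, h x y⟩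

section Images

variable (hS : (fockFlow k).IsStop S) (hT : (fockFlow k).IsStop T)
  {R : Set ℝ≥0∞ → FockR k →L[ℂ] FockR k}
  {jS : preSpace S ⊗ᴴ postSpace S ≃ₗᵢ[ℂ] FockR k}
  {jST : (preSpace S ⊗ᴴ shiftedPre S T) ⊗ᴴ postSpace R ≃ₗᵢ[ℂ] FockR k}

theorem image_closedSpan_pre (hjS : ∀ y x, jS (htmul (toPre S y) (toPost S x)) = hS.joint y x) :
    jS '' (closedSpan {w | ∃ (a : preSpace S) (b : shiftedPre S T),
      w = htmul a (shiftedPreIncl S T b)}) =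
      closedSpan {w | ∃ x y, w = hS.joint x (hT.proj y)} := by
  exact image_closedSpan_of_surjective (toPre_surjective S) (toShiftedPre_surjective S T) jS
    (fun a b => htmul a (shiftedPreIncl S T b)) (stopIso_shiftedPreIncl hS hT hjS)

theorem image_closedSpan_vac_right
    (hj : ∀ x y z, jST (htmul (htmul (toPre S x) (toShiftedPre S T y)) (toPost R z)) =
      hS.joint x (hT.joint y z)) {v : postSpace R} (hv : toPost R vac = v) :
    jST '' (closedSpan {w | ∃ (a : preSpace S) (b : shiftedPre S T), w = htmul (htmul a b) v}) =
      closedSpan {w | ∃ x y, w = hS.joint x (hT.proj y)} := by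
  subst hv
  refine image_closedSpan_of_surjective (toPre_surjective S) (toShiftedPre_surjective S T) jST
    (fun a b => htmul (htmul a b) (toPost R vac)) fun x y => (hj x y vac).trans ?_
  exact congrArg (hS.joint x) (hT.joint_vac y)

theorem image_closedSpan_vac_left
    (hj : ∀ x y z, jST (htmul (htmul (toPre S x) (toShiftedPre S T y)) (toPost R z)) =
      hS.joint x (hT.joint y z)) {v : preSpace S} (hv : toPre S vac = v) :
    jST '' (closedSpan {w | ∃ (b : shiftedPre S T) (c : postSpace R),
      w = htmul (htmul v b) c}) =
      closedSpan {w | ∃ y z, w = hS.joint vac (hT.joint y z)} := by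
  subst hv
  exact image_closedSpan_of_surjective (toShiftedPre_surjective S T) (toPost_surjective R) jST
    (fun b c => htmul (htmul (toPre S vac) b) c) (hj vac)

end Images

/-- The hypothesis `hp`, supplied by `proj_conv`, puts elementary tensors into the pre-R space;
density extends this to the whole tensor product, so the codomain can be restricted. -/
theorem exists_restriction (hS : (fockFlow k).IsStop S) (hT : (fockFlow k).IsStop T)
    {R : Set ℝ≥0∞ → FockR k →L[ℂ] FockR k} (hR : (fockFlow k).IsStop R)
    {jS : preSpace S ⊗ᴴ postSpace S ≃ₗᵢ[ℂ] FockR k}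
    (hjS : ∀ y x, jS (htmul (toPre S y) (toPost S x)) = hS.joint y x)
    (hp : ∀ x y, hR.proj (hS.joint x (hT.proj y)) = hS.joint x (hT.proj y)) :
    ∃ J : preSpace S ⊗ᴴ shiftedPre S T →L[ℂ] preSpace R,
      (∀ u, (J u : FockR k) =
        jS (hmap (ContinuousLinearMap.id ℂ (preSpace S)) (shiftedPreIncl S T) u)) ∧
      ∀ x y, J (htmul (toPre S x) (toShiftedPre S T y)) = toPre R (hS.joint x (hT.proj y)) := by
  let L : preSpace S ⊗ᴴ shiftedPre S T →L[ℂ] FockR k :=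
    (jS.toContinuousLinearEquiv : _ →L[ℂ] FockR k).comp
      (hmap (ContinuousLinearMap.id ℂ (preSpace S)) (shiftedPreIncl S T))
  have hL : ∀ u, L u =
      jS (hmap (ContinuousLinearMap.id ℂ (preSpace S)) (shiftedPreIncl S T) u) := fun _ => rfl
  have hL' : ∀ x y, L (htmul (toPre S x) (toShiftedPre S T y)) = hS.joint x (hT.proj y) :=
    fun x y => by
      rw [hL, hmap_htmul]
      exact stopIso_shiftedPreIncl hS hT hjS x y
  have hpL : hR.proj.comp L = L :=
    clm_ext_of_total (htmul_total_of_surjective (toPre_surjective S)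
      (toShiftedPre_surjective S T)) fun p => by
        rw [ContinuousLinearMap.comp_apply, hL', hp]
  have hmem : ∀ u, L u ∈ preSpace R := fun u =>
    ⟨L u, by rw [stopProj_top hR]; exact congrArg (fun f : _ →L[ℂ] FockR k => f u) hpL⟩
  refine ⟨L.codRestrict (preSpace R) hmem, hL, fun x y => Subtype.ext ?_⟩
  rw [coe_toPre hR, hp]
  exact hL' x y

theorem stopIso_conv_eq {A B C : Type*} [NormedAddCommGroup A] [InnerProductSpace ℂ A]
    [NormedAddCommGroup B] [InnerProductSpace ℂ B] [NormedAddCommGroup C] [InnerProductSpace ℂ C]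
    {F D : Type*} [NormedAddCommGroup F] [InnerProductSpace ℂ F]
    [NormedAddCommGroup D] [InnerProductSpace ℂ D] {ι κ τ : Type*}
    {a : ι → A} {b : κ → B} {c : τ → C}
    (ha : Function.Surjective a) (hb : Function.Surjective b) (hc : Function.Surjective c)
    (j : (A ⊗ᴴ B) ⊗ᴴ C ≃ₗᵢ[ℂ] F) (j' : D ⊗ᴴ C ≃ₗᵢ[ℂ] F) (J : A ⊗ᴴ B →L[ℂ] D)
    (h : ∀ x y z, j (htmul (htmul (a x) (b y)) (c z)) = j' (htmul (J (htmul (a x) (b y))) (c z)))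
    (w : (A ⊗ᴴ B) ⊗ᴴ C) : j w = j' (hmap J (ContinuousLinearMap.id ℂ C) w) := by
  refine congrArg (fun f : _ →L[ℂ] F => f w) (clm_ext_of_total
    (f := (j.toContinuousLinearEquiv : _ →L[ℂ] F))
    (g := (j'.toContinuousLinearEquiv : _ →L[ℂ] F).comp (hmap J (ContinuousLinearMap.id ℂ C)))
    (htmul_htmul_total_of_surjective ha hb hc) fun p => ?_)
  change j _ = j' (hmap J _ _)
  rw [hmap_htmul, h]
  rfl

end

end StopTime

theorem mainTheorem6 {k : Type*} [NormedAddCommGroup k] [InnerProductSpace ℂ k] [CompleteSpace k]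
    (S T : Set ℝ≥0∞ → FockR k →L[ℂ] FockR k) (hS : IsFiniteStopTime S) (hT : IsFiniteStopTime T) :
    -- the isomorphisms `j_S`, `j_T`, the stop time `R = S ⋆ T` and the isomorphism `j_R`
    ∃ (jS : preSpace S ⊗ᴴ postSpace S ≃ₗᵢ[ℂ] FockR k)
      (jT : preSpace T ⊗ᴴ postSpace T ≃ₗᵢ[ℂ] FockR k)
      (R : Set ℝ≥0∞ → FockR k →L[ℂ] FockR k)
      (jR : preSpace R ⊗ᴴ postSpace R ≃ₗᵢ[ℂ] FockR k),
      (IsStopIso S jS ∧ IsStopIso T jT ∧ IsConvolution S T jS R ∧ IsFiniteStopTime R ∧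
        IsStopIso R jR) ∧
      (∀ Q ∈ ({S, T, R} : Set (Set ℝ≥0∞ → FockR k →L[ℂ] FockR k)),
        (∀ t, 0 < t → IsStopProj Q t (stopProj Q t)) ∧ IsStopShift Q (stopShift Q)) ∧
      -- the isometric isomorphism `j_{S, T}`
      ∃ jST : (preSpace S ⊗ᴴ shiftedPre S T) ⊗ᴴ postSpace R ≃ₗᵢ[ℂ] FockR k,
        (∀ x y z : FockR k,
          jST (htmul (htmul (toPre S x) (toShiftedPre S T y)) (toPost R z)) =
            jS (htmul (toPre S x) (toPost S (jT (htmul (toPre T y) (toPost T z)))))) ∧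
        (∃ h : vac ∈ postSpace R,
          jST '' (closedSpan {w | ∃ (a : preSpace S) (b : shiftedPre S T),
              w = htmul (htmul a b) (⟨vac, h⟩ : postSpace R)}) =
            jS '' (closedSpan {w | ∃ (a : preSpace S) (b : shiftedPre S T),
              w = htmul a (shiftedPreIncl S T b)}) ∧
          jS '' (closedSpan {w | ∃ (a : preSpace S) (b : shiftedPre S T),
              w = htmul a (shiftedPreIncl S T b)}) = preSpace R) ∧
        (∃ h : vac ∈ preSpace S,
          jST '' (closedSpan {w | ∃ (b : shiftedPre S T) (c : postSpace R),
              w = htmul (htmul (⟨vac, h⟩ : preSpace S) b) c}) = postSpace S) ∧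
        -- the restriction of `j_S` maps into the pre-`R` space, and `j_{S, T}` factorises
        ∃ J : preSpace S ⊗ᴴ shiftedPre S T →L[ℂ] preSpace R,
          (∀ u, (J u : FockR k) =
            jS (hmap (ContinuousLinearMap.id ℂ (preSpace S)) (shiftedPreIncl S T) u)) ∧
          ∀ w, jST w = jR (hmap J (ContinuousLinearMap.id ℂ (postSpace R)) w) := by
  rw [isFiniteStopTime_iff] at hS hT
  refine (exists_stopIso hS).elim fun jS hjS => ?_
  refine (exists_stopIso hT).elim fun jT hjT => ?_
  refine (exists_stopTensor hS hT hjS).elim fun P hP' => ?_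
  have hP := hP'.1
  have hPt := hP'.2
  have hR := hPt.isStop_conv
  refine (exists_stopIso hR).elim fun jR hjR => ?_
  refine (exists_stopIso_conv hS hT hR).elim fun jST hjST => ?_
  refine (exists_restriction hS hT hR hjS hPt.proj_conv).elim fun J hJ' => ?_
  have hpre := image_closedSpan_pre hS hT hjS
  have h1 := image_closedSpan_vac_right hS hT hjST (toPost_vac hR)
  have h2 := image_closedSpan_vac_left hS hT hjST (toPre_vac hS)
  have h3 := hPt.closedSpan_joint_proj.trans (coe_preSpace hR).symm
  have h4 := (hS.closedSpan_joint_vac hT).trans (coe_postSpace hS).symm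
  -- Both sides are bounded operators, and on elementary tensors their equality is `joint_conv`.
  have h5 := stopIso_conv_eq (toPre_surjective S) (toShiftedPre_surjective S T)
      (toPost_surjective (StopFlow.conv P)) jST jR J fun x y z => by
    rw [hjST, hJ'.2, hjR, hPt.joint_conv]
  refine ⟨jS, jT, StopFlow.conv P, jR, ⟨isStopIso_of_joint hS hjS, isStopIso_of_joint hT hjT,
    ⟨P, hP, fun C _ => rfl⟩, (isFiniteStopTime_iff _).2 hR, isStopIso_of_joint hR hjR⟩, ?_,
    jST, fun x y z => ?_, ⟨vac_mem_postSpace hR, h1.trans hpre.symm, hpre.trans h3⟩,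
    ⟨vac_mem_preSpace hS, h2.trans h4⟩, J, hJ'.1, h5⟩
  · intro Q hQ
    have hQ' : (fockFlow k).IsStop Q := by
      rcases hQ with rfl | rfl | rfl
      exacts [hS, hT, hR]
    exact ⟨fun t ht => isStopProj_stopProj hQ' ht, isStopShift_stopShift hQ'⟩
  · rw [hjST, hjT, hjS]
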